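/- **Model.** Let $\mathbf W_i=(W_i^+,W_i^-,Q_i,\zeta_i)\in\mathbb R_+^2\times\mathbb R^2$, $i\ge 1$, be i.i.d. copies of $(W^+,W^-,Q,\zeta)$, write $\mathscr W_n=(\mathbf W_1,\dots,\mathbf W_n)$, and let $\theta=E[W^++W^-]>0$. Given the types, the digraph $\mathcal G(V_n,E_n)$ on $V_n=\{1,\dots,n\}$ has independent edges, and $(i,j)$, $i\ne j$, is an edge with probability $$p_{ij}^{(n)}=1\wedge\frac{W_i^-W_j^+}{\theta n}\bigl(1+\varphi_{ij}(n)\bigr),\qquad \varphi_{ij}(n)=\varphi(n,\mathbf W_i,\mathbf W_j,\mathscr W_n)>-1\ \text{a.s.},$$ where $n^{-1}\sum_{i\neq j}p^{(n)}_{ij}\to E[W^+]E[W^-]/\theta$ a.s. Put $q_{ij}^{(n)}=W_i^-W_j^+/(\theta n)$ for all $i,j$. **Assumption.** (a) There are $\delta\in(0,1]$, $c\in(0,1)$ with $E[(W^+)^{1+\delta}+(W^-)^2+|Q|]<\infty$, $|\zeta|\le c$ a.s., and $(W^+,Q)$ independent of $(W^-,\zeta)$. (b) There are $\eta\in(0,1]$,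 $\kappa>0$ such that for all $n\ge1$, $P\bigl(\max_{2\le j\le n}|\varphi_{1j}(n)|\le n^{-\eta},\ \max_{2\le j\le n}|\varphi_{j1}(n)|\le n^{-\eta}\bigr)\ge 1-n^{-\kappa}$. **Rank in the graph.** Let $\xi$ be uniform on $V_n$, let $D_i^-$ be the out-degree of $i$, $M_{ij}=\zeta_i/D_i^-$ if $(i,j)\in E_n$ and $M_{ij}=0$ otherwise, and let $R_\xi^{(n,k)}$ be the $\xi$-th coordinate of $\sum_{m=0}^k \mathbf Q M^m$, where $\mathbf Q=(Q_1,\dots,Q_n)$. **Coupled tree.** Let $U_{ij}$, $1\le i,j\le n$, be i.i.d. uniform on $(0,1)$, and independent of the types and of $\xi$. The edge $(i,j)$, $i\neq j$, is present iff $X_{ij}=1(U_{ij}>1-p_{ij}^{(n)})=1$. Let $Z_{ij}$ be the Poisson($q_{ij}^{(n)}$) quantile of $U_{ij}$. Let $Z^*_{\mathbf u,t}$ denote independent variables, independent of everything else, with $Z^*_{\mathbf u,t}\sim$ Poisson($q_{jt}^{(n)}$) if the node $\mathbf u$ has type $j$. The tree has nodes with types in $V_n$. Each node $\mathbf u$ gets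 a mark $\mathcal D_{\mathbf u}=1+\sum_{t=1}^n m_{\mathbf u}(t)$, and $m_{\mathbf u}(t)$ *inactive* nodes of type $t$, $1\le t\le n$, are attached to it. In Step $0$ the root $\emptyset$ gets the type $\xi$, $m_\emptyset(t)=Z_{\xi t}$ for $t\neq \xi$ and $m_\emptyset(\xi)=Z^*_{\emptyset,\xi}$. In Step $k\ge1$ the nodes of generation $k-1$ are explored one after the other, in the order in which they were added. Let $\mathbf u$, of type $i$, be the node being explored; a type is dead if a node of that type has been explored before. * If $\mathbf u$ is the first node of type $i$ in the tree, it gets $Z_{ji}$ offspring of each type $j$ (first the types $j\ne i$ in increasing order, then $j=i$). If $j\ne i$, $Z_{ji}\ge1$ and there is no earlier node of type $j$ in the tree, then the first of these offspring, $\mathbf v$, has $m_{\mathbf v}(t)=Z_{jt}$ for all $t\ne j,i$ that are not dead and $m_{\mathbf v}(t)=Z^*_{\mathbf v,t}$ for the other $t$. All other offspring $\mathbf v$ have $m_{\mathbf v}(t)=Z^*_{\mathbf v,t}$ for all $t$. * Otherwise $\mathbf u$ gets independent fresh Poisson($q_{ji}^{(n)}$) numbers of offspring of each type $j$, and these offspring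 $\mathbf v$ have $m_{\mathbf v}(t)=Z^*_{\mathbf v,t}$ for all $t$. The rank $\hat R_\emptyset^{(n,k)}$ of the root is defined through $\hat R_{\mathbf u}^{(n,0)}=Q_s$ and $\hat R_{\mathbf u}^{(n,k)}=Q_s+\sum_{\mathbf v}\frac{\zeta_{s(\mathbf v)}}{\mathcal D_{\mathbf v}}\hat R_{\mathbf v}^{(n,k-1)}$, $k\ge 1$, where $s$ is the type of $\mathbf u$, the sum is over the offspring $\mathbf v$ of $\mathbf u$, and $s(\mathbf v)$ is the type of $\mathbf v$. **Breaking of the coupling.** Let $T_l$ be the set of vertices with a directed path of length at most $l$ to $\xi$, let $A_l=T_l\setminus T_{l-1}$ ($A_0=T_0=\{\xi\}$), and let $I_{|T_l|}$ be the set of vertices outside $T_l$ with an inbound edge from $T_l$. Let $\hat A_l$ be the set of nodes of generation $l$, and let $\hat I_{|\hat T_l|}$ be the set of inactive nodes attached to nodes of generations $0,\dots,l$. The coupling holds up to Step $k$ if the two explorations are identical: for each $l\le k$, the type map sends $\hat A_l$ bijectively to $A_l$ and $\hat I_{|\hat T_l|}$ bijectively to $I_{|T_l|}$, and for each $\mathbf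 u\in\hat A_l$ of type $j$ and each $t$, $(j,t)$ is an edge iff $t$ is the type of the parent of $\mathbf u$ or $m_{\mathbf u}(t)\ge1$. Let $\tau\in\mathbb N\cup\{\infty\}$ be the first step $k$ up to which the coupling does not hold. **Statement.** Let $\gamma=\min\{\delta/2,\eta\}$, $\mu_n=(\theta n)^{-1}\sum_{i=1}^nW_i^+W_i^-$, and $$B_i=\Bigl\{\max_{j\ne i}|\varphi_{ji}(n)|\le n^{-\eta},\ \max_{1\le j\le n}q_{ji}^{(n)}\le\tfrac14\Bigr\},\qquad \tilde B_i=\Bigl\{\max_{j\ne i}|\varphi_{ij}(n)|\le n^{-\eta},\ \max_{1\le j\le n}q_{ij}^{(n)}\le\tfrac14\Bigr\}.$$ Under the assumption, for any $k_n\in\mathbb N$ and $x_n\in\mathbb R$ with $k_n,x_n\to\infty$ and $$n^{-\delta}x_n\sum_{m=1}^{k_n}\sum_{r=0}^{m-1}\mu_n^{m+r}+\Bigl(n^{-\gamma}+n^{-1}\sum_{i=1}^n1(B_i^c\cup\tilde B_i^c)(W_i^-\vee1)\Bigr)\sum_{m=0}^{k_n}\mu_n^m\ \xrightarrow{P}\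 0,$$ we have $$P\bigl(R_\xi^{(n,k_n)}\ne\hat R_\emptyset^{(n,k_n)}\bigr)\le P(\tau\le k_n)\ \text{ for all } n\ge 1,\qquad P(\tau\le k_n)\to0\quad(n\to\infty).$$ -/

import Mathlib

open MeasureTheory ProbabilityTheory Filter Topology
open scoped NNReal ENNReal BigOperators

noncomputable section

/-! ### Vertex types, edge probabilities and the random digraph -/

/-- A vertex type `(W⁺, W⁻, Q, ζ)`, an element of `ℝ₊ × ℝ₊ × ℝ × ℝ`. -/
abbrev VertexType : Type := ℝ≥0 × ℝ≥0 × ℝ × ℝ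

/-- The attribute `W⁺` of a type, which governs the in-degree. -/
def wPlus (v : VertexType) : ℝ := v.1

/-- The attribute `W⁻` of a type, which governs the out-degree. -/
def wMinus (v : VertexType) : ℝ := v.2.1

/-- The personalization value `Q` of a type. -/
def persQ (v : VertexType) : ℝ := v.2.2.1

/-- The weight `ζ` of a type. -/
def weightZ (v : VertexType) : ℝ := v.2.2.2

/-- A correction term `φ(n, W_i, W_j, (W_1, …, W_n))` of the edge probabilities. -/
abbrev EdgeCorrection : Type :=
  (n : ℕ) → VertexType → VertexType → (Fin n → VertexType) → ℝ

/-- `φ_{ij}(n)` for the type sequence `w`. -/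
def phiTerm (φ : EdgeCorrection) {n : ℕ} (w : Fin n → VertexType) (i j : Fin n) : ℝ :=
  φ n (w i) (w j) w

/-- `q_{ij}^{(n)} = W_i⁻ W_j⁺ / (θ n)`. -/
def qRate (θ : ℝ) {n : ℕ} (w : Fin n → VertexType) (i j : Fin n) : ℝ :=
  wMinus (w i) * wPlus (w j) / (θ * n)

/-- `p_{ij}^{(n)} = 1 ∧ (W_i⁻ W_j⁺ / (θ n)) (1 + φ_{ij}(n))`. -/
def edgeProb (θ : ℝ) (φ : EdgeCorrection) {n : ℕ} (w : Fin n → VertexType)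
    (i j : Fin n) : ℝ :=
  min 1 (qRate θ w i j * (1 + phiTerm φ w i j))

/-- Nodes of the branching tree on the types `Fin n`. The root is `[]`; the `r`-th offspring
(`r = 0, 1, …`) of type `j` of the node `u` is `(j, r) :: u`. -/
abbrev TreeNode (n : ℕ) : Type := List (Fin n × ℕ)

/-- All the randomness besides the types: the uniformly chosen vertex `ξ`, the uniform variables
`U_{ij}` shared by the graph and the tree, the uniform variables `V_{u,j}` from which a node `u`
that repeats a type draws its offspring, and the uniform variables from which the independent
(starred) parts of the marks are drawn. -/
abbrev Seed (n : ℕ) : Type :=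
  Fin n × (Fin n × Fin n → unitInterval) × (TreeNode n × Fin n → unitInterval) ×
    (TreeNode n × Fin n → unitInterval)

/-- The law of the seed: all its components are independent and uniform. -/
def seedLaw (n : ℕ) : Measure (Seed n) :=
  (uniformOn (Set.univ : Set (Fin n))).prod
    ((Measure.infinitePi fun _ : Fin n × Fin n => (volume : Measure unitInterval)).prod
      ((Measure.infinitePi fun _ : TreeNode n × Fin n => (volume : Measure unitInterval)).prod
        (Measure.infinitePi fun _ : TreeNode n × Fin n => (volume : Measure unitInterval))))

/-- The uniformly chosen vertex `ξ`. -/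
def seedRoot {n : ℕ} (s : Seed n) : Fin n := s.1

/-- The shared uniform variable `U_{ij}`. -/
def seedU {n : ℕ} (s : Seed n) (i j : Fin n) : ℝ := s.2.1 (i, j)

/-- The uniform variable `V_{u,j}` for the type `j` offspring of the node `u`. -/
def seedV {n : ℕ} (s : Seed n) (u : TreeNode n) (j : Fin n) : ℝ := s.2.2.1 (u, j)

/-- The uniform variable for the independent part of type `t` of the mark of the node `u`. -/
def seedStar {n : ℕ} (s : Seed n) (u : TreeNode n) (t : Fin n) : ℝ := s.2.2.2 (u, t)

/-- The edge `(i, j)` is present: `i ≠ j` and `U_{ij} > 1 - p_{ij}`. -/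
def IsEdge (θ : ℝ) (φ : EdgeCorrection) {n : ℕ} (w : Fin n → VertexType) (s : Seed n)
    (i j : Fin n) : Prop :=
  i ≠ j ∧ 1 - edgeProb θ φ w i j < seedU s i j

open Classical in
/-- The out-degree `D_i⁻`. -/
def outDegree (θ : ℝ) (φ : EdgeCorrection) {n : ℕ} (w : Fin n → VertexType) (s : Seed n)
    (i : Fin n) : ℕ :=
  (Finset.univ.filter fun j => IsEdge θ φ w s i j).card

open Classical in
/-- The matrix with entry `C_i = ζ_i / D_i⁻` at `(i, j)` if `(i, j)` is an edge, and `0`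
otherwise. -/
def rankMatrix (θ : ℝ) (φ : EdgeCorrection) {n : ℕ} (w : Fin n → VertexType) (s : Seed n) :
    Matrix (Fin n) (Fin n) ℝ :=
  Matrix.of fun i j =>
    if IsEdge θ φ w s i j then weightZ (w i) / (outDegree θ φ w s i : ℝ) else 0

/-- The rank `R_ξ^{(n,k)}` of the chosen vertex: the `ξ`-th coordinate of
`∑_{i=0}^k Q M^i`. -/
def graphRank (θ : ℝ) (φ : EdgeCorrection) {n : ℕ} (w : Fin n → VertexType) (s : Seed n)
    (k : ℕ) : ℝ :=
  (∑ m ∈ Finset.range (k + 1),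
    Matrix.vecMul (fun i => persQ (w i)) (rankMatrix θ φ w s ^ m)) (seedRoot s)

/-! ### Exploration of the in-component in the graph -/

/-- `T_k`: the vertices with a directed path of length at most `k` to the chosen vertex. -/
def graphWithin (θ : ℝ) (φ : EdgeCorrection) {n : ℕ} (w : Fin n → VertexType) (s : Seed n) :
    ℕ → Set (Fin n)
  | 0 => {seedRoot s}
  | k + 1 => graphWithin θ φ w s k ∪
      {j | ∃ i ∈ graphWithin θ φ w s k, IsEdge θ φ w s j i}

/-- `A_k`: the active vertices at the end of Step `k`, i.e. those discovered in Step `k`. -/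
def graphActive (θ : ℝ) (φ : EdgeCorrection) {n : ℕ} (w : Fin n → VertexType) (s : Seed n) :
    ℕ → Set (Fin n)
  | 0 => {seedRoot s}
  | k + 1 => graphWithin θ φ w s (k + 1) \ graphWithin θ φ w s k

/-- The inactive vertices at the end of Step `k`: the vertices that are neither active nor dead
and have an inbound edge from an active or dead vertex. -/
def graphInactive (θ : ℝ) (φ : EdgeCorrection) {n : ℕ} (w : Fin n → VertexType) (s : Seed n)
    (k : ℕ) : Set (Fin n) :=
  {t | t ∉ graphWithin θ φ w s k ∧ ∃ j ∈ graphWithin θ φ w s k, IsEdge θ φ w s j t}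

/-! ### The coupled Poisson branching tree -/

/-- The generalized inverse at `u ∈ (0, 1)` of the Poisson distribution function with mean `q`. -/
def poissonQuantile (q u : ℝ) : ℕ :=
  sInf {m : ℕ | u ≤ ∑ t ∈ Finset.range (m + 1), Real.exp (-q) * q ^ t / (t.factorial : ℝ)}

/-- The coupled variable `Z_{ji} = G_{ji}⁻¹(U_{ji})`. -/
def coupledZ (θ : ℝ) {n : ℕ} (w : Fin n → VertexType) (s : Seed n) (j i : Fin n) : ℕ :=
  poissonQuantile (qRate θ w j i) (seedU s j i)

/-- The type of a node, given the type `ξ` of the root. -/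
def nodeType {n : ℕ} (ξ : Fin n) : TreeNode n → Fin n
  | [] => ξ
  | (j, _) :: _ => j

/-- The type of the parent of a node (`none` for the root). -/
def parentType {n : ℕ} (ξ : Fin n) : TreeNode n → Option (Fin n)
  | [] => none
  | _ :: v => some (nodeType ξ v)

/-- A stage of the construction of the tree: the nodes added so far, in the order in which they
were added; the set of types of the nodes whose offspring have been determined ("dead" types); and,
for each node `u` and type `t`, the number `mark u t` of inactive nodes of type `t` created with the
mark of `u`. The mark is `𝒟_u = 1 + ∑_t mark u t`. -/
structure TreeState (n : ℕ) where
  nodes : List (TreeNode n)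
  dead : Finset (Fin n)
  mark : TreeNode n → Fin n → ℕ

/-- An independent Poisson variable `Z*` with mean `q_{jt}`, for the mark of a node `u` of
type `j`. -/
def starZ (θ : ℝ) {n : ℕ} (w : Fin n → VertexType) (s : Seed n) (u : TreeNode n) (j t : Fin n) :
    ℕ :=
  poissonQuantile (qRate θ w j t) (seedStar s u t)

/-- Step 0: the root has type `ξ`; its mark uses `Z_{ξt}` for `t ≠ ξ` and `Z*_{ξξ}`. -/
def treeStart (θ : ℝ) {n : ℕ} (w : Fin n → VertexType) (s : Seed n) : TreeState n where
  nodes := [[]]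
  dead := ∅
  mark := fun _ t =>
    if t = seedRoot s then starZ θ w s [] (seedRoot s) t else coupledZ θ w s (seedRoot s) t

/-- The number of type `j` offspring of the node `u`: `Z_{ji} = G_{ji}⁻¹(U_{ji})` if `u` is the
first node of its type `i`, and `G_{ji}⁻¹(V_{u,j})` otherwise. Since nodes are explored in the order
in which they were added, `u` is the first node of its type iff its type is not yet dead. -/
def offspringCount (θ : ℝ) {n : ℕ} (w : Fin n → VertexType) (s : Seed n) (S : TreeState n)
    (u : TreeNode n) (j : Fin n) : ℕ :=
  let i := nodeType (seedRoot s) u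
  if i ∈ S.dead then poissonQuantile (qRate θ w j i) (seedV s u j) else coupledZ θ w s j i

/-- The offspring of the node `u`: those of the types `j ≠ i` in increasing order of `j`, then
those of the type `i` of `u` itself. -/
def offspring (θ : ℝ) {n : ℕ} (w : Fin n → VertexType) (s : Seed n) (S : TreeState n)
    (u : TreeNode n) : List (TreeNode n) :=
  let i := nodeType (seedRoot s) u
  ((List.finRange n).filter (fun j => j ≠ i) ++ [i]).flatMap fun j =>
    (List.range (offspringCount θ w s S u j)).map fun r => (j, r) :: u

open Classical in
/-- The numbers of inactive nodes of each type `t` created with the mark of the offspring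
`(j, r) :: u`. If `u` is the first node of its type `i`, if `j ≠ i`, if there was no node of type `j`
in the tree before, and if `r = 0`, then the shared `Z_{jt}` are used for the `t ≠ j, i` that are
not dead. In all other cases independent `Z*` are used (so that the mark minus one is Poisson
with mean `∑_t q_{jt}`). -/
def offspringMark (θ : ℝ) {n : ℕ} (w : Fin n → VertexType) (s : Seed n) (S : TreeState n)
    (u : TreeNode n) (j : Fin n) (r : ℕ) (t : Fin n) : ℕ :=
  let i := nodeType (seedRoot s) u
  if i ∉ S.dead ∧ j ≠ i ∧ (∀ v ∈ S.nodes, nodeType (seedRoot s) v ≠ j) ∧ r = 0 ∧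
      t ≠ j ∧ t ≠ i ∧ t ∉ S.dead
  then coupledZ θ w s j t
  else starZ θ w s ((j, r) :: u) j t

/-- Exploration of one node `u`: its offspring and their marks are added and its type becomes
dead. -/
def exploreNode (θ : ℝ) {n : ℕ} (w : Fin n → VertexType) (s : Seed n) (S : TreeState n)
    (u : TreeNode n) : TreeState n where
  nodes := S.nodes ++ offspring θ w s S u
  dead := insert (nodeType (seedRoot s) u) S.dead
  mark := fun v =>
    match v with
    | [] => S.mark []
    | (j, r) :: u' => if u' = u then offspringMark θ w s S u j r else S.mark ((j, r) :: u')

/-- The tree at the end of Step `k`. In Step `k + 1` the nodes of generation `k` are explored in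
the order in which they were added. -/
def coupledTree (θ : ℝ) {n : ℕ} (w : Fin n → VertexType) (s : Seed n) : ℕ → TreeState n
  | 0 => treeStart θ w s
  | k + 1 =>
      ((coupledTree θ w s k).nodes.filter fun u => u.length = k).foldl
        (exploreNode θ w s) (coupledTree θ w s k)

/-- `Â_k`: the nodes of generation `k`. -/
def treeActive (θ : ℝ) {n : ℕ} (w : Fin n → VertexType) (s : Seed n) (k : ℕ) :
    Set (TreeNode n) :=
  {u | u ∈ (coupledTree θ w s k).nodes ∧ u.length = k}

/-- `Î` at the end of Step `k`: the inactive nodes created with the marks of the nodes of the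
tree. The triple `(u, t, r)` is the `r`-th inactive node of type `t` created with the mark of `u`. -/
def treeInactive (θ : ℝ) {n : ℕ} (w : Fin n → VertexType) (s : Seed n) (k : ℕ) :
    Set (TreeNode n × Fin n × ℕ) :=
  {x | x.1 ∈ (coupledTree θ w s k).nodes ∧ x.2.2 < (coupledTree θ w s k).mark x.1 x.2.1}

/-- The rank of the node `u` of the tree `S` computed from its descendants in the next `k`
generations: `R̂_u^{(0)} = Q̂_u` and `R̂_u^{(k+1)} = ∑_v Ĉ_v R̂_v^{(k)} + Q̂_u`, the sum being over the
offspring `v` of `u`, with `Ĉ_v = ζ_v / 𝒟_v`. -/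
def nodeRank {n : ℕ} (w : Fin n → VertexType) (ξ : Fin n) (S : TreeState n) :
    ℕ → TreeNode n → ℝ
  | 0, u => persQ (w (nodeType ξ u))
  | k + 1, u =>
      ((S.nodes.filter fun v => v ≠ [] ∧ v.tail = u).map fun v =>
        weightZ (w (nodeType ξ v)) / (1 + ∑ t, (S.mark v t : ℝ)) * nodeRank w ξ S k v).sum
      + persQ (w (nodeType ξ u))

/-- The rank `R̂_∅^{(n,k)}` of the root of the coupled tree, computed up to generation `k`. -/
def treeRank (θ : ℝ) {n : ℕ} (w : Fin n → VertexType) (s : Seed n) (k : ℕ) : ℝ :=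
  nodeRank w (seedRoot s) (coupledTree θ w s k) k []

/-! ### The step at which the coupling breaks -/

/-- The coupling holds up to Step `k`: the exploration of the graph and that of the tree are
identical, i.e. for each `l ≤ k`, identifying each node with the vertex of its type, `Â_l = A_l` and
the inactive sets agree (in particular no type is repeated), and the edges discovered agree: the
outbound edges of the vertex of an active node lead to its parent and to the inactive nodes created
with its mark. -/
def CouplingHolds (θ : ℝ) (φ : EdgeCorrection) {n : ℕ} (w : Fin n → VertexType) (s : Seed n)
    (k : ℕ) : Prop :=
  ∀ l ≤ k,
    Set.BijOn (nodeType (seedRoot s)) (treeActive θ w s l) (graphActive θ φ w s l) ∧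
    Set.BijOn (fun x => x.2.1) (treeInactive θ w s l) (graphInactive θ φ w s l) ∧
    ∀ u ∈ treeActive θ w s l, ∀ t : Fin n,
      IsEdge θ φ w s (nodeType (seedRoot s) u) t ↔
        parentType (seedRoot s) u = some t ∨ 1 ≤ (coupledTree θ w s l).mark u t

/-- `τ`: the step during which the coupling breaks (`⊤` if it never does). -/
def couplingBreak (θ : ℝ) (φ : EdgeCorrection) {n : ℕ} (w : Fin n → VertexType) (s : Seed n) :
    ℕ∞ :=
  sInf {m : ℕ∞ | ∃ l : ℕ, m = l ∧ ¬ CouplingHolds θ φ w s l}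

/-! ### The error expression -/

/-- The event `B_i`. -/
def EventB (θ : ℝ) (φ : EdgeCorrection) (η : ℝ) {n : ℕ} (w : Fin n → VertexType) (i : Fin n) :
    Prop :=
  (∀ j, j ≠ i → |phiTerm φ w j i| ≤ (n : ℝ) ^ (-η)) ∧ ∀ j, qRate θ w j i ≤ 1 / 4

/-- The event `B̃_i`. -/
def EventBTilde (θ : ℝ) (φ : EdgeCorrection) (η : ℝ) {n : ℕ} (w : Fin n → VertexType)
    (i : Fin n) : Prop :=
  (∀ j, j ≠ i → |phiTerm φ w i j| ≤ (n : ℝ) ^ (-η)) ∧ ∀ j, qRate θ w i j ≤ 1 / 4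

/-- `μ_n = (θ n)⁻¹ ∑_i W_i⁺ W_i⁻`. -/
def muMean (θ : ℝ) {n : ℕ} (w : Fin n → VertexType) : ℝ :=
  (θ * n)⁻¹ * ∑ i, wPlus (w i) * wMinus (w i)

open Classical in
/-- The expression
`n^{-δ} x ∑_{m=1}^k ∑_{r=0}^{m-1} μ_n^{m+r}
  + (n^{-γ} + n⁻¹ ∑_i 1(B_iᶜ ∪ B̃_iᶜ) (W_i⁻ ∨ 1)) ∑_{m=0}^k μ_n^m` with `γ = min {δ/2, η}`. -/
def couplingError (θ : ℝ) (φ : EdgeCorrection) (δ η : ℝ) (k : ℕ) (x : ℝ) {n : ℕ}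
    (w : Fin n → VertexType) : ℝ :=
  (n : ℝ) ^ (-δ) * x *
      ∑ m ∈ Finset.Icc 1 k, ∑ r ∈ Finset.range m, muMean θ w ^ (m + r) +
    ((n : ℝ) ^ (-(min (δ / 2) η)) +
        (n : ℝ)⁻¹ * ∑ i, if ¬ EventB θ φ η w i ∨ ¬ EventBTilde θ φ η w i
          then max (wMinus (w i)) 1 else 0) *
      ∑ m ∈ Finset.range (k + 1), muMean θ w ^ m

end

/-! ### Breadth-first exploration of the in-component of a vertex -/

/-! Given the types, the graph and the tree are both compared with a third object: the Poisson
digraph on `V_n`, in which `(j, t)` is an edge when the coupled variable `Z_{jt}` is at least 1. The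
in-component of `ξ` in it is explored breadth first. A level is free of defects (`NoDefect`) if the
edge indicators met there agree with the `Z`'s, no explored vertex points into the level, no vertex
points to two vertices of the level, no vertex of the level shares a target outside the earlier
levels with another explored vertex, and the independent parts of the marks vanish at the explored
types and at the type itself.

The deterministic half says that without defects up to distance `k` the graph and the tree both
coincide with this exploration (`foldInvariant_coupledTree`, `couplingHolds_of_noDefect`), so `τ >
k`. While the coupling holds, the out-degree of an explored vertex other than `ξ` is the mark of its
node, and both ranks satisfy the same recursion (`graphRank_eq_treeRank`). This proves the first
claim pointwise.

The probabilistic half is a first-moment bound given the types. The levels up to `r` are determined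
by the edges into vertices at distance less than `r`; edges into all other vertices are independent
of that history (`expect_mul_ind`). Hence the total weight `P_r` of `W⁺` over level `r` has
conditional mean growth at most `μ_n`, so `P_r / μ_n ^ r` behaves like a supermartingale, and
outside an event of probability `O(1 / x)`, and as long as only good vertices are met, `P_r ≤ x μ_n
^ r` at all levels simultaneously (`expect_weight_exceeds_le`).

Under this control a collision, which involves two weights, is estimated by replacing one of them by
its bound and averaging the other. This yields `x μ_n ^ r ∑_{l ≤ r} μ_n ^ l` times a rate of order
`n ^ (-δ)`; the slow rate comes from `n⁻² ∑ (W⁺)²`, since `W⁺` has only `1 + δ` moments. Mismatches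
at a vertex where `B_i` and `B̃_i` occur cost order `n ^ (-γ)` on average, and reaching a vertex
where one of them fails gives the term with `W⁻ ∨ 1`: the root is uniform, a later vertex is reached
with probability proportional to its `W⁻`. Summation over the levels bounds the conditional
probability of a defect by `C (1 / x_n + error)` (`expect_defects_le_couplingError`), where `C`
depends on the types only through an upper bound `K` for the average of `(1 + (W⁻)²)(1 +
(W⁺)^(1+δ))` and a lower bound `c₀` for `μ_n`.

The law of large numbers supplies `K` and `c₀`; independence of `W⁺` and `W⁻` makes the product
moment finite. If `E[W⁺ W⁻] = 0` there is no such `c₀`, but then one of the two weights vanishes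
a.s., there are no edges, and the coupling never breaks. -/

open Classical in
/-- The explored vertices and the active vertices after `r` steps of the breadth-first exploration
of the in-component of `ξ` in the digraph with adjacency relation `g`. -/
noncomputable def exploration {n : ℕ} (g : Fin n → Fin n → Prop) (ξ : Fin n) :
    ℕ → Finset (Fin n) × Finset (Fin n)
  | 0 => (∅, {ξ})
  | r + 1 => ((exploration g ξ r).1 ∪ (exploration g ξ r).2,
      Finset.univ.filter fun j => j ∉ (exploration g ξ r).1 ∪ (exploration g ξ r).2 ∧
        ∃ t ∈ (exploration g ξ r).2, g j t)

/-- The vertices at distance less than `r`. -/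
noncomputable def deadSet {n : ℕ} (g : Fin n → Fin n → Prop) (ξ : Fin n) (r : ℕ) :
    Finset (Fin n) := (exploration g ξ r).1

/-- The vertices at distance `r`. -/
noncomputable def actSet {n : ℕ} (g : Fin n → Fin n → Prop) (ξ : Fin n) (r : ℕ) :
    Finset (Fin n) := (exploration g ξ r).2

open Classical in
/-- A neighbour of `j` at distance `r`, if there is one. -/
noncomputable def bfsParent {n : ℕ} (g : Fin n → Fin n → Prop) (ξ : Fin n) (r : ℕ) (j : Fin n) :
    Fin n :=
  if h : ∃ t ∈ actSet g ξ r, g j t then h.choose else j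

/-- The node of the tree that corresponds to a vertex at distance `r`. -/
noncomputable def bfsPath {n : ℕ} (g : Fin n → Fin n → Prop) (ξ : Fin n) :
    ℕ → Fin n → TreeNode n
  | 0, _ => []
  | r + 1, j => (j, 0) :: bfsPath g ξ r (bfsParent g ξ r j)

section Exploration

variable {n : ℕ} {g g' : Fin n → Fin n → Prop} {ξ : Fin n}

@[simp] lemma deadSet_zero : deadSet g ξ 0 = ∅ := rfl

@[simp] lemma actSet_zero : actSet g ξ 0 = {ξ} := rfl

lemma deadSet_succ (r : ℕ) : deadSet g ξ (r + 1) = deadSet g ξ r ∪ actSet g ξ r := rfl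

lemma mem_actSet_succ {r : ℕ} {j : Fin n} :
    j ∈ actSet g ξ (r + 1) ↔ j ∉ deadSet g ξ (r + 1) ∧ ∃ t ∈ actSet g ξ r, g j t := by
  simp only [actSet, deadSet, exploration, Finset.mem_filter, Finset.mem_univ, true_and]

lemma mem_deadSet {r : ℕ} {j : Fin n} : j ∈ deadSet g ξ r ↔ ∃ l < r, j ∈ actSet g ξ l := by
  induction r with
  | zero => simp
  | succ r ih =>
    rw [deadSet_succ, Finset.mem_union, ih]
    constructor
    · rintro (⟨l, hl, h⟩ | h)
      exacts [⟨l, by omega, h⟩, ⟨r, by omega, h⟩]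
    · rintro ⟨l, hl, h⟩
      rcases Nat.lt_succ_iff_lt_or_eq.1 hl with hl | rfl
      exacts [Or.inl ⟨l, hl, h⟩, Or.inr h]

lemma notMem_deadSet_of_mem_actSet {r : ℕ} {j : Fin n} (h : j ∈ actSet g ξ r) :
    j ∉ deadSet g ξ r := by
  cases r with
  | zero => simp
  | succ r => exact (mem_actSet_succ.1 h).1

lemma actSet_level_unique {r s : ℕ} {j : Fin n} (hr : j ∈ actSet g ξ r) (hs : j ∈ actSet g ξ s) :
    r = s := by
  rcases lt_trichotomy r s with h | h | h
  · exact absurd (mem_deadSet.2 ⟨r, h, hr⟩) (notMem_deadSet_of_mem_actSet hs)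
  · exact h
  · exact absurd (mem_deadSet.2 ⟨s, h, hs⟩) (notMem_deadSet_of_mem_actSet hr)

lemma deadSet_mono {l r : ℕ} (h : l ≤ r) : deadSet g ξ l ⊆ deadSet g ξ r := by
  intro j hj
  obtain ⟨m, hm, hj⟩ := mem_deadSet.1 hj
  exact mem_deadSet.2 ⟨m, by omega, hj⟩

lemma mem_deadSet_succ {r : ℕ} {j : Fin n} :
    j ∈ deadSet g ξ (r + 1) ↔ j ∈ deadSet g ξ r ∨ j ∈ actSet g ξ r := by
  rw [deadSet_succ, Finset.mem_union]

lemma mem_union_iff_mem_deadSet {r : ℕ} {j : Fin n} :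
    j ∈ deadSet g ξ (r + 1) ↔ ∃ l ≤ r, j ∈ actSet g ξ l := by
  rw [mem_deadSet]
  simp only [Nat.lt_succ_iff]

/-- The exploration depends only on the edges into explored vertices. -/
lemma exploration_congr {r : ℕ} (h : ∀ t ∈ deadSet g ξ r, ∀ j, g j t ↔ g' j t) :
    ∀ l ≤ r, exploration g ξ l = exploration g' ξ l := by
  intro l
  induction l with
  | zero => intro _; rfl
  | succ l ih =>
    intro hl
    have e := ih (by omega)
    have hA : ∀ j t, t ∈ (exploration g ξ l).2 → (g j t ↔ g' j t) := fun j t ht =>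
      h t (mem_deadSet.2 ⟨l, by omega, ht⟩) j
    rw [exploration, exploration, ← e]
    refine congrArg₂ Prod.mk rfl ?_
    ext j
    simp only [Finset.mem_filter, Finset.mem_univ, true_and]
    refine and_congr Iff.rfl (exists_congr fun t => ?_)
    constructor
    · rintro ⟨ht, hg⟩; exact ⟨ht, (hA j t ht).1 hg⟩
    · rintro ⟨ht, hg⟩; exact ⟨ht, (hA j t ht).2 hg⟩

/-- The edges into a vertex are inspected only once it is dead, so changing the edges into a vertex
not yet dead leaves the levels up to `r` unchanged. All independence statements below rest on this.
-/
lemma exploration_congr_column {r : ℕ} {t : Fin n} (ht : t ∉ deadSet g ξ r)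
    (h : ∀ j t', t' ≠ t → (g j t' ↔ g' j t')) :
    ∀ l ≤ r, exploration g ξ l = exploration g' ξ l :=
  exploration_congr fun t' ht' j => h j t' (fun e => ht (e ▸ ht'))

lemma bfsParent_spec {r : ℕ} {j : Fin n} (h : j ∈ actSet g ξ (r + 1)) :
    bfsParent g ξ r j ∈ actSet g ξ r ∧ g j (bfsParent g ξ r j) := by
  have h' := (mem_actSet_succ.1 h).2
  rw [bfsParent, dif_pos h']
  exact h'.choose_spec

@[simp] lemma bfsPath_length (r : ℕ) (j : Fin n) : (bfsPath g ξ r j).length = r := by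
  induction r generalizing j with
  | zero => rfl
  | succ r ih => simp [bfsPath, ih]

lemma nodeType_bfsPath {r : ℕ} {j : Fin n} (h : j ∈ actSet g ξ r) :
    nodeType ξ (bfsPath g ξ r j) = j := by
  cases r with
  | zero => simpa [bfsPath, nodeType, eq_comm] using h
  | succ r => rfl

end Exploration

/-! ### Structure of the coupled tree -/

section TreeStructure

variable {n : ℕ} {θ : ℝ} {w : Fin n → VertexType} {s : Seed n}

lemma mem_offspring {S : TreeState n} {u v : TreeNode n} :
    v ∈ offspring θ w s S u ↔ ∃ j r, r < offspringCount θ w s S u j ∧ v = (j, r) :: u := by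
  simp only [offspring, List.mem_flatMap, List.mem_append, List.mem_filter, List.mem_finRange,
    List.mem_singleton, List.mem_map, List.mem_range, true_and, decide_eq_true_eq]
  constructor
  · rintro ⟨j, _, r, hr, rfl⟩
    exact ⟨j, r, hr, rfl⟩
  · rintro ⟨j, r, hr, rfl⟩
    exact ⟨j, ne_or_eq _ _, r, hr, rfl⟩

lemma nodup_offspring (S : TreeState n) (u : TreeNode n) : (offspring θ w s S u).Nodup := by
  rw [offspring, List.nodup_flatMap]
  refine ⟨fun j _ => List.nodup_range.map fun a b h => by simpa using h, ?_⟩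
  have hnd : ((List.finRange n).filter (fun j => j ≠ nodeType (seedRoot s) u) ++
      [nodeType (seedRoot s) u]).Nodup := by
    refine List.Nodup.append ((List.nodup_finRange n).filter _) (List.nodup_singleton _) ?_
    intro j hj hj'
    simp only [List.mem_filter, decide_eq_true_eq, List.mem_singleton] at hj hj'
    exact hj.2 hj'
  refine hnd.imp fun {a b} hab v hv hv' => ?_
  simp only [List.mem_map, List.mem_range] at hv hv'
  obtain ⟨r, -, rfl⟩ := hv
  obtain ⟨r', -, h⟩ := hv'
  simp only [List.cons.injEq, Prod.mk.injEq] at h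
  exact hab h.1.1.symm

/-- Exploration only appends, and only children of explored nodes; the freezing of earlier
generations follows from this. -/
lemma exists_nodes_foldl_exploreNode (L : List (TreeNode n)) (S : TreeState n) :
    ∃ E : List (TreeNode n), (L.foldl (exploreNode θ w s) S).nodes = S.nodes ++ E ∧
      ∀ v ∈ E, v ≠ [] ∧ v.tail ∈ L := by
  induction L generalizing S with
  | nil => exact ⟨[], by simp, by simp⟩
  | cons u L ih =>
    obtain ⟨E, hE, hEL⟩ := ih (exploreNode θ w s S u)
    refine ⟨offspring θ w s S u ++ E, ?_, ?_⟩
    · rw [List.foldl_cons, hE, exploreNode, List.append_assoc]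
    · intro v hv
      rcases List.mem_append.1 hv with hv | hv
      · obtain ⟨j, r, -, rfl⟩ := mem_offspring.1 hv
        simp
      · exact ⟨(hEL v hv).1, List.mem_cons_of_mem _ (hEL v hv).2⟩

/-- No node of the queue has a child in the tree yet, and exploring `u` creates children of `u`
alone, which does not occur again in the queue. -/
lemma nodup_nodes_foldl_exploreNode (L : List (TreeNode n)) (S : TreeState n) (hL : L.Nodup)
    (hS : S.nodes.Nodup) (hd : ∀ v ∈ S.nodes, v ≠ [] → v.tail ∉ L) :
    (L.foldl (exploreNode θ w s) S).nodes.Nodup := by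
  induction L generalizing S with
  | nil => exact hS
  | cons u L ih =>
    rw [List.foldl_cons]
    have hL' := List.nodup_cons.1 hL
    refine ih _ hL'.2 ?_ ?_
    · refine List.Nodup.append hS (nodup_offspring S u) fun v hv hv' => ?_
      obtain ⟨j, r, -, rfl⟩ := mem_offspring.1 hv'
      exact hd _ hv (by simp) (by simp)
    · intro v hv hne hvL
      rcases List.mem_append.1 hv with hv | hv
      · exact hd v hv hne (List.mem_cons_of_mem _ hvL)
      · obtain ⟨j, r, -, rfl⟩ := mem_offspring.1 hv
        exact hL'.1 hvL

lemma mark_foldl_exploreNode (L : List (TreeNode n)) (S : TreeState n) {v : TreeNode n}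
    (hv : v = [] ∨ v.tail ∉ L) : (L.foldl (exploreNode θ w s) S).mark v = S.mark v := by
  induction L generalizing S with
  | nil => rfl
  | cons u L ih =>
    rw [List.foldl_cons, ih]
    · match v, hv with
      | [], _ => rfl
      | (j, r) :: u', hv =>
        have : u' ≠ u := by
          rintro rfl
          simp at hv
        simp [exploreNode, this]
    · exact hv.imp id fun h h' => h (List.mem_cons_of_mem _ h')

lemma coupledTree_succ (k : ℕ) : coupledTree θ w s (k + 1) =
    ((coupledTree θ w s k).nodes.filter fun u => u.length = k).foldl
        (exploreNode θ w s) (coupledTree θ w s k) := rfl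

lemma length_le_of_mem_nodes {k : ℕ} {v : TreeNode n} (hv : v ∈ (coupledTree θ w s k).nodes) :
    v.length ≤ k := by
  induction k generalizing v with
  | zero =>
    have : v = [] := by simpa [coupledTree, treeStart] using hv
    simp [this]
  | succ k ih =>
    obtain ⟨E, hE, hEL⟩ := exists_nodes_foldl_exploreNode (θ := θ) (w := w) (s := s)
      ((coupledTree θ w s k).nodes.filter fun u => u.length = k) (coupledTree θ w s k)
    rw [coupledTree_succ, hE, List.mem_append] at hv
    rcases hv with hv | hv
    · exact (ih hv).trans (Nat.le_succ k)
    · have := (hEL v hv).2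
      simp only [List.mem_filter, List.length_tail, decide_eq_true_eq] at this
      omega

/-- Step `k + 1` adds only children of nodes of length `k`, so shorter generations are final. -/
lemma mem_nodes_succ_iff {k : ℕ} {v : TreeNode n} (hv : v.length ≤ k) :
    v ∈ (coupledTree θ w s (k + 1)).nodes ↔ v ∈ (coupledTree θ w s k).nodes := by
  obtain ⟨E, hE, hEL⟩ := exists_nodes_foldl_exploreNode (θ := θ) (w := w) (s := s)
    ((coupledTree θ w s k).nodes.filter fun u => u.length = k) (coupledTree θ w s k)
  rw [coupledTree_succ, hE, List.mem_append]
  refine ⟨fun h => h.resolve_right fun h => ?_, Or.inl⟩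
  obtain ⟨hne, h2⟩ := hEL v h
  simp only [List.mem_filter, List.length_tail, decide_eq_true_eq] at h2
  have := List.length_pos_iff.2 hne
  omega

lemma mem_nodes_iff_of_length_le {k l : ℕ} (hlk : l ≤ k) {v : TreeNode n} (hv : v.length ≤ l) :
    v ∈ (coupledTree θ w s k).nodes ↔ v ∈ (coupledTree θ w s l).nodes := by
  induction k, hlk using Nat.le_induction with
  | base => rfl
  | succ k hk ih => rw [mem_nodes_succ_iff (hv.trans hk), ih]

lemma mark_coupledTree_of_length_le {k l : ℕ} (hlk : l ≤ k) {v : TreeNode n}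
    (hv : v.length ≤ l) :
    (coupledTree θ w s k).mark v = (coupledTree θ w s l).mark v := by
  induction k, hlk using Nat.le_induction with
  | base => rfl
  | succ k hk ih =>
    rw [coupledTree_succ, mark_foldl_exploreNode, ih]
    by_cases hne : v = []
    · exact Or.inl hne
    · refine Or.inr fun h => ?_
      simp only [List.mem_filter, List.length_tail, decide_eq_true_eq] at h
      have := List.length_pos_iff.2 hne
      omega

lemma tail_mem_nodes {k : ℕ} {v : TreeNode n} (hv : v ∈ (coupledTree θ w s k).nodes)
    (hne : v ≠ []) : v.tail ∈ (coupledTree θ w s k).nodes := by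
  induction k with
  | zero => exact absurd (by simpa [coupledTree, treeStart] using hv) hne
  | succ k ih =>
    obtain ⟨E, hE, hEL⟩ := exists_nodes_foldl_exploreNode (θ := θ) (w := w) (s := s)
      ((coupledTree θ w s k).nodes.filter fun u => u.length = k) (coupledTree θ w s k)
    rw [coupledTree_succ, hE, List.mem_append] at hv ⊢
    rcases hv with hv | hv
    · exact Or.inl (ih hv)
    · exact Or.inl (List.mem_filter.1 (hEL v hv).2).1

lemma nodup_nodes_coupledTree (k : ℕ) : (coupledTree θ w s k).nodes.Nodup := by
  induction k with
  | zero => simp [coupledTree, treeStart]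
  | succ k ih =>
    rw [coupledTree_succ]
    refine nodup_nodes_foldl_exploreNode _ _ (ih.filter _) ih fun v hv hne h => ?_
    simp only [List.mem_filter, List.length_tail, decide_eq_true_eq] at h
    have h1 := length_le_of_mem_nodes hv
    have := List.length_pos_iff.2 hne
    omega

end TreeStructure

/-! ### A sufficient condition for the coupling to hold -/

/-- The adjacency relation of the coupled Poisson variables. -/
def poissonEdge (θ : ℝ) {n : ℕ} (w : Fin n → VertexType) (s : Seed n) (j t : Fin n) : Prop :=
  1 ≤ coupledZ θ w s j t

/-- The edge indicator of `(j, t)` differs from the coupled Poisson variable. -/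
def Mismatch (θ : ℝ) (φ : EdgeCorrection) {n : ℕ} (w : Fin n → VertexType) (s : Seed n)
    (j t : Fin n) : Prop :=
  ¬ ((IsEdge θ φ w s j t ∧ coupledZ θ w s j t = 1) ∨
    (¬ IsEdge θ φ w s j t ∧ coupledZ θ w s j t = 0))

/-- The exploration of the Poisson digraph meets no collision at distance `r`, the digraph agrees
with it there, and the independent parts of the marks vanish where they have to. -/
structure NoDefect (θ : ℝ) (φ : EdgeCorrection) {n : ℕ} (w : Fin n → VertexType) (s : Seed n)
    (r : ℕ) : Prop where
  outMatch : ∀ j ∈ actSet (poissonEdge θ w s) (seedRoot s) r, ∀ t ∉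
    deadSet (poissonEdge θ w s) (seedRoot s) r, j ≠ t → ¬ Mismatch θ φ w s j t
  inMatch : ∀ t ∈ actSet (poissonEdge θ w s) (seedRoot s) r, ∀ j, j ≠ t → ¬ Mismatch θ φ w s j t
  noReturn : ∀ t ∈ actSet (poissonEdge θ w s) (seedRoot s) r, ∀ j ∈
    deadSet (poissonEdge θ w s) (seedRoot s) (r + 1), ¬ poissonEdge θ w s j t
  noCommonTarget : ∀ j ∈ actSet (poissonEdge θ w s) (seedRoot s) r, ∀ j' ∈
    deadSet (poissonEdge θ w s) (seedRoot s) (r + 1), j ≠ j' → ∀ t ∉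
    deadSet (poissonEdge θ w s) (seedRoot s) r,
    ¬ (poissonEdge θ w s j t ∧ poissonEdge θ w s j' t)
  noCommonSource : ∀ t ∈ actSet (poissonEdge θ w s) (seedRoot s) r, ∀ t' ∈
    actSet (poissonEdge θ w s) (seedRoot s) r, t ≠ t' → ∀ j,
    ¬ (poissonEdge θ w s j t ∧ poissonEdge θ w s j t')
  starZero : ∀ j ∈ actSet (poissonEdge θ w s) (seedRoot s) r, ∀ t,
    t ∈ deadSet (poissonEdge θ w s) (seedRoot s) r ∨ t = j →
    starZ θ w s (bfsPath (poissonEdge θ w s) (seedRoot s) r j) j t = 0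

section Coupling

variable {n : ℕ} {θ : ℝ} {φ : EdgeCorrection} {w : Fin n → VertexType} {s : Seed n}

local notation "gP" => poissonEdge θ w s
local notation "rt" => seedRoot s

lemma isEdge_iff_of_not_mismatch {j t : Fin n} (h : ¬ Mismatch θ φ w s j t) :
    IsEdge θ φ w s j t ↔ gP j t := by
  rcases not_not.1 h with h | h
  · simp [poissonEdge, h.1, h.2]
  · simp [poissonEdge, h.1, h.2]

lemma coupledZ_eq_one_of_not_mismatch {j t : Fin n} (h : ¬ Mismatch θ φ w s j t)
    (hg : gP j t) : coupledZ θ w s j t = 1 := by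
  rcases not_not.1 h with h | h
  · exact h.2
  · simp [poissonEdge, h.2] at hg

/-- The value that the mark of the node of a vertex `j` at distance `r` has to have. -/
noncomputable def targetMark (θ : ℝ) {n : ℕ} (w : Fin n → VertexType) (s : Seed n) (r : ℕ)
    (j t : Fin n) : ℕ :=
  open Classical in
  if t ∈ deadSet (poissonEdge θ w s) (seedRoot s) r ∨ t = j then 0 else coupledZ θ w s j t

/-- The state of the tree after the vertices at distance `l` in `p` have been explored. -/
structure FoldInvariant (θ : ℝ) {n : ℕ} (w : Fin n → VertexType) (s : Seed n) (l : ℕ)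
    (S : TreeState n) (p : Finset (Fin n)) : Prop where
  subset : p ⊆ actSet (poissonEdge θ w s) (seedRoot s) l
  mem_nodes : ∀ v, v ∈ S.nodes ↔
    (∃ r ≤ l, ∃ j ∈ actSet (poissonEdge θ w s) (seedRoot s) r,
      v = bfsPath (poissonEdge θ w s) (seedRoot s) r j) ∨
    ∃ j ∈ actSet (poissonEdge θ w s) (seedRoot s) (l + 1),
      bfsParent (poissonEdge θ w s) (seedRoot s) l j ∈ p ∧
      v = bfsPath (poissonEdge θ w s) (seedRoot s) (l + 1) j
  dead_eq : S.dead = deadSet (poissonEdge θ w s) (seedRoot s) l ∪ p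
  mark_old : ∀ r ≤ l, ∀ j ∈ actSet (poissonEdge θ w s) (seedRoot s) r, ∀ t,
    S.mark (bfsPath (poissonEdge θ w s) (seedRoot s) r j) t = targetMark θ w s r j t
  mark_new : ∀ j ∈ actSet (poissonEdge θ w s) (seedRoot s) (l + 1),
    bfsParent (poissonEdge θ w s) (seedRoot s) l j ∈ p → ∀ t,
    S.mark (bfsPath (poissonEdge θ w s) (seedRoot s) (l + 1) j) t = targetMark θ w s (l + 1) j t

/-- A successor of an active vertex is new and has only this edge into the explored part. -/
lemma child_of_active {l : ℕ} (h : NoDefect θ φ w s l) {i j : Fin n} (hi : i ∈ actSet gP rt l)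
    (hg : gP j i) : j ∈ actSet gP rt (l + 1) ∧ bfsParent gP rt l j = i ∧ j ≠ i ∧
      coupledZ θ w s j i = 1 := by
  have hj : j ∉ deadSet gP rt (l + 1) := fun hj => h.noReturn i hi j hj hg
  have hact : j ∈ actSet gP rt (l + 1) := mem_actSet_succ.2 ⟨hj, i, hi, hg⟩
  have hji : j ≠ i := by
    rintro rfl
    exact hj (mem_deadSet_succ.2 (Or.inr hi))
  refine ⟨hact, ?_, hji, coupledZ_eq_one_of_not_mismatch (h.inMatch i hi j hji) hg⟩
  by_contra hne
  have hp := bfsParent_spec hact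
  exact h.noCommonSource _ hp.1 i hi hne j ⟨hp.2, hg⟩

/-- As `i` is not dead, its node draws its offspring from the shared `Z_{ji}`. By `child_of_active`
each positive one equals 1 and belongs to a new vertex with parent `i`, so the offspring are exactly
the `bfsPath` nodes below `i`. -/
lemma FoldInvariant.explore {l : ℕ} {S : TreeState n} {p : Finset (Fin n)} {i : Fin n}
    (hS : FoldInvariant θ w s l S p) (h : NoDefect θ φ w s l)
    (hstar : ∀ j ∈ actSet gP rt (l + 1), ∀ t, t ∈ deadSet gP rt (l + 1) ∨ t = j →
      starZ θ w s (bfsPath gP rt (l + 1) j) j t = 0)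
    (hi : i ∈ actSet gP rt l) (hip : i ∉ p) :
    FoldInvariant θ w s l (exploreNode θ w s S (bfsPath gP rt l i)) (insert i p) := by
  have hty : nodeType rt (bfsPath gP rt l i) = i := nodeType_bfsPath hi
  have hid : i ∉ S.dead := by
    rw [hS.dead_eq, Finset.mem_union, not_or]
    exact ⟨notMem_deadSet_of_mem_actSet hi, hip⟩
  have hcount : ∀ j, offspringCount θ w s S (bfsPath gP rt l i) j = coupledZ θ w s j i := by
    intro j
    simp only [offspringCount, hty, if_neg hid]
  have hoff : ∀ v, v ∈ offspring θ w s S (bfsPath gP rt l i) ↔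
      ∃ j ∈ actSet gP rt (l + 1), bfsParent gP rt l j = i ∧ v = bfsPath gP rt (l + 1) j := by
    intro v
    rw [mem_offspring]
    simp only [hcount]
    constructor
    · rintro ⟨j, r, hr, rfl⟩
      have hg : gP j i := by unfold poissonEdge; omega
      obtain ⟨h1, h2, h3, h4⟩ := child_of_active h hi hg
      refine ⟨j, h1, h2, ?_⟩
      -- Here `Z_{ji} = 1`, so the only offspring index is 0, which is the index built into
      -- `bfsPath`.
      obtain rfl : r = 0 := by omega
      rw [bfsPath, h2]
    · rintro ⟨j, hj, hp, rfl⟩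
      have hg := (bfsParent_spec hj).2
      rw [hp] at hg
      exact ⟨j, 0, hg, by rw [bfsPath, hp]⟩
  refine ⟨?_, ?_, ?_, ?_, ?_⟩
  · exact Finset.insert_subset hi hS.subset
  · intro v
    simp only [exploreNode, List.mem_append, hS.mem_nodes, hoff, Finset.mem_insert]
    constructor
    · rintro ((h1 | ⟨j, h1, h2, h3⟩) | ⟨j, h1, h2, h3⟩)
      · exact Or.inl h1
      · exact Or.inr ⟨j, h1, Or.inr h2, h3⟩
      · exact Or.inr ⟨j, h1, Or.inl h2, h3⟩
    · rintro (h1 | ⟨j, h1, h2 | h2, h3⟩)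
      · exact Or.inl (Or.inl h1)
      · exact Or.inr ⟨j, h1, h2, h3⟩
      · exact Or.inl (Or.inr ⟨j, h1, h2, h3⟩)
  · simp only [exploreNode, hty, hS.dead_eq, Finset.union_insert]
  · intro r hr j hj t
    rw [← hS.mark_old r hr j hj t]
    cases r with
    | zero => simp [bfsPath, exploreNode]
    | succ r =>
      have : bfsPath gP rt r (bfsParent gP rt r j) ≠ bfsPath gP rt l i := by
        intro e
        have := congrArg List.length e
        simp at this
        omega
      simp [bfsPath, exploreNode, this]
  · intro j hj hp t
    rcases eq_or_ne (bfsParent gP rt l j) i with hpi | hpi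
    · have hg := (bfsParent_spec hj).2
      rw [hpi] at hg
      obtain ⟨-, -, hji, -⟩ := child_of_active h hi hg
      have hjd := (mem_actSet_succ.1 hj).1
      -- A node of type `j` could be present only if the parent of `j` were already explored, but
      -- this parent is `i ∉ p`.
      have hnew : ∀ v ∈ S.nodes, nodeType rt v ≠ j := by
        intro v hv e
        rcases (hS.mem_nodes v).1 hv with ⟨r, hr, j', hj', rfl⟩ | ⟨j', hj', hp', rfl⟩
        · rw [nodeType_bfsPath hj'] at e
          exact hjd (mem_union_iff_mem_deadSet.2 ⟨r, hr, e ▸ hj'⟩)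
        · rw [nodeType_bfsPath hj'] at e
          rw [e, hpi] at hp'
          exact hip hp'
      have hst := hstar j hj t
      rw [bfsPath, hpi] at hst
      rw [bfsPath, hpi]
      simp only [exploreNode, if_true, offspringMark, hty, hid, hji, targetMark,
        not_false_eq_true, ne_eq, true_and]
      by_cases htd : t ∈ deadSet gP rt (l + 1) ∨ t = j
      · rw [if_pos htd]
        -- The construction still uses the shared `Z_{jt}` for those `t` of the current level that
        -- are explored after `i`. It vanishes: otherwise `j` would point both to `t` and to `i`, a
        -- common source.
        split_ifs with hc
        · obtain ⟨-, hc1, hc2, hc3⟩ := hc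
          rw [hS.dead_eq, Finset.mem_union, not_or] at hc3
          have htl : t ∈ actSet gP rt l :=
            (mem_deadSet_succ.1 (htd.resolve_right hc1)).resolve_left hc3.1
          by_contra hz
          exact h.noCommonSource t htl i hi hc2 j ⟨Nat.one_le_iff_ne_zero.2 hz, hg⟩
        · exact hst htd
      · rw [if_neg htd, if_pos]
        rw [not_or] at htd
        refine ⟨hnew, htd.2, ?_, ?_⟩
        · rintro rfl
          exact htd.1 (mem_deadSet_succ.2 (Or.inr hi))
        · rw [hS.dead_eq, Finset.mem_union]
          rintro (h1 | h1)
          exacts [htd.1 (mem_deadSet_succ.2 (Or.inl h1)),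
            htd.1 (mem_deadSet_succ.2 (Or.inr (hS.subset h1)))]
    · have hp' : bfsParent gP rt l j ∈ p := (Finset.mem_insert.1 hp).resolve_left hpi
      rw [← hS.mark_new j hj hp' t]
      have : bfsPath gP rt l (bfsParent gP rt l j) ≠ bfsPath gP rt l i := by
        intro e
        have := congrArg (nodeType rt) e
        rw [hty, nodeType_bfsPath (bfsParent_spec hj).1] at this
        exact hpi this
      simp [bfsPath, exploreNode, this]

/-- The set `p` records the types already explored in the current generation; the invariant is
passed along one node at a time. -/
lemma FoldInvariant.foldl {l : ℕ} (h : NoDefect θ φ w s l)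
    (hstar : ∀ j ∈ actSet gP rt (l + 1), ∀ t, t ∈ deadSet gP rt (l + 1) ∨ t = j →
      starZ θ w s (bfsPath gP rt (l + 1) j) j t = 0) (L : List (TreeNode n)) (hL : L.Nodup)
    {S : TreeState n} {p : Finset (Fin n)} (hS : FoldInvariant θ w s l S p)
    (hLp : ∀ u ∈ L, ∃ i ∈ actSet gP rt l, i ∉ p ∧ u = bfsPath gP rt l i) :
    ∃ p', FoldInvariant θ w s l (L.foldl (exploreNode θ w s) S) p' ∧
      ∀ i, i ∈ p' ↔ i ∈ p ∨ ∃ u ∈ L, nodeType rt u = i := by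
  induction L generalizing S p with
  | nil => exact ⟨p, hS, by simp⟩
  | cons u L ih =>
    obtain ⟨i, hi, hip, rfl⟩ := hLp u List.mem_cons_self
    have hL' := List.nodup_cons.1 hL
    obtain ⟨p', h1, h2⟩ := ih hL'.2 (hS.explore h hstar hi hip) (by
      intro v hv
      obtain ⟨i', hi', hip', rfl⟩ := hLp v (List.mem_cons_of_mem _ hv)
      refine ⟨i', hi', ?_, rfl⟩
      rw [Finset.mem_insert, not_or]
      exact ⟨fun e => hL'.1 (e ▸ hv), hip'⟩)
    refine ⟨p', h1, fun i' => ?_⟩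
    rw [h2]
    simp only [Finset.mem_insert, List.mem_cons, exists_eq_or_imp, nodeType_bfsPath hi]
    tauto

/-- The coupled tree after `l` steps, if there have been no defects. -/
lemma foldInvariant_coupledTree {k : ℕ} (h : ∀ r ≤ k, NoDefect θ φ w s r) {l : ℕ} (hl : l ≤ k) :
    FoldInvariant θ w s l (coupledTree θ w s l) ∅ := by
  induction l with
  | zero =>
    refine ⟨Finset.empty_subset _, ?_, ?_, ?_, ?_⟩
    · intro v
      simp [coupledTree, treeStart, bfsPath]
    · simp [coupledTree, treeStart]
    · intro r hr j hj t
      obtain rfl : r = 0 := by omega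
      have hst := (h 0 (by omega)).starZero j hj t
      obtain rfl : j = rt := by simpa using hj
      simp only [bfsPath] at hst
      simp only [coupledTree, treeStart, targetMark, deadSet_zero, Finset.notMem_empty, false_or]
        at hst ⊢
      split_ifs with hc
      · exact hst hc
      · rfl
    · simp
  | succ l ih =>
    have hS := ih (by omega)
    obtain ⟨p, hp, hmem⟩ := FoldInvariant.foldl (h l (by omega)) (h (l + 1) hl).starZero
      ((coupledTree θ w s l).nodes.filter fun u => u.length = l)
      ((nodup_nodes_coupledTree l).filter _) hS (by
        intro u hu
        simp only [List.mem_filter, decide_eq_true_eq, hS.mem_nodes, Finset.notMem_empty,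
          false_and, and_false, exists_false, or_false] at hu
        obtain ⟨⟨r, hr, j, hj, rfl⟩, hlen⟩ := hu
        rw [bfsPath_length] at hlen
        subst hlen
        exact ⟨j, hj, Finset.notMem_empty _, rfl⟩)
    rw [← coupledTree_succ] at hp
    -- The whole level has now been explored, so the condition that the parent lies in `p` becomes
    -- automatic and the next level starts with `p = ∅`.
    have hpl : p = actSet gP rt l := by
      refine Finset.Subset.antisymm hp.subset fun i hi => (hmem i).2 (Or.inr
        ⟨bfsPath gP rt l i, ?_, nodeType_bfsPath hi⟩)
      simp only [List.mem_filter, hS.mem_nodes, bfsPath_length, decide_true, and_true]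
      exact Or.inl ⟨l, le_rfl, i, hi, rfl⟩
    subst hpl
    refine ⟨Finset.empty_subset _, ?_, ?_, ?_, ?_⟩
    · intro v
      rw [hp.mem_nodes]
      simp only [Finset.notMem_empty, false_and, and_false, exists_false, or_false]
      constructor
      · rintro (⟨r, hr, h'⟩ | ⟨j, hj, -, h'⟩)
        · exact ⟨r, by omega, h'⟩
        · exact ⟨l + 1, le_rfl, j, hj, h'⟩
      · rintro ⟨r, hr, j, hj, rfl⟩
        rcases Nat.le_succ_iff.1 hr with hr | rfl
        · exact Or.inl ⟨r, hr, j, hj, rfl⟩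
        · exact Or.inr ⟨j, hj, (bfsParent_spec hj).1, rfl⟩
    · rw [hp.dead_eq, deadSet_succ, Finset.union_empty]
    · intro r hr j hj t
      rcases Nat.le_succ_iff.1 hr with hr | rfl
      · exact hp.mark_old r hr j hj t
      · exact hp.mark_new j hj (bfsParent_spec hj).1 t
    · simp

/-- A graph edge into an explored vertex at distance `m` is a Poisson edge by `inMatch`, so its
source lies at distance `m + 1`; only `m = l` can produce a vertex that is new. -/
lemma graphWithin_eq_deadSet {k : ℕ} (h : ∀ r ≤ k, NoDefect θ φ w s r) {l : ℕ} (hl : l ≤ k) :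
    graphWithin θ φ w s l = deadSet gP rt (l + 1) := by
  induction l with
  | zero => ext j; simp [graphWithin, mem_deadSet_succ]
  | succ l ih =>
    ext j
    simp only [graphWithin, ih (by omega), Set.mem_union, Set.mem_ofPred_eq, Finset.mem_coe]
    rw [mem_deadSet_succ (r := l + 1), mem_actSet_succ]
    constructor
    · rintro (hj | ⟨i, hi, hji⟩)
      · exact Or.inl hj
      · by_cases hj : j ∈ deadSet gP rt (l + 1)
        · exact Or.inl hj
        · obtain ⟨m, hm, him⟩ := mem_union_iff_mem_deadSet.1 hi
          have hg : gP j i :=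
            (isEdge_iff_of_not_mismatch ((h m (by omega)).inMatch i him j hji.1)).1 hji
          have hjm := (child_of_active (h m (by omega)) him hg).1
          refine Or.inr ⟨hj, i, ?_, hg⟩
          obtain rfl | hml := Nat.eq_or_lt_of_le hm
          · exact him
          · exact absurd (mem_union_iff_mem_deadSet.2 ⟨m + 1, by omega, hjm⟩) hj
    · rintro (hj | ⟨hj, i, hi, hg⟩)
      · exact Or.inl hj
      · have hc := child_of_active (h l (by omega)) hi hg
        exact Or.inr ⟨i, mem_deadSet_succ.2 (Or.inr hi),
          (isEdge_iff_of_not_mismatch ((h l (by omega)).inMatch i hi j hc.2.2.1)).2 hg⟩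

lemma graphActive_eq_actSet {k : ℕ} (h : ∀ r ≤ k, NoDefect θ φ w s r) {l : ℕ} (hl : l ≤ k) :
    graphActive θ φ w s l = actSet gP rt l := by
  cases l with
  | zero => simp [graphActive]
  | succ l =>
    rw [graphActive, graphWithin_eq_deadSet h hl, graphWithin_eq_deadSet h (by omega : l ≤ k)]
    ext j
    simp only [Set.mem_sdiff, Finset.mem_coe]
    rw [mem_deadSet_succ (r := l + 1)]
    constructor
    · rintro ⟨h1, h2⟩
      exact h1.resolve_left h2
    · intro h1
      exact ⟨Or.inr h1, notMem_deadSet_of_mem_actSet h1⟩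

lemma mem_nodes_coupledTree_iff {k : ℕ} (h : ∀ r ≤ k, NoDefect θ φ w s r) {l : ℕ} (hl : l ≤ k)
    {v : TreeNode n} : v ∈ (coupledTree θ w s l).nodes ↔
      ∃ r ≤ l, ∃ j ∈ actSet gP rt r, v = bfsPath gP rt r j := by
  rw [(foldInvariant_coupledTree h hl).mem_nodes]
  simp

lemma targetMark_pos {r : ℕ} {j t : Fin n} (h : 0 < targetMark θ w s r j t) :
    t ∉ deadSet gP rt r ∧ t ≠ j ∧ targetMark θ w s r j t = coupledZ θ w s j t ∧ gP j t := by
  rw [targetMark] at h ⊢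
  split_ifs at h ⊢ with hc
  · exact absurd h (lt_irrefl _)
  · rw [not_or] at hc
    exact ⟨hc.1, hc.2, rfl, h⟩

/-- An edge from an explored vertex into the explored part leads to its parent. -/
lemma notMem_deadSet_of_targetMark_pos {k : ℕ} (h : ∀ r ≤ k, NoDefect θ φ w s r) {l r : ℕ}
    (hl : l ≤ k) {j t : Fin n} (hj : j ∈ actSet gP rt r)
    (hm : 0 < targetMark θ w s r j t) : t ∉ deadSet gP rt (l + 1) := by
  intro ht
  obtain ⟨h1, h2, h3, h4⟩ := targetMark_pos hm
  obtain ⟨m, hml, htm⟩ := mem_union_iff_mem_deadSet.1 ht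
  have hrm : r ≤ m := by
    by_contra hlt
    exact h1 (mem_deadSet.2 ⟨m, by omega, htm⟩)
  exact (h m (by omega)).noReturn t htm j (mem_union_iff_mem_deadSet.2 ⟨r, hrm, hj⟩) h4

/-- Without defects up to distance `k`, the coupling holds up to step `k`. -/
theorem couplingHolds_of_noDefect {k : ℕ} (h : ∀ r ≤ k, NoDefect θ φ w s r) :
    CouplingHolds θ φ w s k := by
  intro l hl
  have hF := foldInvariant_coupledTree h hl
  have hgen : ∀ u ∈ treeActive θ w s l, ∃ j ∈ actSet gP rt l, u = bfsPath gP rt l j := by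
    rintro u ⟨hu, hul⟩
    obtain ⟨r, hr, j, hj, rfl⟩ := (mem_nodes_coupledTree_iff h hl).1 hu
    rw [bfsPath_length] at hul
    subst hul
    exact ⟨j, hj, rfl⟩
  refine ⟨⟨?_, ?_, ?_⟩, ⟨?_, ?_, ?_⟩, ?_⟩
  · intro u hu
    obtain ⟨j, hj, rfl⟩ := hgen u hu
    rw [nodeType_bfsPath hj, graphActive_eq_actSet h hl]
    exact hj
  · intro u hu u' hu' e
    obtain ⟨j, hj, rfl⟩ := hgen u hu
    obtain ⟨j', hj', rfl⟩ := hgen u' hu'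
    rw [nodeType_bfsPath hj, nodeType_bfsPath hj'] at e
    rw [e]
  · intro j hj
    rw [graphActive_eq_actSet h hl] at hj
    exact ⟨bfsPath gP rt l j, ⟨(mem_nodes_coupledTree_iff h hl).2 ⟨l, le_rfl, j, hj, rfl⟩,
      bfsPath_length l j⟩, nodeType_bfsPath hj⟩
  · rintro ⟨u, t, m⟩ ⟨hu, hm⟩
    obtain ⟨r, hr, j, hj, rfl⟩ := (mem_nodes_coupledTree_iff h hl).1 hu
    dsimp only at hm
    rw [hF.mark_old r hr j hj t] at hm
    have hm0 := Nat.zero_lt_of_lt hm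
    obtain ⟨h1, h2, h3, h4⟩ := targetMark_pos hm0
    simp only [graphInactive, Set.mem_ofPred_eq, graphWithin_eq_deadSet h hl, Finset.mem_coe]
    exact ⟨notMem_deadSet_of_targetMark_pos h hl hj hm0, j,
      mem_union_iff_mem_deadSet.2 ⟨r, hr, hj⟩,
      (isEdge_iff_of_not_mismatch ((h r (by omega)).outMatch j hj t h1 h2.symm)).2 h4⟩
  · rintro ⟨u, t, m⟩ ⟨hu, hm⟩ ⟨u', t', m'⟩ ⟨hu', hm'⟩ e
    obtain rfl : t = t' := e
    obtain ⟨r, hr, j, hj, rfl⟩ := (mem_nodes_coupledTree_iff h hl).1 hu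
    obtain ⟨r', hr', j', hj', rfl⟩ := (mem_nodes_coupledTree_iff h hl).1 hu'
    dsimp only at hm hm'
    rw [hF.mark_old r hr j hj t] at hm
    rw [hF.mark_old r' hr' j' hj' t] at hm'
    have hm0 := Nat.zero_lt_of_lt hm
    have hm0' := Nat.zero_lt_of_lt hm'
    obtain ⟨h1, h2, h3, h4⟩ := targetMark_pos hm0
    obtain ⟨h1', h2', h3', h4'⟩ := targetMark_pos hm0'
    have hz := coupledZ_eq_one_of_not_mismatch
      ((h r (by omega)).outMatch j hj t h1 h2.symm) h4
    have hz' := coupledZ_eq_one_of_not_mismatch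
      ((h r' (by omega)).outMatch j' hj' t h1' h2'.symm) h4'
    obtain rfl : m = 0 := by omega
    obtain rfl : m' = 0 := by omega
    -- `noCommonTarget` compares a level with everything explored up to it, so it is applied at the
    -- later of the two levels.
    have hjj : j = j' := by
      by_contra hne
      rcases le_total r r' with hrr | hrr
      · exact (h r' (by omega)).noCommonTarget j' hj' j
          (mem_union_iff_mem_deadSet.2 ⟨r, hrr, hj⟩) (Ne.symm hne) t h1' ⟨h4', h4⟩
      · exact (h r (by omega)).noCommonTarget j hj j'
          (mem_union_iff_mem_deadSet.2 ⟨r', hrr, hj'⟩) hne t h1 ⟨h4, h4'⟩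
    subst hjj
    rw [actSet_level_unique hj hj']
  · rintro t ⟨ht, j, hj, hjt⟩
    rw [graphWithin_eq_deadSet h hl] at ht hj
    obtain ⟨r, hr, hj⟩ := mem_union_iff_mem_deadSet.1 hj
    have htr : t ∉ deadSet gP rt r := fun h' => ht (deadSet_mono (by omega) h')
    have hz := (isEdge_iff_of_not_mismatch
      ((h r (by omega)).outMatch j hj t htr hjt.1)).1 hjt
    refine ⟨(bfsPath gP rt r j, t, 0),
      ⟨(mem_nodes_coupledTree_iff h hl).2 ⟨r, hr, j, hj, rfl⟩, ?_⟩, rfl⟩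
    dsimp only
    rw [hF.mark_old r hr j hj t, targetMark, if_neg (not_or.2 ⟨htr, hjt.1.symm⟩)]
    exact hz
  · intro u hu t
    obtain ⟨j, hj, rfl⟩ := hgen u hu
    rw [nodeType_bfsPath hj, hF.mark_old l le_rfl j hj t]
    have hpar : ∀ t, parentType rt (bfsPath gP rt l j) = some t → t ∈ deadSet gP rt l ∧ gP j t := by
      intro t ht
      cases l with
      | zero => simp [bfsPath, parentType] at ht
      | succ l =>
        have hp := bfsParent_spec hj
        simp only [bfsPath, parentType, Option.some.injEq, nodeType_bfsPath hp.1] at ht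
        subst ht
        exact ⟨mem_deadSet_succ.2 (Or.inr hp.1), hp.2⟩
    -- For edges back into the explored part `outMatch` says nothing. They are controlled by
    -- `inMatch` at the level of `t`, and `child_of_active` then identifies `t` as the parent. All
    -- other edges fall under `outMatch`.
    by_cases htd : t ∈ deadSet gP rt l
    · have hz : targetMark θ w s l j t = 0 := if_pos (Or.inl htd)
      rw [hz]
      simp only [nonpos_iff_eq_zero, one_ne_zero, or_false]
      obtain ⟨m, hml, htm⟩ := mem_deadSet.1 htd
      have hne : j ≠ t := by
        rintro rfl
        exact notMem_deadSet_of_mem_actSet hj htd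
      rw [isEdge_iff_of_not_mismatch ((h m (by omega)).inMatch t htm j hne)]
      refine ⟨fun hg => ?_, fun hp => (hpar t hp).2⟩
      obtain ⟨h1, h2, -, -⟩ := child_of_active (h m (by omega)) htm hg
      obtain rfl := actSet_level_unique hj h1
      simp only [bfsPath, parentType, h2, nodeType_bfsPath htm]
    · rcases eq_or_ne t j with rfl | hne
      · have htm : targetMark θ w s l t t = 0 := if_pos (Or.inr rfl)
        rw [htm]
        simp only [nonpos_iff_eq_zero, one_ne_zero, or_false]
        exact ⟨fun he => absurd rfl he.1, fun hp => absurd (hpar t hp).1 htd⟩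
      · have htm : targetMark θ w s l j t = coupledZ θ w s j t := if_neg (not_or.2 ⟨htd, hne⟩)
        rw [htm, isEdge_iff_of_not_mismatch ((h l hl).outMatch j hj t htd hne.symm)]
        exact ⟨Or.inr, fun h' => h'.elim (fun hp => absurd (hpar t hp).1 htd) id⟩

end Coupling

/-! ### Equality of the ranks -/

section Rank

variable {n : ℕ} {θ : ℝ} {φ : EdgeCorrection} {w : Fin n → VertexType} {s : Seed n}

local notation "rt" => seedRoot s

/-- The rank of the vertex `j` computed from paths of length at most `k`. -/
noncomputable def vertexRank (θ : ℝ) (φ : EdgeCorrection) {n : ℕ} (w : Fin n → VertexType)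
    (s : Seed n) (k : ℕ) (j : Fin n) : ℝ :=
  (∑ m ∈ Finset.range (k + 1),
    Matrix.vecMul (fun i => persQ (w i)) (rankMatrix θ φ w s ^ m)) j

lemma vertexRank_zero (j : Fin n) : vertexRank θ φ w s 0 j = persQ (w j) := by
  simp [vertexRank]

/-- Splitting off the power 0 and factoring one matrix out on the right puts the weight on the
in-neighbour, as in the recursion for `nodeRank`. -/
lemma vertexRank_succ (k : ℕ) (j : Fin n) : vertexRank θ φ w s (k + 1) j =
    (∑ i, vertexRank θ φ w s k i * rankMatrix θ φ w s i j) + persQ (w j) := by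
  have h : ∑ m ∈ Finset.range (k + 1),
      Matrix.vecMul (fun i => persQ (w i)) (rankMatrix θ φ w s ^ (m + 1)) =
      Matrix.vecMul (∑ m ∈ Finset.range (k + 1),
        Matrix.vecMul (fun i => persQ (w i)) (rankMatrix θ φ w s ^ m)) (rankMatrix θ φ w s) := by
    rw [Matrix.sum_vecMul]
    refine Finset.sum_congr rfl fun m _ => ?_
    rw [Matrix.vecMul_vecMul, pow_succ]
  rw [vertexRank, Finset.sum_range_succ', h, Pi.add_apply, pow_zero,
    Matrix.vecMul_one]
  rfl

lemma CouplingHolds.mono {k l : ℕ} (h : CouplingHolds θ φ w s k) (hl : l ≤ k) :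
    CouplingHolds θ φ w s l := fun m hm => h m (hm.trans hl)

lemma subset_graphWithin_of_le {l k : ℕ} (hl : l ≤ k) :
    graphWithin θ φ w s l ⊆ graphWithin θ φ w s k := by
  induction k, hl using Nat.le_induction with
  | base => exact subset_rfl
  | succ k _ ih => exact ih.trans Set.subset_union_left

lemma graphActive_subset {l k : ℕ} (hl : l ≤ k) :
    graphActive θ φ w s l ⊆ graphWithin θ φ w s k := by
  refine subset_trans ?_ (subset_graphWithin_of_le hl)
  cases l with
  | zero => exact subset_rfl
  | succ l => exact Set.sdiff_subset

lemma exists_graphActive_of_mem {k : ℕ} {j : Fin n} (h : j ∈ graphWithin θ φ w s k) :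
    ∃ l ≤ k, j ∈ graphActive θ φ w s l := by
  induction k with
  | zero => exact ⟨0, le_rfl, h⟩
  | succ k ih =>
    by_cases hk : j ∈ graphWithin θ φ w s k
    · obtain ⟨l, hl, hj⟩ := ih hk
      exact ⟨l, by omega, hj⟩
    · exact ⟨k + 1, le_rfl, h, hk⟩

lemma graphActive_level_unique {l m : ℕ} {j : Fin n} (hl : j ∈ graphActive θ φ w s l)
    (hm : j ∈ graphActive θ φ w s m) : l = m := by
  have key : ∀ {a b : ℕ}, a < b → j ∈ graphActive θ φ w s a → j ∉ graphActive θ φ w s b := by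
    intro a b hab ha hb
    obtain ⟨b, rfl⟩ := Nat.exists_eq_add_of_lt hab
    exact hb.2 (graphActive_subset (by omega) ha)
  rcases lt_trichotomy l m with h | h | h
  · exact absurd hm (key h hl)
  · exact h
  · exact absurd hl (key h hm)

lemma treeActive_iff {k l : ℕ} (hl : l ≤ k) {u : TreeNode n} :
    u ∈ treeActive θ w s l ↔ u ∈ (coupledTree θ w s k).nodes ∧ u.length = l := by
  constructor
  · rintro ⟨h1, h2⟩
    exact ⟨(mem_nodes_iff_of_length_le hl h2.le).2 h1, h2⟩
  · rintro ⟨h1, h2⟩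
    exact ⟨(mem_nodes_iff_of_length_le hl h2.le).1 h1, h2⟩

lemma CouplingHolds.nodeType_mem {k : ℕ} (h : CouplingHolds θ φ w s k) {u : TreeNode n}
    (hu : u ∈ (coupledTree θ w s k).nodes) :
    nodeType rt u ∈ graphActive θ φ w s u.length :=
  (h u.length (length_le_of_mem_nodes hu)).1.mapsTo
    ((treeActive_iff (length_le_of_mem_nodes hu)).2 ⟨hu, rfl⟩)

/-- The coupling gives injectivity only within a generation; across generations the types lie in the
disjoint sets `A_l`. -/
lemma CouplingHolds.nodeType_injOn {k : ℕ} (h : CouplingHolds θ φ w s k) {u v : TreeNode n}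
    (hu : u ∈ (coupledTree θ w s k).nodes) (hv : v ∈ (coupledTree θ w s k).nodes)
    (e : nodeType rt u = nodeType rt v) : u = v := by
  have hlen : u.length = v.length := by
    have h1 := h.nodeType_mem hu
    rw [e] at h1
    exact graphActive_level_unique h1 (h.nodeType_mem hv)
  exact (h u.length (length_le_of_mem_nodes hu)).1.injOn
    ((treeActive_iff (length_le_of_mem_nodes hu)).2 ⟨hu, rfl⟩)
    ((treeActive_iff (length_le_of_mem_nodes hu)).2 ⟨hv, hlen.symm⟩) e

lemma CouplingHolds.isEdge_iff {k : ℕ} (h : CouplingHolds θ φ w s k) {u : TreeNode n}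
    (hu : u ∈ (coupledTree θ w s k).nodes) (t : Fin n) :
    IsEdge θ φ w s (nodeType rt u) t ↔
      parentType rt u = some t ∨ 1 ≤ (coupledTree θ w s k).mark u t := by
  have hul := length_le_of_mem_nodes hu
  rw [mark_coupledTree_of_length_le hul le_rfl]
  exact (h u.length hul).2.2 u ((treeActive_iff hul).2 ⟨hu, rfl⟩) t

/-- Two inactive nodes of the same type attached to `u` would contradict injectivity on the inactive
set. -/
lemma CouplingHolds.mark_le_one {k : ℕ} (h : CouplingHolds θ φ w s k) {u : TreeNode n}
    (hu : u ∈ (coupledTree θ w s k).nodes) (t : Fin n) : (coupledTree θ w s k).mark u t ≤ 1 := by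
  by_contra hlt
  have h0 : (u, t, 0) ∈ treeInactive θ w s k := ⟨hu, by dsimp only; omega⟩
  have h1 : (u, t, 1) ∈ treeInactive θ w s k := ⟨hu, by dsimp only; omega⟩
  have := (h k le_rfl).2.1.injOn h0 h1 rfl
  simp at this

lemma CouplingHolds.notMem_of_mark_pos {k : ℕ} (h : CouplingHolds θ φ w s k) {u : TreeNode n}
    (hu : u ∈ (coupledTree θ w s k).nodes) {t : Fin n}
    (ht : 1 ≤ (coupledTree θ w s k).mark u t) : t ∉ graphWithin θ φ w s k :=
  ((h k le_rfl).2.1.mapsTo (show (u, t, 0) ∈ treeInactive θ w s k from ⟨hu, ht⟩)).1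

lemma parentType_of_ne_nil {ξ : Fin n} {u : TreeNode n} (hu : u ≠ []) :
    parentType ξ u = some (nodeType ξ u.tail) := by
  cases u with
  | nil => exact absurd rfl hu
  | cons a u => rfl

/-- The out-neighbours are the parent, which lies in `T_k`, and the types of the inactive nodes,
which lie outside it and occur once each. The root has no parent, so the 1 in its mark would be one
too many; its mark never enters the rank of the root. -/
lemma CouplingHolds.outDegree_eq {k : ℕ} (h : CouplingHolds θ φ w s k) {u : TreeNode n}
    (hu : u ∈ (coupledTree θ w s k).nodes) (hne : u ≠ []) :
    (outDegree θ φ w s (nodeType rt u) : ℝ) = 1 + ∑ t, ((coupledTree θ w s k).mark u t : ℝ) := by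
  classical
  have htl := tail_mem_nodes hu hne
  have hT : nodeType rt u.tail ∈ graphWithin θ φ w s k :=
    graphActive_subset (length_le_of_mem_nodes htl) (h.nodeType_mem htl)
  have hset : (Finset.univ.filter fun j => IsEdge θ φ w s (nodeType rt u) j) =
      insert (nodeType rt u.tail)
        (Finset.univ.filter fun t => 1 ≤ (coupledTree θ w s k).mark u t) := by
    ext t
    simp only [Finset.mem_filter, Finset.mem_univ, true_and, Finset.mem_insert, h.isEdge_iff hu,
      parentType_of_ne_nil hne, Option.some.injEq, eq_comm]
  have hdeg : outDegree θ φ w s (nodeType rt u) =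
      (Finset.univ.filter fun j => IsEdge θ φ w s (nodeType rt u) j).card := by
    unfold outDegree
    congr
  have hmark : ∀ t, (coupledTree θ w s k).mark u t =
      if 1 ≤ (coupledTree θ w s k).mark u t then 1 else 0 := by
    intro t
    have := h.mark_le_one hu t
    split_ifs <;> omega
  rw [hdeg, hset, Finset.card_insert_of_notMem, Finset.card_filter, add_comm]
  · push_cast
    congr 1
    refine Finset.sum_congr rfl fun t _ => ?_
    conv_rhs => rw [hmark t]
    push_cast
    rfl
  · simp only [Finset.mem_filter, Finset.mem_univ, true_and]
    exact fun hm => h.notMem_of_mark_pos hu hm hT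

/-- In the graph, the in-neighbours of an explored vertex are the types of the offspring of its
node. -/
lemma CouplingHolds.inNeighbour_iff {k : ℕ} (h : CouplingHolds θ φ w s k) {u : TreeNode n}
    (hu : u ∈ (coupledTree θ w s k).nodes) (hlen : u.length < k) (i : Fin n) :
    IsEdge θ φ w s i (nodeType rt u) ↔
      ∃ v ∈ (coupledTree θ w s k).nodes, v ≠ [] ∧ v.tail = u ∧ nodeType rt v = i := by
  constructor
  · intro he
    have hi : i ∈ graphWithin θ φ w s (u.length + 1) :=
      Or.inr ⟨_, graphActive_subset le_rfl (h.nodeType_mem hu), he⟩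
    obtain ⟨l, hl, hil⟩ := exists_graphActive_of_mem hi
    obtain ⟨v, hv, rfl⟩ := (h l (by omega)).1.surjOn hil
    have hvk := ((treeActive_iff (show l ≤ k by omega)).1 hv).1
    rw [h.isEdge_iff hvk] at he
    rcases he with he | he
    · have hvne : v ≠ [] := by
        rintro rfl
        simp [parentType] at he
      rw [parentType_of_ne_nil hvne, Option.some.injEq] at he
      exact ⟨v, hvk, hvne, h.nodeType_injOn (tail_mem_nodes hvk hvne) hu he, rfl⟩
    · exact absurd (graphActive_subset hlen.le (h.nodeType_mem hu))
        (h.notMem_of_mark_pos hvk he)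
  · rintro ⟨v, hv, hne, rfl, rfl⟩
    rw [h.isEdge_iff hv, parentType_of_ne_nil hne]
    exact Or.inl rfl

/-- Induction on the remaining depth. The bound on `u.length + a` guarantees that all offspring
needed are in the tree, and the type map matches them with the in-neighbours in the graph. -/
lemma CouplingHolds.nodeRank_eq {k : ℕ} (h : CouplingHolds θ φ w s k) (a : ℕ) {u : TreeNode n}
    (hu : u ∈ (coupledTree θ w s k).nodes) (hlen : u.length + a ≤ k) :
    nodeRank w rt (coupledTree θ w s k) a u = vertexRank θ φ w s a (nodeType rt u) := by
  classical
  induction a generalizing u with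
  | zero => rw [nodeRank, vertexRank_zero]
  | succ a ih =>
    rw [nodeRank, vertexRank_succ]
    congr 1
    have hnd : ((coupledTree θ w s k).nodes.filter fun v => v ≠ [] ∧ v.tail = u).Nodup :=
      (nodup_nodes_coupledTree k).filter _
    rw [← List.sum_toFinset _ hnd]
    have hmem : ∀ v, v ∈ ((coupledTree θ w s k).nodes.filter
        fun v => v ≠ [] ∧ v.tail = u).toFinset ↔
        v ∈ (coupledTree θ w s k).nodes ∧ v ≠ [] ∧ v.tail = u := by
      intro v
      simp
    have hzero : ∀ i, i ∉ (Finset.univ.filter fun i => IsEdge θ φ w s i (nodeType rt u)) →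
        vertexRank θ φ w s a i * rankMatrix θ φ w s i (nodeType rt u) = 0 := by
      intro i hi
      have hi' : ¬ IsEdge θ φ w s i (nodeType rt u) := by simpa using hi
      simp [rankMatrix, hi']
    rw [← Finset.sum_subset (Finset.subset_univ _) fun i _ hi => hzero i hi]
    refine Finset.sum_bij (fun v _ => nodeType rt v) ?_ ?_ ?_ ?_
    · intro v hv
      obtain ⟨h1, h2, h3⟩ := (hmem v).1 hv
      simp only [Finset.mem_filter, Finset.mem_univ, true_and]
      exact (h.inNeighbour_iff hu (by omega) _).2 ⟨v, h1, h2, h3, rfl⟩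
    · intro v hv v' hv' e
      exact h.nodeType_injOn ((hmem v).1 hv).1 ((hmem v').1 hv').1 e
    · intro i hi
      simp only [Finset.mem_filter, Finset.mem_univ, true_and] at hi
      obtain ⟨v, h1, h2, h3, h4⟩ := (h.inNeighbour_iff hu (by omega) _).1 hi
      exact ⟨v, (hmem v).2 ⟨h1, h2, h3⟩, h4⟩
    · intro v hv
      obtain ⟨h1, h2, h3⟩ := (hmem v).1 hv
      have he := (h.inNeighbour_iff hu (by omega) _).2 ⟨v, h1, h2, h3, rfl⟩
      have hl : v.length = u.length + 1 := by
        have := List.length_pos_iff.2 h2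
        rw [← h3, List.length_tail]
        omega
      rw [ih h1 (by omega), ← h.outDegree_eq h1 h2]
      simp only [rankMatrix, Matrix.of_apply, he, if_true]
      ring

/-- As long as the coupling holds, the rank of the root agrees with that of the chosen vertex. -/
theorem graphRank_eq_treeRank {k : ℕ} (h : CouplingHolds θ φ w s k) :
    graphRank θ φ w s k = treeRank θ w s k := by
  have hroot : ([] : TreeNode n) ∈ (coupledTree θ w s k).nodes :=
    (mem_nodes_iff_of_length_le (l := 0) (Nat.zero_le k) (by simp)).2
      (by simp [coupledTree, treeStart])
  exact (h.nodeRank_eq k hroot (by simp)).symm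

lemma couplingHolds_of_lt_couplingBreak {k : ℕ} (h : ¬ couplingBreak θ φ w s ≤ k) :
    CouplingHolds θ φ w s k := by
  by_contra hc
  exact h (sInf_le ⟨k, rfl, hc⟩)

/-- Holding up to step `k` implies holding up to every earlier step, so every failing step is at
least `k + 1`. -/
lemma lt_couplingBreak_of_couplingHolds {k : ℕ} (h : CouplingHolds θ φ w s k) :
    ¬ couplingBreak θ φ w s ≤ k := by
  rw [not_le, couplingBreak]
  refine lt_of_lt_of_le (show (k : ℕ∞) < (k + 1 : ℕ) from by exact_mod_cast Nat.lt_succ_self k)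
    (le_sInf ?_)
  rintro m ⟨l, rfl, hl⟩
  by_contra hlt
  refine hl (h.mono ?_)
  have : (l : ℕ∞) < ((k + 1 : ℕ) : ℕ∞) := not_le.1 hlt
  have := Nat.cast_lt.1 this
  omega

end Rank

/-! ### Expectations over a random digraph with independent edges -/

open Classical in
/-- The indicator of a proposition. -/
noncomputable def ind (p : Prop) : ℝ := if p then 1 else 0

lemma ind_of {p : Prop} (h : p) : ind p = 1 := if_pos h

lemma ind_of_not {p : Prop} (h : ¬ p) : ind p = 0 := if_neg h

lemma ind_nonneg (p : Prop) : 0 ≤ ind p := by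
  unfold ind; split_ifs <;> norm_num

lemma ind_le_one (p : Prop) : ind p ≤ 1 := by
  unfold ind; split_ifs <;> norm_num

lemma ind_mono {p q : Prop} (h : p → q) : ind p ≤ ind q := by
  by_cases hp : p
  · rw [ind_of hp, ind_of (h hp)]
  · rw [ind_of_not hp]; exact ind_nonneg q

lemma ind_and (p q : Prop) : ind (p ∧ q) = ind p * ind q := by
  by_cases hp : p <;> by_cases hq : q <;> simp [ind, hp, hq]

lemma ind_ne_zero {p : Prop} : ind p ≠ 0 ↔ p := by
  by_cases hp : p <;> simp [ind, hp]

lemma sum_mem_eq_sum_ind {ι : Type*} [Fintype ι] (s : Finset ι) (f : ι → ℝ) :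
    ∑ j ∈ s, f j = ∑ j, ind (j ∈ s) * f j := by
  classical
  simp [ind]

lemma ind_exists_le_sum {ι : Type*} [Fintype ι] (p : ι → Prop) :
    ind (∃ i, p i) ≤ ∑ i, ind (p i) := by
  by_cases h : ∃ i, p i
  · obtain ⟨i, hi⟩ := h
    rw [ind_of ⟨i, hi⟩, ← ind_of hi]
    exact Finset.single_le_sum (f := fun i => ind (p i)) (fun i _ => ind_nonneg _)
      (Finset.mem_univ i)
  · rw [ind_of_not h]
    exact Finset.sum_nonneg fun i _ => ind_nonneg _

/-- The discretized state of all edges: whether the Poisson variable is positive, and whether it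
differs from the edge indicator. -/
abbrev EdgeStates (n : ℕ) : Type := Fin n × Fin n → Bool × Bool

/-- The adjacency relation given by the first components. -/
def stateEdge {n : ℕ} (c : EdgeStates n) (j t : Fin n) : Prop := (c (j, t)).1 = true

/-- The relation given by the second components. -/
def stateMismatch {n : ℕ} (c : EdgeStates n) (j t : Fin n) : Prop := (c (j, t)).2 = true

/-- The expectation of a function of a uniform vertex and of independent edge states. -/
noncomputable def expect {n : ℕ} (ρ : Fin n × Fin n → Measure (Bool × Bool))
    (F : Fin n → EdgeStates n → ℝ) : ℝ :=
  (n : ℝ)⁻¹ * ∑ ξ, ∫ c, F ξ c ∂Measure.pi ρ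

section Expect

variable {n : ℕ} {ρ : Fin n × Fin n → Measure (Bool × Bool)}

lemma expect_nonneg {F : Fin n → EdgeStates n → ℝ} (h : ∀ ξ c, 0 ≤ F ξ c) : 0 ≤ expect ρ F :=
  mul_nonneg (by positivity) (Finset.sum_nonneg fun ξ _ => integral_nonneg (h ξ))

lemma expect_const_mul (a : ℝ) (F : Fin n → EdgeStates n → ℝ) :
    expect ρ (fun ξ c => a * F ξ c) = a * expect ρ F := by
  simp only [expect, integral_const_mul]
  rw [← Finset.mul_sum]
  ring

lemma expect_mul_const (a : ℝ) (F : Fin n → EdgeStates n → ℝ) :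
    expect ρ (fun ξ c => F ξ c * a) = expect ρ F * a := by
  rw [mul_comm, ← expect_const_mul]
  congr 1
  ext ξ c
  ring

variable [∀ e, IsProbabilityMeasure (ρ e)]

lemma expect_mono {F G : Fin n → EdgeStates n → ℝ} (h : ∀ ξ c, F ξ c ≤ G ξ c) :
    expect ρ F ≤ expect ρ G := by
  refine mul_le_mul_of_nonneg_left (Finset.sum_le_sum fun ξ _ => ?_) (by positivity)
  exact integral_mono .of_finite .of_finite (h ξ)

lemma expect_add (F G : Fin n → EdgeStates n → ℝ) :
    expect ρ (fun ξ c => F ξ c + G ξ c) = expect ρ F + expect ρ G := by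
  simp only [expect]
  rw [← mul_add, ← Finset.sum_add_distrib]
  congr 1
  exact Finset.sum_congr rfl fun ξ _ => integral_add .of_finite .of_finite

lemma expect_sum {ι : Type*} (s : Finset ι) (F : ι → Fin n → EdgeStates n → ℝ) :
    expect ρ (fun ξ c => ∑ i ∈ s, F i ξ c) = ∑ i ∈ s, expect ρ (F i) := by
  simp only [expect]
  rw [← Finset.mul_sum, Finset.sum_comm]
  congr 1
  exact Finset.sum_congr rfl fun ξ _ => integral_finsetSum _ fun i _ => .of_finite

lemma expect_of_root (f : Fin n → ℝ) : expect ρ (fun ξ _ => f ξ) = (∑ i, f i) / n := by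
  simp [expect, div_eq_inv_mul]

/-- Under a product measure, a function that ignores one coordinate is independent of it. -/
lemma integral_mul_ind_coord {ι : Type*} [Fintype ι] {C : Type*} [MeasurableSpace C]
    [Finite C] [MeasurableSingletonClass C] (ν : ι → Measure C) [∀ e, IsProbabilityMeasure (ν e)]
    (e : ι) {F : (ι → C) → ℝ} (hF : ∀ c c', (∀ e' ≠ e, c e' = c' e') → F c = F c')
    (B : C → Prop) :
    ∫ c, F c * ind (B (c e)) ∂Measure.pi ν = (∫ c, F c ∂Measure.pi ν) * (ν e).real {b | B b} := by
  classical
  -- An arbitrary filler for the ignored coordinate, so that `F` becomes a function of the remaining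
  -- ones.
  obtain ⟨b₀⟩ : Nonempty C := by
    by_contra h
    rw [not_nonempty_iff] at h
    have := measure_univ (μ := ν e)
    rw [Set.eq_empty_of_isEmpty (Set.univ : Set C), measure_empty] at this
    exact zero_ne_one this
  have hind : iIndepFun (fun (i : ι) (c : ι → C) => c i) (Measure.pi ν) :=
    iIndepFun_pi (X := fun _ b => b) fun i => aemeasurable_id
  have h2 := hind.indepFun_finset ({e}ᶜ : Finset ι) {e}
    (Finset.disjoint_left.2 fun a ha hb => (Finset.mem_compl.1 ha) hb)
    fun i => measurable_pi_apply i
  have h3 := h2.comp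
    (φ := fun y => F fun i => if h : i ∈ ({e}ᶜ : Finset ι) then y ⟨i, h⟩ else b₀)
    (ψ := fun y => ind (B (y ⟨e, Finset.mem_singleton_self e⟩)))
    (Measurable.of_discrete) (Measurable.of_discrete)
  have h4 := h3.integral_fun_mul_eq_mul_integral
    (Measurable.of_discrete.aestronglyMeasurable) (Measurable.of_discrete.aestronglyMeasurable)
  simp only [Function.comp_apply] at h4
  have hF' : ∀ c : ι → C,
      F (fun i => if i ∈ ({e}ᶜ : Finset ι) then c i else b₀) = F c := by
    intro c
    refine hF _ _ fun e' he' => ?_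
    simp [he']
  simp only [dite_eq_ite, hF'] at h4
  rw [h4]
  congr 1
  have h5 : ∫ c, ind (B (c e)) ∂Measure.pi ν = ∫ b, ind (B b) ∂ν e := by
    rw [← (measurePreserving_eval ν e).map_eq, integral_map (measurable_pi_apply e).aemeasurable
      Measurable.of_discrete.aestronglyMeasurable]
  rw [h5]
  have h6 : (fun b => ind (B b)) = Set.indicator {b | B b} 1 := by
    ext b
    by_cases hb : B b <;> simp [ind, hb]
  rw [h6, integral_indicator_one (Set.toFinite _).measurableSet]

/-- A function that depends only on the exploration up to step `r`. -/
def OfHistory (r : ℕ) (Y : Fin n → EdgeStates n → ℝ) : Prop :=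
  ∀ ξ c c', (∀ l ≤ r, exploration (stateEdge c) ξ l = exploration (stateEdge c') ξ l) →
    Y ξ c = Y ξ c'

lemma OfHistory.mul {r : ℕ} {Y Y' : Fin n → EdgeStates n → ℝ} (h : OfHistory r Y)
    (h' : OfHistory r Y') : OfHistory r (fun ξ c => Y ξ c * Y' ξ c) :=
  fun ξ c c' hc => congrArg₂ (· * ·) (h ξ c c' hc) (h' ξ c c' hc)

lemma ofHistory_mem_actSet {l r : ℕ} (hl : l ≤ r) (t : Fin n) :
    OfHistory r (fun ξ c => ind (t ∈ actSet (stateEdge c) ξ l)) := by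
  intro ξ c c' hc
  simp only [actSet, hc l hl]

lemma ofHistory_mem_deadSet {l r : ℕ} (hl : l ≤ r + 1) (t : Fin n) :
    OfHistory r (fun ξ c => ind (t ∈ deadSet (stateEdge c) ξ l)) := by
  intro ξ c c' hc
  cases l with
  | zero => rfl
  | succ l => simp only [deadSet, exploration, hc l (by omega)]

lemma ofHistory_notMem_deadSet {l r : ℕ} (hl : l ≤ r + 1) (t : Fin n) :
    OfHistory r (fun ξ c => ind (t ∉ deadSet (stateEdge c) ξ l)) := by
  intro ξ c c' hc
  cases l with
  | zero => rfl
  | succ l => simp only [deadSet, exploration, hc l (by omega)]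

/-- Whether `t` is unexplored is itself random. Where `Y` is nonzero the column of `t` is unread, so
changing it alters neither the history nor `Y`; if `Y` is zero at both states there is nothing to
show. Hence `Y` ignores the column altogether. -/
lemma OfHistory.eq_of_column {r : ℕ} {Y : Fin n → EdgeStates n → ℝ} (hY : OfHistory r Y) {t : Fin n}
    (hs : ∀ ξ c, Y ξ c ≠ 0 → t ∉ deadSet (stateEdge c) ξ r) {ξ : Fin n} {c c' : EdgeStates n}
    (h : ∀ j t', t' ≠ t → c (j, t') = c' (j, t')) : Y ξ c = Y ξ c' := by
  by_cases h1 : Y ξ c ≠ 0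
  · exact hY ξ c c' (exploration_congr_column (hs ξ c h1) fun j t' ht => by
      simp only [stateEdge, h j t' ht])
  · by_cases h2 : Y ξ c' ≠ 0
    · exact (hY ξ c' c (exploration_congr_column (hs ξ c' h2) fun j t' ht => by
        simp only [stateEdge, h j t' ht])).symm
    · rw [not_not.1 h1, not_not.1 h2]

/-- An edge into a vertex that has not been explored is independent of the exploration. -/
lemma expect_mul_ind {r : ℕ} {Y : Fin n → EdgeStates n → ℝ} (hY : OfHistory r Y) {j t : Fin n}
    (hs : ∀ ξ c, Y ξ c ≠ 0 → t ∉ deadSet (stateEdge c) ξ r) (B : Bool × Bool → Prop) :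
    expect ρ (fun ξ c => Y ξ c * ind (B (c (j, t)))) =
      expect ρ Y * (ρ (j, t)).real {b | B b} := by
  simp only [expect]
  rw [mul_assoc, Finset.sum_mul]
  congr 1
  refine Finset.sum_congr rfl fun ξ _ => integral_mul_ind_coord ρ (j, t) (fun c c' h => ?_) B
  exact hY.eq_of_column hs fun j' t' ht' => h _ fun e => ht' (congrArg Prod.snd e)

/-- The edges are split off one at a time; `e ≠ e'` keeps the first indicator free of the second
coordinate, even when both edges share a column. -/
lemma expect_mul_ind_mul_ind {r : ℕ} {Y : Fin n → EdgeStates n → ℝ} (hY : OfHistory r Y)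
    {e e' : Fin n × Fin n} (hne : e ≠ e')
    (hs : ∀ ξ c, Y ξ c ≠ 0 → e.2 ∉ deadSet (stateEdge c) ξ r ∧ e'.2 ∉ deadSet (stateEdge c) ξ r)
    (B B' : Bool × Bool → Prop) :
    expect ρ (fun ξ c => Y ξ c * (ind (B (c e)) * ind (B' (c e')))) =
      expect ρ Y * ((ρ e).real {b | B b} * (ρ e').real {b | B' b}) := by
  rw [← mul_assoc, ← expect_mul_ind (j := e.1) (t := e.2) hY (fun ξ c h => (hs ξ c h).1) B]
  simp only [expect]
  rw [mul_assoc, Finset.sum_mul]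
  congr 1
  refine Finset.sum_congr rfl fun ξ _ => ?_
  rw [← integral_mul_ind_coord ρ e' (fun c c' h => ?_) B']
  · refine integral_congr_ae (Eventually.of_forall fun c => ?_)
    simp only [mul_assoc]
  · have h1 : Y ξ c = Y ξ c' := hY.eq_of_column (fun ξ c h => (hs ξ c h).2) fun j' t' ht' =>
      h _ fun e => ht' (congrArg Prod.snd e)
    simp only [h1, h e hne]

end Expect

/-! ### Growth of the exploration -/

/-- The sum of `f` over the vertices at distance `r`. -/
noncomputable def actSum {n : ℕ} (f : Fin n → ℝ) (r : ℕ) (ξ : Fin n) (c : EdgeStates n) : ℝ :=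
  ∑ j ∈ actSet (stateEdge c) ξ r, f j

/-- Before step `r`, all active vertices were good, and their total weight was at most `x μ ^ l`. -/
def okBefore {n : ℕ} (p : Fin n → ℝ) (good : Fin n → Prop) (x μ : ℝ) (r : ℕ) (ξ : Fin n)
    (c : EdgeStates n) : Prop :=
  ∀ l < r, actSum p l ξ c ≤ x * μ ^ l ∧ ∀ i ∈ actSet (stateEdge c) ξ l, good i

section Growth

variable {n : ℕ} {ρ : Fin n × Fin n → Measure (Bool × Bool)}
  {m p f : Fin n → ℝ} {N x μ : ℝ} {good : Fin n → Prop}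

lemma actSum_eq (f : Fin n → ℝ) (r : ℕ) (ξ : Fin n) (c : EdgeStates n) :
    actSum f r ξ c = ∑ j, ind (j ∈ actSet (stateEdge c) ξ r) * f j :=
  sum_mem_eq_sum_ind _ _

lemma actSum_nonneg (hf : ∀ i, 0 ≤ f i) (r : ℕ) (ξ : Fin n) (c : EdgeStates n) :
    0 ≤ actSum f r ξ c := Finset.sum_nonneg fun i _ => hf i

lemma ofHistory_actSum {l r : ℕ} (hl : l ≤ r) (f : Fin n → ℝ) : OfHistory r (actSum f l) := by
  intro ξ c c' hc
  simp only [actSum, actSet, hc l hl]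

lemma ofHistory_okBefore {r s : ℕ} (h : r ≤ s + 1) :
    OfHistory s (fun ξ c => ind (okBefore p good x μ r ξ c)) := by
  intro ξ c c' hc
  have : okBefore p good x μ r ξ c ↔ okBefore p good x μ r ξ c' := by
    refine forall_congr' fun l => forall_congr' fun hl => ?_
    simp only [actSum, actSet, hc l (by omega)]
  simp only [this]

lemma okBefore.mono {r s : ℕ} (h : r ≤ s) {ξ : Fin n} {c : EdgeStates n}
    (hs : okBefore p good x μ s ξ c) : okBefore p good x μ r ξ c :=
  fun l hl => hs l (hl.trans_le h)

lemma ind_okBefore_anti {r s : ℕ} (h : r ≤ s) (ξ : Fin n) (c : EdgeStates n) :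
    ind (okBefore p good x μ s ξ c) ≤ ind (okBefore p good x μ r ξ c) :=
  ind_mono fun hs => hs.mono h

lemma okBefore_zero (ξ : Fin n) (c : EdgeStates n) : okBefore p good x μ 0 ξ c :=
  fun l hl => absurd hl (Nat.not_lt_zero l)

lemma okBefore_succ {r : ℕ} {ξ : Fin n} {c : EdgeStates n} :
    okBefore p good x μ (r + 1) ξ c ↔ okBefore p good x μ r ξ c ∧ actSum p r ξ c ≤ x * μ ^ r ∧
      ∀ i ∈ actSet (stateEdge c) ξ r, good i := by
  constructor
  · intro h
    exact ⟨h.mono (Nat.le_succ r), h r (Nat.lt_succ_self r)⟩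
  · rintro ⟨h, hr⟩ l hl
    rcases Nat.lt_succ_iff_lt_or_eq.1 hl with hl | rfl
    exacts [h l hl, hr]

lemma ind_mem_actSet_succ_le (r : ℕ) (ξ : Fin n) (c : EdgeStates n) (j : Fin n) :
    ind (j ∈ actSet (stateEdge c) ξ (r + 1)) ≤
      ∑ t, ind (t ∈ actSet (stateEdge c) ξ r) * ind (stateEdge c j t) := by
  simp only [← ind_and]
  exact (ind_mono fun h => (mem_actSet_succ.1 h).2).trans (ind_exists_le_sum _)

variable [∀ e, IsProbabilityMeasure (ρ e)]

/-- The expected weight of the next generation. -/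
lemma expect_mul_actSum_succ_le (hf : ∀ i, 0 ≤ f i)
    (hq : ∀ j t, (ρ (j, t)).real {b | b.1 = true} ≤ m j * p t / N) {r : ℕ}
    {Y : Fin n → EdgeStates n → ℝ} (hY : OfHistory r Y) (hY0 : ∀ ξ c, 0 ≤ Y ξ c) :
    expect ρ (fun ξ c => Y ξ c * actSum f (r + 1) ξ c) ≤
      expect ρ (fun ξ c => Y ξ c * actSum p r ξ c) * ((∑ j, m j * f j) / N) := by
  have h1 : ∀ ξ c, Y ξ c * actSum f (r + 1) ξ c ≤
      ∑ j, ∑ t, f j * (Y ξ c * ind (t ∈ actSet (stateEdge c) ξ r) * ind (stateEdge c j t)) := by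
    intro ξ c
    rw [actSum_eq, Finset.mul_sum]
    refine Finset.sum_le_sum fun j _ => ?_
    rw [← Finset.mul_sum, ← mul_assoc, mul_comm _ (f j)]
    refine mul_le_mul_of_nonneg_left ?_ (hf j)
    simp only [mul_assoc]
    rw [← Finset.mul_sum]
    exact mul_le_mul_of_nonneg_left (ind_mem_actSet_succ_le r ξ c j) (hY0 ξ c)
  refine (expect_mono h1).trans ?_
  rw [expect_sum]
  have h2 : ∀ j t, expect ρ (fun ξ c => f j * (Y ξ c * ind (t ∈ actSet (stateEdge c) ξ r) *
      ind (stateEdge c j t))) ≤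
      f j * (expect ρ (fun ξ c => Y ξ c * ind (t ∈ actSet (stateEdge c) ξ r)) *
        (m j * p t / N)) := by
    intro j t
    rw [expect_const_mul]
    refine mul_le_mul_of_nonneg_left ?_ (hf j)
    have := expect_mul_ind (ρ := ρ) (hY.mul (ofHistory_mem_actSet le_rfl t)) (j := j) (t := t)
      (fun ξ c h => notMem_deadSet_of_mem_actSet (ind_ne_zero.1 (right_ne_zero_of_mul h)))
      (fun b => b.1 = true)
    rw [show expect ρ (fun ξ c => Y ξ c * ind (t ∈ actSet (stateEdge c) ξ r) *
      ind (stateEdge c j t)) = _ from this]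
    exact mul_le_mul_of_nonneg_left (hq j t)
      (expect_nonneg fun ξ c => mul_nonneg (hY0 ξ c) (ind_nonneg _))
  have h3 : expect ρ (fun ξ c => Y ξ c * actSum p r ξ c) =
      ∑ t, expect ρ (fun ξ c => Y ξ c * ind (t ∈ actSet (stateEdge c) ξ r)) * p t := by
    simp only [actSum_eq, Finset.mul_sum, ← mul_assoc]
    rw [expect_sum]
    simp only [expect_mul_const]
  rw [h3, Finset.sum_div, Finset.sum_mul_sum]
  simp only [expect_sum]
  refine (Finset.sum_le_sum fun j _ => Finset.sum_le_sum fun t _ => h2 j t).trans ?_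
  rw [Finset.sum_comm]
  refine Finset.sum_le_sum fun t _ => Finset.sum_le_sum fun j _ => le_of_eq (by ring)

/-- The expected weight of pairs in the next generation. -/
lemma expect_mul_pairSum_succ_le (hf : ∀ i, 0 ≤ f i)
    (hq : ∀ j t, (ρ (j, t)).real {b | b.1 = true} ≤ m j * p t / N) {r : ℕ}
    {Y : Fin n → EdgeStates n → ℝ} (hY : OfHistory r Y) (hY0 : ∀ ξ c, 0 ≤ Y ξ c) :
    expect ρ (fun ξ c => Y ξ c * ∑ j, ∑ j', ind (j ≠ j') *
        (ind (j ∈ actSet (stateEdge c) ξ (r + 1)) *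
          ind (j' ∈ actSet (stateEdge c) ξ (r + 1)) * (f j * f j'))) ≤
      expect ρ (fun ξ c => Y ξ c * actSum p r ξ c ^ 2) * ((∑ j, m j * f j) / N) ^ 2 := by
  have h1 : ∀ ξ c, Y ξ c * ∑ j, ∑ j', ind (j ≠ j') *
        (ind (j ∈ actSet (stateEdge c) ξ (r + 1)) *
          ind (j' ∈ actSet (stateEdge c) ξ (r + 1)) * (f j * f j')) ≤
      ∑ j, ∑ j', ∑ t, ∑ t', ind (j ≠ j') * (f j * f j') * (Y ξ c *
        ind (t ∈ actSet (stateEdge c) ξ r) * ind (t' ∈ actSet (stateEdge c) ξ r) *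
        (ind (stateEdge c j t) * ind (stateEdge c j' t'))) := by
    intro ξ c
    rw [Finset.mul_sum]
    refine Finset.sum_le_sum fun j _ => ?_
    rw [Finset.mul_sum]
    refine Finset.sum_le_sum fun j' _ => ?_
    have hmul := mul_le_mul (ind_mem_actSet_succ_le r ξ c j) (ind_mem_actSet_succ_le r ξ c j')
      (ind_nonneg _) (Finset.sum_nonneg fun t _ => mul_nonneg (ind_nonneg _) (ind_nonneg _))
    rw [Finset.sum_mul_sum] at hmul
    have h0 : 0 ≤ ind (j ≠ j') * (f j * f j') * Y ξ c :=
      mul_nonneg (mul_nonneg (ind_nonneg _) (mul_nonneg (hf j) (hf j'))) (hY0 ξ c)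
    refine (le_of_eq ?_).trans ((mul_le_mul_of_nonneg_left hmul h0).trans (le_of_eq ?_))
    · ring
    · simp only [Finset.mul_sum]
      refine Finset.sum_congr rfl fun t _ => Finset.sum_congr rfl fun t' _ => ?_
      ring
  refine (expect_mono h1).trans ?_
  have h2 : ∀ j j' t t', expect ρ (fun ξ c => ind (j ≠ j') * (f j * f j') * (Y ξ c *
        ind (t ∈ actSet (stateEdge c) ξ r) * ind (t' ∈ actSet (stateEdge c) ξ r) *
        (ind (stateEdge c j t) * ind (stateEdge c j' t')))) ≤
      (f j * f j') * (expect ρ (fun ξ c => Y ξ c * ind (t ∈ actSet (stateEdge c) ξ r) *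
        ind (t' ∈ actSet (stateEdge c) ξ r)) * ((m j * p t / N) * (m j' * p t' / N))) := by
    intro j j' t t'
    have hE : 0 ≤ expect ρ (fun ξ c => Y ξ c * ind (t ∈ actSet (stateEdge c) ξ r) *
        ind (t' ∈ actSet (stateEdge c) ξ r)) := expect_nonneg fun ξ c =>
          mul_nonneg (mul_nonneg (hY0 ξ c) (ind_nonneg _)) (ind_nonneg _)
    have hQ : ∀ j t, 0 ≤ m j * p t / N := fun j t => measureReal_nonneg.trans (hq j t)
    rw [expect_const_mul]
    -- Distinct sources make the two edges distinct even if `t = t'`, hence independent; the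
    -- diagonal has weight 0.
    by_cases hjj : j = j'
    · rw [ind_of_not (not_not.2 hjj)]
      have := mul_nonneg (mul_nonneg (hf j) (hf j'))
        (mul_nonneg hE (mul_nonneg (hQ j t) (hQ j' t')))
      simpa using this
    · rw [ind_of hjj, one_mul]
      refine mul_le_mul_of_nonneg_left ?_ (mul_nonneg (hf j) (hf j'))
      have := expect_mul_ind_mul_ind (ρ := ρ) ((hY.mul (ofHistory_mem_actSet le_rfl t)).mul
        (ofHistory_mem_actSet le_rfl t')) (e := (j, t)) (e' := (j', t'))
        (fun h => hjj (congrArg Prod.fst h))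
        (fun ξ c h => ⟨notMem_deadSet_of_mem_actSet (ind_ne_zero.1
          (right_ne_zero_of_mul (left_ne_zero_of_mul h))),
          notMem_deadSet_of_mem_actSet (ind_ne_zero.1 (right_ne_zero_of_mul h))⟩)
        (fun b => b.1 = true) (fun b => b.1 = true)
      rw [show expect ρ (fun ξ c => Y ξ c *
        ind (t ∈ actSet (stateEdge c) ξ r) * ind (t' ∈ actSet (stateEdge c) ξ r) *
        (ind (stateEdge c j t) * ind (stateEdge c j' t'))) = _ from this]
      exact mul_le_mul_of_nonneg_left
        (mul_le_mul (hq j t) (hq j' t') measureReal_nonneg (hQ j t)) hE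
  have h3 : expect ρ (fun ξ c => Y ξ c * actSum p r ξ c ^ 2) =
      ∑ t, ∑ t', expect ρ (fun ξ c => Y ξ c * ind (t ∈ actSet (stateEdge c) ξ r) *
        ind (t' ∈ actSet (stateEdge c) ξ r)) * (p t * p t') := by
    simp only [← expect_mul_const, ← expect_sum]
    congr 1
    ext ξ c
    rw [actSum_eq, sq, Finset.sum_mul_sum, Finset.mul_sum]
    refine Finset.sum_congr rfl fun t _ => ?_
    rw [Finset.mul_sum]
    refine Finset.sum_congr rfl fun t' _ => ?_
    ring
  simp only [expect_sum]
  refine (Finset.sum_le_sum fun j _ => Finset.sum_le_sum fun j' _ => Finset.sum_le_sum fun t _ =>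
    Finset.sum_le_sum fun t' _ => h2 j j' t t').trans (le_of_eq ?_)
  rw [h3, div_pow, sq, Finset.sum_mul_sum, Finset.sum_div, Finset.mul_sum]
  refine Finset.sum_congr rfl fun j _ => ?_
  rw [Finset.sum_div, Finset.mul_sum]
  refine Finset.sum_congr rfl fun j' _ => ?_
  rw [Finset.sum_mul]
  refine Finset.sum_congr rfl fun t _ => ?_
  rw [Finset.sum_mul]
  refine Finset.sum_congr rfl fun t' _ => ?_
  ring

/-- The expected weight of the vertices at distance `r`. -/
lemma expect_okBefore_mul_weight_le (hp : ∀ i, 0 ≤ p i)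
    (hq : ∀ j t, (ρ (j, t)).real {b | b.1 = true} ≤ m j * p t / N)
    (hμ : (∑ j, m j * p j) / N = μ) (hμ0 : 0 ≤ μ) (r : ℕ) :
    expect ρ (fun ξ c => ind (okBefore p good x μ r ξ c) * actSum p r ξ c) ≤
      (∑ i, p i) / n * μ ^ r := by
  induction r with
  | zero =>
    rw [pow_zero, mul_one, ← expect_of_root (ρ := ρ)]
    refine expect_mono fun ξ c => ?_
    simp [actSum, ind_of (okBefore_zero ξ c)]
  | succ r ih =>
    refine (expect_mul_actSum_succ_le hp hq (ofHistory_okBefore le_rfl)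
      fun ξ c => ind_nonneg _).trans ?_
    rw [hμ, pow_succ, ← mul_assoc]
    refine mul_le_mul_of_nonneg_right (le_trans (expect_mono fun ξ c => ?_) ih) hμ0
    exact mul_le_mul_of_nonneg_right (ind_okBefore_anti (Nat.le_succ r) ξ c)
      (actSum_nonneg hp r ξ c)

/-- The expected sum of a function over the vertices at distance `r`. -/
lemma expect_okBefore_mul_actSum_le (hf : ∀ i, 0 ≤ f i) (hp : ∀ i, 0 ≤ p i)
    (hq : ∀ j t, (ρ (j, t)).real {b | b.1 = true} ≤ m j * p t / N)
    (hμ : (∑ j, m j * p j) / N = μ) (hμ0 : 0 ≤ μ) {B : ℝ} (hB : (∑ i, f i) / n ≤ B)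
    (hB0 : 0 ≤ (∑ j, m j * f j) / N)
    (hBμ : (∑ i, p i) / n * ((∑ j, m j * f j) / N) ≤ B * μ) (r : ℕ) :
    expect ρ (fun ξ c => ind (okBefore p good x μ r ξ c) * actSum f r ξ c) ≤ B * μ ^ r := by
  cases r with
  | zero =>
    rw [pow_zero, mul_one]
    refine le_trans ?_ hB
    rw [← expect_of_root (ρ := ρ)]
    refine expect_mono fun ξ c => ?_
    simp [actSum, ind_of (okBefore_zero ξ c)]
  | succ r =>
    refine (expect_mul_actSum_succ_le hf hq (ofHistory_okBefore le_rfl)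
      fun ξ c => ind_nonneg _).trans ?_
    have h1 : expect ρ (fun ξ c => ind (okBefore p good x μ (r + 1) ξ c) * actSum p r ξ c) ≤
        (∑ i, p i) / n * μ ^ r :=
      (expect_mono fun ξ c => mul_le_mul_of_nonneg_right (ind_okBefore_anti (Nat.le_succ r) ξ c)
        (actSum_nonneg hp r ξ c)).trans (expect_okBefore_mul_weight_le hp hq hμ hμ0 r)
    refine (mul_le_mul_of_nonneg_right h1 hB0).trans ?_
    calc _ = (∑ i, p i) / n * ((∑ j, m j * f j) / N) * μ ^ r := by ring
      _ ≤ B * μ * μ ^ r := mul_le_mul_of_nonneg_right hBμ (pow_nonneg hμ0 r)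
      _ = B * μ ^ (r + 1) := by ring

/-- A maximal inequality for the weights of the generations. -/
lemma expect_weight_exceeds_le (hp : ∀ i, 0 ≤ p i)
    (hq : ∀ j t, (ρ (j, t)).real {b | b.1 = true} ≤ m j * p t / N)
    (hμ : (∑ j, m j * p j) / N = μ) (hμ0 : 0 < μ) (R : ℕ) :
    x * ∑ r ∈ Finset.range R, expect ρ (fun ξ c => ind (okBefore p good x μ r ξ c ∧
        x * μ ^ r < actSum p r ξ c)) +
      expect ρ (fun ξ c => ind (okBefore p good x μ R ξ c) * actSum p R ξ c) / μ ^ R ≤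
      (∑ i, p i) / n := by
  induction R with
  | zero =>
    have := expect_okBefore_mul_weight_le (good := good) (x := x) hp hq hμ hμ0.le 0
    simpa using this
  | succ R ih =>
    -- As in Doob's inequality, the mass that crosses the barrier at level `R` is paid for by the
    -- drop from `E[P_R] / μ ^ R` to the next term.
    refine le_trans ?_ ih
    rw [Finset.sum_range_succ, mul_add, add_assoc]
    refine add_le_add le_rfl ?_
    rw [le_div_iff₀ (pow_pos hμ0 R), add_mul]
    have h1 := expect_mul_actSum_succ_le (ρ := ρ) hp hq
      (ofHistory_okBefore (p := p) (good := good) (x := x) (μ := μ) (le_refl (R + 1)))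
      fun ξ c => ind_nonneg _
    rw [hμ] at h1
    have h2 : expect ρ (fun ξ c => ind (okBefore p good x μ (R + 1) ξ c) *
        actSum p (R + 1) ξ c) / μ ^ (R + 1) * μ ^ R ≤
        expect ρ (fun ξ c => ind (okBefore p good x μ (R + 1) ξ c) * actSum p R ξ c) := by
      rw [pow_succ, div_mul_eq_mul_div, div_le_iff₀ (by positivity)]
      calc _ ≤ _ := mul_le_mul_of_nonneg_right h1 (pow_nonneg hμ0.le R)
        _ = _ := by ring
    refine (add_le_add le_rfl h2).trans ?_
    rw [mul_right_comm, ← expect_const_mul, ← expect_add]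
    refine expect_mono fun ξ c => ?_
    have hP := actSum_nonneg hp R ξ c
    -- The first summand lives where the barrier is crossed at `R` and the second where it is not,
    -- so only one of them is present; each is at most the controlled weight.
    by_cases h : x * μ ^ R < actSum p R ξ c
    · have hnot : ¬ okBefore p good x μ (R + 1) ξ c := fun h' =>
        absurd (okBefore_succ.1 h').2.1 (not_le.2 h)
      rw [ind_of_not hnot, zero_mul, add_zero, ind_and, ind_of h, mul_one, mul_comm]
      exact mul_le_mul_of_nonneg_left h.le (ind_nonneg _)
    · rw [ind_of_not (fun h' => h h'.2), mul_zero, zero_add]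
      exact mul_le_mul_of_nonneg_right (ind_okBefore_anti (Nat.le_succ R) ξ c) hP

/-- Decomposition by the first level at which control is lost: there a bad vertex occurs or the
weight crosses its barrier. -/
lemma ind_not_okBefore_le (k : ℕ) (ξ : Fin n) (c : EdgeStates n) :
    ind (¬ okBefore p good x μ k ξ c) ≤ ∑ r ∈ Finset.range k,
      (ind (okBefore p good x μ r ξ c) * actSum (fun i => ind (¬ good i)) r ξ c +
        ind (okBefore p good x μ r ξ c ∧ x * μ ^ r < actSum p r ξ c)) := by
  induction k with
  | zero => simp [ind_of_not (not_not.2 (okBefore_zero (p := p) (good := good) ξ c))]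
  | succ k ih =>
    rw [Finset.sum_range_succ]
    by_cases h : okBefore p good x μ k ξ c
    · have h0 := (ind_nonneg (¬ okBefore p good x μ k ξ c)).trans ih
      refine le_trans ?_ (le_add_of_nonneg_left h0)
      rw [ind_and, ind_of h, one_mul, one_mul]
      have hb : ∀ i, 0 ≤ ind (¬ good i) := fun i => ind_nonneg _
      have hS := actSum_nonneg hb k ξ c
      by_cases hx : x * μ ^ k < actSum p k ξ c
      · rw [ind_of hx]
        linarith [ind_le_one (¬ okBefore p good x μ (k + 1) ξ c)]
      · by_cases hg : ∀ i ∈ actSet (stateEdge c) ξ k, good i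
        · rw [ind_of_not (not_not.2 (okBefore_succ.2 ⟨h, not_lt.1 hx, hg⟩))]
          linarith [ind_nonneg (x * μ ^ k < actSum p k ξ c)]
        · push Not at hg
          obtain ⟨i, hi, hgi⟩ := hg
          have h1 : ind (¬ good i) ≤ actSum (fun i => ind (¬ good i)) k ξ c :=
            Finset.single_le_sum (f := fun i => ind (¬ good i)) (fun i _ => hb i) hi
          rw [ind_of hgi] at h1
          linarith [ind_le_one (¬ okBefore p good x μ (k + 1) ξ c),
            ind_nonneg (x * μ ^ k < actSum p k ξ c)]
    · refine le_trans ?_ (le_add_of_nonneg_right (add_nonneg (mul_nonneg (ind_nonneg _)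
        (actSum_nonneg (fun i => ind_nonneg _) k ξ c)) (ind_nonneg _)))
      refine le_trans ?_ ih
      rw [ind_of h]
      exact ind_le_one _

end Growth

/-! ### The expected number of defects -/

/-- The sum of `f` over the vertices at distance less than `r`. -/
noncomputable def deadSum {n : ℕ} (f : Fin n → ℝ) (r : ℕ) (ξ : Fin n) (c : EdgeStates n) : ℝ :=
  ∑ j ∈ deadSet (stateEdge c) ξ r, f j

/-- The number of mismatches on edges from a vertex at distance `r` to an unexplored one. -/
noncomputable def outMismatches {n : ℕ} (r : ℕ) (ξ : Fin n) (c : EdgeStates n) : ℝ :=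
  ∑ e : Fin n × Fin n, ind (e.1 ≠ e.2) * (ind (e.1 ∈ actSet (stateEdge c) ξ r) *
    ind (e.2 ∉ deadSet (stateEdge c) ξ r) * ind (stateMismatch c e.1 e.2))

/-- The number of mismatches on edges into a vertex at distance `r`. -/
noncomputable def inMismatches {n : ℕ} (r : ℕ) (ξ : Fin n) (c : EdgeStates n) : ℝ :=
  ∑ e : Fin n × Fin n, ind (e.1 ≠ e.2) * (ind (e.2 ∈ actSet (stateEdge c) ξ r) *
    ind (stateMismatch c e.1 e.2))

/-- The number of edges from an explored vertex into a vertex at distance `r`. -/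
noncomputable def returnEdges {n : ℕ} (r : ℕ) (ξ : Fin n) (c : EdgeStates n) : ℝ :=
  ∑ e : Fin n × Fin n, 1 * (ind (e.2 ∈ actSet (stateEdge c) ξ r) *
    ind (e.1 ∈ deadSet (stateEdge c) ξ (r + 1)) * ind (stateEdge c e.1 e.2))

/-- The number of pairs of edges with the same target, one of them from distance `r`. -/
noncomputable def commonTargets {n : ℕ} (r : ℕ) (ξ : Fin n) (c : EdgeStates n) : ℝ :=
  ∑ i : Fin n × Fin n × Fin n, ind (i.1 ≠ i.2.1) * (ind (i.1 ∈ actSet (stateEdge c) ξ r) *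
    ind (i.2.1 ∈ deadSet (stateEdge c) ξ (r + 1)) * ind (i.2.2 ∉ deadSet (stateEdge c) ξ r) *
    (ind (stateEdge c i.1 i.2.2) * ind (stateEdge c i.2.1 i.2.2)))

/-- The number of pairs of edges with the same source into vertices at distance `r`. -/
noncomputable def commonSources {n : ℕ} (r : ℕ) (ξ : Fin n) (c : EdgeStates n) : ℝ :=
  ∑ i : Fin n × Fin n × Fin n, ind (i.1 ≠ i.2.1) * (ind (i.1 ∈ actSet (stateEdge c) ξ r) *
    ind (i.2.1 ∈ actSet (stateEdge c) ξ r) *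
    (ind (stateEdge c i.2.2 i.1) * ind (stateEdge c i.2.2 i.2.1)))

/-- The total rate of the independent parts of the marks that have to vanish at distance `r`. -/
noncomputable def starRate {n : ℕ} (m p : Fin n → ℝ) (N : ℝ) (r : ℕ) (ξ : Fin n)
    (c : EdgeStates n) : ℝ :=
  ∑ j ∈ actSet (stateEdge c) ξ r,
    (∑ t ∈ deadSet (stateEdge c) ξ r, m j * p t / N + m j * p j / N)

/-- A bound for the number of defects at distance `r`. -/
noncomputable def defectCount {n : ℕ} (m p : Fin n → ℝ) (N : ℝ) (r : ℕ) (ξ : Fin n)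
    (c : EdgeStates n) : ℝ :=
  outMismatches r ξ c + inMismatches r ξ c + returnEdges r ξ c + commonTargets r ξ c +
    commonSources r ξ c + starRate m p N r ξ c

section Defects

variable {n : ℕ} {ρ : Fin n × Fin n → Measure (Bool × Bool)}
  {m p f : Fin n → ℝ} {N x μ : ℝ} {good : Fin n → Prop}

lemma deadSum_zero (f : Fin n → ℝ) (ξ : Fin n) (c : EdgeStates n) : deadSum f 0 ξ c = 0 := by
  simp [deadSum]

lemma deadSum_succ (f : Fin n → ℝ) (r : ℕ) (ξ : Fin n) (c : EdgeStates n) :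
    deadSum f (r + 1) ξ c = deadSum f r ξ c + actSum f r ξ c := by
  rw [deadSum, deadSet_succ, Finset.sum_union]
  · rfl
  · exact Finset.disjoint_left.2 fun j hj hj' => notMem_deadSet_of_mem_actSet hj' hj

lemma deadSum_eq_sum_actSum (f : Fin n → ℝ) (r : ℕ) (ξ : Fin n) (c : EdgeStates n) :
    deadSum f r ξ c = ∑ l ∈ Finset.range r, actSum f l ξ c := by
  induction r with
  | zero => simp [deadSum_zero]
  | succ r ih => rw [deadSum_succ, ih, Finset.sum_range_succ]

lemma deadSum_eq (f : Fin n → ℝ) (r : ℕ) (ξ : Fin n) (c : EdgeStates n) :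
    deadSum f r ξ c = ∑ j, ind (j ∈ deadSet (stateEdge c) ξ r) * f j :=
  sum_mem_eq_sum_ind _ _

lemma deadSum_nonneg (hf : ∀ i, 0 ≤ f i) (r : ℕ) (ξ : Fin n) (c : EdgeStates n) :
    0 ≤ deadSum f r ξ c := Finset.sum_nonneg fun i _ => hf i

lemma ofHistory_deadSum {l r : ℕ} (hl : l ≤ r + 1) (f : Fin n → ℝ) :
    OfHistory r (deadSum f l) := by
  intro ξ c c' hc
  simp only [deadSum_eq_sum_actSum]
  refine Finset.sum_congr rfl fun i hi => ?_
  exact ofHistory_actSum (by have := Finset.mem_range.1 hi; omega) f ξ c c' hc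

lemma ind_okBefore_mul_actSum_le {r : ℕ} (ξ : Fin n) (c : EdgeStates n) :
    ind (okBefore p good x μ (r + 1) ξ c) * actSum p r ξ c ≤
      ind (okBefore p good x μ (r + 1) ξ c) * (x * μ ^ r) := by
  by_cases h : okBefore p good x μ (r + 1) ξ c
  · rw [ind_of h, one_mul, one_mul]
    exact (h r (Nat.lt_succ_self r)).1
  · rw [ind_of_not h, zero_mul, zero_mul]

lemma ind_okBefore_mul_deadSum_le {r : ℕ} (ξ : Fin n) (c : EdgeStates n) :
    ind (okBefore p good x μ r ξ c) * deadSum p r ξ c ≤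
      ind (okBefore p good x μ r ξ c) * (x * ∑ l ∈ Finset.range r, μ ^ l) := by
  by_cases h : okBefore p good x μ r ξ c
  · rw [ind_of h, one_mul, one_mul, deadSum_eq_sum_actSum, Finset.mul_sum]
    exact Finset.sum_le_sum fun l hl => (h l (Finset.mem_range.1 hl)).1
  · rw [ind_of_not h, zero_mul, zero_mul]

variable [∀ e, IsProbabilityMeasure (ρ e)]

/-- A count of edges, each weighted by a function of the history supported where its target is
unexplored, may be replaced in expectation by its conditional rate. All single-edge defects have
this shape. -/
lemma expect_sum_ind_le {ι : Type*} [Fintype ι] {r : ℕ} {v β : ι → ℝ} {e : ι → Fin n × Fin n}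
    {A : ι → Fin n → EdgeStates n → ℝ} (hv : ∀ i, 0 ≤ v i) (hA : ∀ i, OfHistory r (A i))
    (hA0 : ∀ i ξ c, 0 ≤ A i ξ c)
    (hs : ∀ i ξ c, A i ξ c ≠ 0 → (e i).2 ∉ deadSet (stateEdge c) ξ r)
    (B : Bool × Bool → Prop) (hβ : ∀ i, (ρ (e i)).real {b | B b} ≤ β i) :
    expect ρ (fun ξ c => ∑ i, v i * (A i ξ c * ind (B (c (e i))))) ≤
      expect ρ (fun ξ c => ∑ i, v i * (A i ξ c * β i)) := by
  simp only [expect_sum, expect_const_mul, expect_mul_const]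
  refine Finset.sum_le_sum fun i _ => mul_le_mul_of_nonneg_left ?_ (hv i)
  rw [← Prod.mk.eta (p := e i), expect_mul_ind (hA i) (hs i) B]
  exact mul_le_mul_of_nonneg_left (hβ i) (expect_nonneg (hA0 i))

/-- The same for pairs of edges; distinctness is required only where the deterministic weight is
nonzero. -/
lemma expect_sum_ind_mul_ind_le {ι : Type*} [Fintype ι] {r : ℕ} {v β β' : ι → ℝ}
    {e e' : ι → Fin n × Fin n} {A : ι → Fin n → EdgeStates n → ℝ} (hv : ∀ i, 0 ≤ v i)
    (hne : ∀ i, v i ≠ 0 → e i ≠ e' i) (hA : ∀ i, OfHistory r (A i)) (hA0 : ∀ i ξ c, 0 ≤ A i ξ c)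
    (hs : ∀ i ξ c, A i ξ c ≠ 0 →
      (e i).2 ∉ deadSet (stateEdge c) ξ r ∧ (e' i).2 ∉ deadSet (stateEdge c) ξ r)
    (B : Bool × Bool → Prop) (hβ : ∀ i, (ρ (e i)).real {b | B b} ≤ β i)
    (hβ' : ∀ i, (ρ (e' i)).real {b | B b} ≤ β' i) :
    expect ρ (fun ξ c => ∑ i, v i * (A i ξ c * (ind (B (c (e i))) * ind (B (c (e' i)))))) ≤
      expect ρ (fun ξ c => ∑ i, v i * (A i ξ c * (β i * β' i))) := by
  simp only [expect_sum, expect_const_mul, expect_mul_const]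
  refine Finset.sum_le_sum fun i _ => ?_
  by_cases h0 : v i = 0
  · simp [h0]
  · refine mul_le_mul_of_nonneg_left ?_ (hv i)
    rw [expect_mul_ind_mul_ind (hA i) (hne i h0) (hs i) B B]
    exact mul_le_mul_of_nonneg_left (mul_le_mul (hβ i) (hβ' i) measureReal_nonneg
      (measureReal_nonneg.trans (hβ i))) (expect_nonneg (hA0 i))

/-- The expected sum of a function over the vertices at distance less than `r`. -/
lemma expect_okBefore_mul_deadSum_le {B : ℝ} (hf : ∀ i, 0 ≤ f i)
    (hB : ∀ l, expect ρ (fun ξ c => ind (okBefore p good x μ l ξ c) * actSum f l ξ c) ≤ B * μ ^ l)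
    {r s : ℕ} (hr : r ≤ s + 1) :
    expect ρ (fun ξ c => ind (okBefore p good x μ s ξ c) * deadSum f r ξ c) ≤
      B * ∑ l ∈ Finset.range r, μ ^ l := by
  simp only [deadSum_eq_sum_actSum, Finset.mul_sum]
  rw [expect_sum]
  refine Finset.sum_le_sum fun l hl => le_trans (expect_mono fun ξ c => ?_) (hB l)
  have := Finset.mem_range.1 hl
  exact mul_le_mul_of_nonneg_right (ind_okBefore_anti (by omega) ξ c) (actSum_nonneg hf l ξ c)

lemma expect_outMismatches_le (r : ℕ) :
    expect ρ (fun ξ c => ind (okBefore p good x μ (r + 1) ξ c) * outMismatches r ξ c) ≤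
      expect ρ (fun ξ c => ind (okBefore p good x μ (r + 1) ξ c) *
        actSum (fun j => ∑ t, ind (j ≠ t) * (ρ (j, t)).real {b | b.2 = true}) r ξ c) := by
  have h := expect_sum_ind_le (ρ := ρ) (ι := Fin n × Fin n) (r := r)
    (v := fun e => ind (e.1 ≠ e.2)) (e := id)
    (A := fun e ξ c => ind (okBefore p good x μ (r + 1) ξ c) *
      (ind (e.1 ∈ actSet (stateEdge c) ξ r) * ind (e.2 ∉ deadSet (stateEdge c) ξ r)))
    (fun e => ind_nonneg _)
    (fun e => (ofHistory_okBefore le_rfl).mul ((ofHistory_mem_actSet le_rfl _).mul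
      (ofHistory_notMem_deadSet (Nat.le_succ r) _)))
    (fun e ξ c => mul_nonneg (ind_nonneg _) (mul_nonneg (ind_nonneg _) (ind_nonneg _)))
    (fun e ξ c h => ind_ne_zero.1 (right_ne_zero_of_mul (right_ne_zero_of_mul h)))
    (fun b => b.2 = true) (fun e => le_rfl)
  refine le_trans (le_of_eq ?_) (h.trans (expect_mono fun ξ c => ?_))
  · congr 1
    ext ξ c
    rw [outMismatches, Finset.mul_sum]
    refine Finset.sum_congr rfl fun e _ => ?_
    rw [stateMismatch, Prod.mk.eta, id]
    ring
  · rw [actSum_eq, Finset.mul_sum, Fintype.sum_prod_type]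
    refine Finset.sum_le_sum fun j _ => ?_
    rw [Finset.mul_sum, Finset.mul_sum]
    refine Finset.sum_le_sum fun t _ => ?_
    -- The restriction to unexplored targets has served to give independence and can be dropped.
    have h1 := ind_le_one (t ∉ deadSet (stateEdge c) ξ r)
    have h2 : 0 ≤ ind (j ≠ t) * (ind (okBefore p good x μ (r + 1) ξ c) *
        ind (j ∈ actSet (stateEdge c) ξ r)) * (ρ (j, t)).real {b | b.2 = true} :=
      mul_nonneg (mul_nonneg (ind_nonneg _) (mul_nonneg (ind_nonneg _) (ind_nonneg _)))
        measureReal_nonneg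
    dsimp only [id]
    linarith [mul_le_mul_of_nonneg_left h1 h2]

lemma expect_inMismatches_le (r : ℕ) :
    expect ρ (fun ξ c => ind (okBefore p good x μ (r + 1) ξ c) * inMismatches r ξ c) ≤
      expect ρ (fun ξ c => ind (okBefore p good x μ (r + 1) ξ c) *
        actSum (fun t => ∑ j, ind (j ≠ t) * (ρ (j, t)).real {b | b.2 = true}) r ξ c) := by
  have h := expect_sum_ind_le (ρ := ρ) (ι := Fin n × Fin n) (r := r)
    (v := fun e => ind (e.1 ≠ e.2)) (e := id)
    (A := fun e ξ c => ind (okBefore p good x μ (r + 1) ξ c) *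
      ind (e.2 ∈ actSet (stateEdge c) ξ r))
    (fun e => ind_nonneg _)
    (fun e => (ofHistory_okBefore le_rfl).mul (ofHistory_mem_actSet le_rfl _))
    (fun e ξ c => mul_nonneg (ind_nonneg _) (ind_nonneg _))
    (fun e ξ c h => notMem_deadSet_of_mem_actSet (ind_ne_zero.1 (right_ne_zero_of_mul h)))
    (fun b => b.2 = true) (fun e => le_rfl)
  refine le_trans (le_of_eq ?_) (h.trans (le_of_eq ?_))
  · congr 1
    ext ξ c
    rw [inMismatches, Finset.mul_sum]
    refine Finset.sum_congr rfl fun e _ => ?_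
    rw [stateMismatch, Prod.mk.eta, id]
    ring
  · congr 1
    ext ξ c
    rw [actSum_eq, Finset.mul_sum, Fintype.sum_prod_type, Finset.sum_comm]
    refine Finset.sum_congr rfl fun t _ => ?_
    rw [Finset.mul_sum, Finset.mul_sum]
    refine Finset.sum_congr rfl fun j _ => ?_
    dsimp only [id]
    ring

/-- One factor is bounded by the barrier `x μ ^ r` and the other averaged. No second moment of the
offspring numbers is needed. -/
lemma expect_okBefore_mul_sq_le (hp : ∀ i, 0 ≤ p i) (hx : 0 ≤ x) (hμ0 : 0 ≤ μ)
    (hq : ∀ j t, (ρ (j, t)).real {b | b.1 = true} ≤ m j * p t / N)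
    (hμ : (∑ j, m j * p j) / N = μ) (r : ℕ) :
    expect ρ (fun ξ c => ind (okBefore p good x μ (r + 1) ξ c) * actSum p r ξ c ^ 2) ≤
      (∑ i, p i) / n * (x * (μ ^ r * ∑ l ∈ Finset.range (r + 1), μ ^ l)) := by
  have hS : μ ^ r ≤ ∑ l ∈ Finset.range (r + 1), μ ^ l :=
    Finset.single_le_sum (f := fun l => μ ^ l) (fun l _ => pow_nonneg hμ0 l)
      (Finset.self_mem_range_succ r)
  have hx' : 0 ≤ x * μ ^ r := mul_nonneg hx (pow_nonneg hμ0 r)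
  have hp0 : 0 ≤ (∑ i, p i) / n := div_nonneg (Finset.sum_nonneg fun i _ => hp i) (by positivity)
  have h1 := expect_okBefore_mul_weight_le (good := good) (x := x) hp hq hμ hμ0 r
  refine le_trans (expect_mono (G := fun ξ c =>
    ind (okBefore p good x μ r ξ c) * actSum p r ξ c * (x * μ ^ r)) fun ξ c => ?_) ?_
  · have hP := actSum_nonneg hp r ξ c
    calc _ = ind (okBefore p good x μ (r + 1) ξ c) * actSum p r ξ c * actSum p r ξ c := by ring
      _ ≤ ind (okBefore p good x μ (r + 1) ξ c) * (x * μ ^ r) * actSum p r ξ c :=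
          mul_le_mul_of_nonneg_right (ind_okBefore_mul_actSum_le ξ c) hP
      _ = ind (okBefore p good x μ (r + 1) ξ c) * (actSum p r ξ c * (x * μ ^ r)) := by ring
      _ ≤ ind (okBefore p good x μ r ξ c) * (actSum p r ξ c * (x * μ ^ r)) :=
          mul_le_mul_of_nonneg_right (ind_okBefore_anti (Nat.le_succ r) ξ c) (mul_nonneg hP hx')
      _ = _ := by ring
  · rw [expect_mul_const]
    calc _ ≤ (∑ i, p i) / n * μ ^ r * (x * μ ^ r) := mul_le_mul_of_nonneg_right h1 hx'
      _ = (∑ i, p i) / n * (x * (μ ^ r * μ ^ r)) := by ring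
      _ ≤ _ := mul_le_mul_of_nonneg_left (mul_le_mul_of_nonneg_left
          (mul_le_mul_of_nonneg_left hS (pow_nonneg hμ0 r)) hx) hp0

/-- Both edges point to an unexplored `t`, so their joint rate factors and the sum over `t` can be
taken out. Control is relaxed from before `r + 1` to before `r`, so that the remaining pairs can in
turn be averaged given the previous levels. -/
lemma expect_commonTargets_le (hm : ∀ i, 0 ≤ m i) (hp : ∀ i, 0 ≤ p i) (hN : 0 < N)
    (hq : ∀ j t, (ρ (j, t)).real {b | b.1 = true} ≤ m j * p t / N) (r : ℕ) :
    expect ρ (fun ξ c => ind (okBefore p good x μ (r + 1) ξ c) * commonTargets r ξ c) ≤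
      expect ρ (fun ξ c => ind (okBefore p good x μ r ξ c) *
      ∑ j, ∑ j', ind (j ≠ j') * (ind (j ∈ actSet (stateEdge c) ξ r) *
        ind (j' ∈ deadSet (stateEdge c) ξ (r + 1)) * (m j * m j'))) *
        ((∑ t, p t * p t) / N ^ 2) := by
  have h := expect_sum_ind_mul_ind_le (ρ := ρ) (ι := Fin n × Fin n × Fin n) (r := r)
    (v := fun i => ind (i.1 ≠ i.2.1)) (e := fun i => (i.1, i.2.2)) (e' := fun i => (i.2.1, i.2.2))
    (β := fun i => m i.1 * p i.2.2 / N) (β' := fun i => m i.2.1 * p i.2.2 / N)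
    (A := fun i ξ c => ind (okBefore p good x μ (r + 1) ξ c) *
      (ind (i.1 ∈ actSet (stateEdge c) ξ r) * ind (i.2.1 ∈ deadSet (stateEdge c) ξ (r + 1)) *
        ind (i.2.2 ∉ deadSet (stateEdge c) ξ r)))
    (fun i => ind_nonneg _) (fun i hi he => ind_ne_zero.1 hi (congrArg Prod.fst he))
    (fun i => (ofHistory_okBefore le_rfl).mul (((ofHistory_mem_actSet le_rfl _).mul
      (ofHistory_mem_deadSet le_rfl _)).mul (ofHistory_notMem_deadSet (Nat.le_succ r) _)))
    (fun i ξ c => mul_nonneg (ind_nonneg _)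
      (mul_nonneg (mul_nonneg (ind_nonneg _) (ind_nonneg _)) (ind_nonneg _)))
    (fun i ξ c h => and_self_iff.2
      (ind_ne_zero.1 (right_ne_zero_of_mul (right_ne_zero_of_mul h))))
    (fun b => b.1 = true) (fun i => hq _ _) (fun i => hq _ _)
  rw [← expect_mul_const]
  refine le_trans (le_of_eq ?_) (h.trans (expect_mono fun ξ c => ?_))
  · congr 1
    ext ξ c
    rw [commonTargets, Finset.mul_sum]
    refine Finset.sum_congr rfl fun e _ => ?_
    rw [stateEdge, stateEdge]
    ring
  · rw [Fintype.sum_prod_type, Finset.mul_sum, Finset.sum_mul]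
    refine Finset.sum_le_sum fun j _ => ?_
    rw [Fintype.sum_prod_type, Finset.mul_sum, Finset.sum_mul]
    refine Finset.sum_le_sum fun j' _ => ?_
    rw [Finset.sum_div, Finset.mul_sum]
    refine Finset.sum_le_sum fun t _ => ?_
    have h1 := mul_le_mul (ind_okBefore_anti (p := p) (good := good) (x := x) (μ := μ)
      (Nat.le_succ r) ξ c) (ind_le_one (t ∉ deadSet (stateEdge c) ξ r)) (ind_nonneg _)
      (ind_nonneg _)
    have h2 : 0 ≤ ind (j ≠ j') * (ind (j ∈ actSet (stateEdge c) ξ r) *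
        ind (j' ∈ deadSet (stateEdge c) ξ (r + 1))) *
        (m j * p t / N * (m j' * p t / N)) :=
      mul_nonneg (mul_nonneg (ind_nonneg _) (mul_nonneg (ind_nonneg _) (ind_nonneg _)))
        (mul_nonneg (div_nonneg (mul_nonneg (hm j) (hp t)) hN.le)
          (div_nonneg (mul_nonneg (hm j') (hp t)) hN.le))
    have h3 := mul_le_mul_of_nonneg_right h1 h2
    refine le_trans (le_of_eq (by ring)) (h3.trans (le_of_eq (by ring)))

/-- The `W⁺` weight of the dead vertices is at most the sum of the barriers; the `W⁻` weight of the
level is averaged. The self-loop terms are kept and later charged to the mismatches. -/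
lemma expect_starRate_le (hm : ∀ i, 0 ≤ m i) (hN : 0 < N) (hx : 0 ≤ x) (hμ0 : 0 ≤ μ) {B : ℝ}
    (hB : ∀ l, expect ρ (fun ξ c => ind (okBefore p good x μ l ξ c) * actSum m l ξ c) ≤ B * μ ^ l)
    (r : ℕ) :
    expect ρ (fun ξ c => ind (okBefore p good x μ (r + 1) ξ c) * starRate m p N r ξ c) ≤
      B / N * (x * (μ ^ r * ∑ l ∈ Finset.range (r + 1), μ ^ l)) +
      expect ρ (fun ξ c => ind (okBefore p good x μ (r + 1) ξ c) *
        actSum (fun j => m j * p j / N) r ξ c) := by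
  have hS : ∑ l ∈ Finset.range r, μ ^ l ≤ ∑ l ∈ Finset.range (r + 1), μ ^ l :=
    Finset.sum_le_sum_of_subset_of_nonneg (Finset.range_subset_range.2 (Nat.le_succ r))
      fun l _ _ => pow_nonneg hμ0 l
  have hxS : 0 ≤ x * ∑ l ∈ Finset.range (r + 1), μ ^ l / N :=
    mul_nonneg hx (Finset.sum_nonneg fun l _ => div_nonneg (pow_nonneg hμ0 l) hN.le)
  have hsplit : ∀ ξ c, ind (okBefore p good x μ (r + 1) ξ c) * starRate m p N r ξ c ≤
      ind (okBefore p good x μ r ξ c) * actSum m r ξ c *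
        (x * ∑ l ∈ Finset.range (r + 1), μ ^ l / N) +
      ind (okBefore p good x μ (r + 1) ξ c) * actSum (fun j => m j * p j / N) r ξ c := by
    intro ξ c
    have hM := actSum_nonneg hm r ξ c
    have e1 : starRate m p N r ξ c = actSum m r ξ c * (deadSum p r ξ c / N) +
        actSum (fun j => m j * p j / N) r ξ c := by
      rw [starRate, Finset.sum_add_distrib, actSum, actSum, deadSum, Finset.sum_div,
        Finset.sum_mul_sum]
      simp only [mul_div_assoc]
    rw [e1, mul_add]
    refine add_le_add ?_ le_rfl
    by_cases h : okBefore p good x μ (r + 1) ξ c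
    · have h' := h.mono (Nat.le_succ r)
      have hd := ind_okBefore_mul_deadSum_le (p := p) (good := good) (x := x) (μ := μ) (r := r) ξ c
      rw [ind_of h', one_mul, one_mul] at hd
      rw [ind_of h, ind_of h', one_mul, one_mul, ← Finset.sum_div, ← mul_div_assoc x]
      exact mul_le_mul_of_nonneg_left (div_le_div_of_nonneg_right
        (hd.trans (mul_le_mul_of_nonneg_left hS hx)) hN.le) hM
    · rw [ind_of_not h, zero_mul]
      exact mul_nonneg (mul_nonneg (ind_nonneg _) hM) hxS
  refine (expect_mono hsplit).trans ?_
  rw [expect_add, expect_mul_const]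
  refine add_le_add ?_ le_rfl
  calc _ ≤ _ := mul_le_mul_of_nonneg_right (hB r) hxS
    _ = _ := by rw [← Finset.sum_div]; ring

variable (hm : ∀ i, 0 ≤ m i) (hp : ∀ i, 0 ≤ p i) (hN : 0 < N) (hx : 0 ≤ x) (hμ0 : 0 ≤ μ)
  (hq : ∀ j t, (ρ (j, t)).real {b | b.1 = true} ≤ m j * p t / N)

include hm hN hx hμ0 hq

/-- Edges into the current level are fresh. The weight of their targets is bounded by the barrier,
that of their explored sources is averaged. -/
lemma expect_returnEdges_le {B : ℝ}
    (hB : ∀ l, expect ρ (fun ξ c => ind (okBefore p good x μ l ξ c) * actSum m l ξ c) ≤ B * μ ^ l)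
    (r : ℕ) :
    expect ρ (fun ξ c => ind (okBefore p good x μ (r + 1) ξ c) * returnEdges r ξ c) ≤
      B / N * (x * (μ ^ r * ∑ l ∈ Finset.range (r + 1), μ ^ l)) := by
  have h := expect_sum_ind_le (ρ := ρ) (ι := Fin n × Fin n) (r := r)
    (v := fun e => 1) (e := id) (β := fun e => m e.1 * p e.2 / N)
    (A := fun e ξ c => ind (okBefore p good x μ (r + 1) ξ c) *
      (ind (e.2 ∈ actSet (stateEdge c) ξ r) * ind (e.1 ∈ deadSet (stateEdge c) ξ (r + 1))))
    (fun e => zero_le_one)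
    (fun e => (ofHistory_okBefore le_rfl).mul ((ofHistory_mem_actSet le_rfl _).mul
      (ofHistory_mem_deadSet le_rfl _)))
    (fun e ξ c => mul_nonneg (ind_nonneg _) (mul_nonneg (ind_nonneg _) (ind_nonneg _)))
    (fun e ξ c h => notMem_deadSet_of_mem_actSet
      (ind_ne_zero.1 (left_ne_zero_of_mul (right_ne_zero_of_mul h))))
    (fun b => b.1 = true) (fun e => hq e.1 e.2)
  have h2 := expect_okBefore_mul_deadSum_le hm hB (r := r + 1) (s := r + 1) (Nat.le_succ _)
  refine le_trans (le_of_eq ?_) (h.trans (le_trans (expect_mono (G := fun ξ c =>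
    ind (okBefore p good x μ (r + 1) ξ c) * deadSum m (r + 1) ξ c * (x * μ ^ r / N))
    fun ξ c => ?_) ?_))
  · congr 1
    ext ξ c
    rw [returnEdges, Finset.mul_sum]
    refine Finset.sum_congr rfl fun e _ => ?_
    rw [stateEdge, Prod.mk.eta, id]
    ring
  · have h3 := mul_le_mul_of_nonneg_right (ind_okBefore_mul_actSum_le (p := p) (good := good)
      (x := x) (μ := μ) (r := r) ξ c) (div_nonneg (deadSum_nonneg hm (r + 1) ξ c) hN.le)
    refine le_trans (le_of_eq ?_) (h3.trans (le_of_eq (by ring)))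
    rw [actSum_eq, deadSum_eq, Fintype.sum_prod_type, mul_assoc, ← mul_div_assoc,
      Finset.sum_mul_sum, Finset.sum_comm, Finset.sum_div, Finset.mul_sum]
    refine Finset.sum_congr rfl fun t _ => ?_
    rw [Finset.sum_div, Finset.mul_sum]
    refine Finset.sum_congr rfl fun j _ => ?_
    ring
  · rw [expect_mul_const]
    calc _ ≤ _ := mul_le_mul_of_nonneg_right h2
          (div_nonneg (mul_nonneg hx (pow_nonneg hμ0 r)) hN.le)
      _ = _ := by ring

include hp

/-- Two edges from `j` into the level lie in different unread columns; summing out `j` leaves the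
squared weight of the level. -/
lemma expect_commonSources_le (hμ : (∑ j, m j * p j) / N = μ) (r : ℕ) :
    expect ρ (fun ξ c => ind (okBefore p good x μ (r + 1) ξ c) * commonSources r ξ c) ≤
      (∑ i, p i) / n * ((∑ j, m j * m j) / N / N) *
        (x * (μ ^ r * ∑ l ∈ Finset.range (r + 1), μ ^ l)) := by
  have h := expect_sum_ind_mul_ind_le (ρ := ρ) (ι := Fin n × Fin n × Fin n) (r := r)
    (v := fun i => ind (i.1 ≠ i.2.1)) (e := fun i => (i.2.2, i.1)) (e' := fun i => (i.2.2, i.2.1))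
    (β := fun i => m i.2.2 * p i.1 / N) (β' := fun i => m i.2.2 * p i.2.1 / N)
    (A := fun i ξ c => ind (okBefore p good x μ (r + 1) ξ c) *
      (ind (i.1 ∈ actSet (stateEdge c) ξ r) * ind (i.2.1 ∈ actSet (stateEdge c) ξ r)))
    (fun i => ind_nonneg _) (fun i hi he => ind_ne_zero.1 hi (congrArg Prod.snd he))
    (fun i => (ofHistory_okBefore le_rfl).mul ((ofHistory_mem_actSet le_rfl _).mul
      (ofHistory_mem_actSet le_rfl _)))
    (fun i ξ c => mul_nonneg (ind_nonneg _) (mul_nonneg (ind_nonneg _) (ind_nonneg _)))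
    (fun i ξ c h => ⟨notMem_deadSet_of_mem_actSet
      (ind_ne_zero.1 (left_ne_zero_of_mul (right_ne_zero_of_mul h))),
      notMem_deadSet_of_mem_actSet
      (ind_ne_zero.1 (right_ne_zero_of_mul (right_ne_zero_of_mul h)))⟩)
    (fun b => b.1 = true) (fun i => hq _ _) (fun i => hq _ _)
  have h2 := expect_okBefore_mul_sq_le (good := good) hp hx hμ0 hq hμ r
  have ha : 0 ≤ (∑ j, m j * m j) / N / N := div_nonneg (div_nonneg
    (Finset.sum_nonneg fun i _ => mul_nonneg (hm i) (hm i)) hN.le) hN.le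
  refine le_trans (le_of_eq ?_) (h.trans (le_trans (expect_mono (G := fun ξ c =>
    ind (okBefore p good x μ (r + 1) ξ c) * actSum p r ξ c ^ 2 * ((∑ j, m j * m j) / N / N))
    fun ξ c => ?_) ?_))
  · congr 1
    ext ξ c
    rw [commonSources, Finset.mul_sum]
    refine Finset.sum_congr rfl fun e _ => ?_
    rw [stateEdge, stateEdge]
    ring
  · rw [actSum_eq, sq, Finset.sum_mul_sum, Fintype.sum_prod_type, Finset.mul_sum, Finset.sum_mul]
    refine Finset.sum_le_sum fun t _ => ?_
    rw [Fintype.sum_prod_type, Finset.mul_sum, Finset.sum_mul]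
    refine Finset.sum_le_sum fun t' _ => ?_
    rw [Finset.sum_div, Finset.sum_div, Finset.mul_sum]
    refine Finset.sum_le_sum fun j _ => ?_
    have h1 := ind_le_one (t ≠ t')
    have h2 : 0 ≤ (ind (okBefore p good x μ (r + 1) ξ c) *
        (ind (t ∈ actSet (stateEdge c) ξ r) * ind (t' ∈ actSet (stateEdge c) ξ r))) *
        (m j * p t / N * (m j * p t' / N)) :=
      mul_nonneg (mul_nonneg (ind_nonneg _) (mul_nonneg (ind_nonneg _) (ind_nonneg _)))
        (mul_nonneg (div_nonneg (mul_nonneg (hm j) (hp t)) hN.le)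
          (div_nonneg (mul_nonneg (hm j) (hp t')) hN.le))
    refine (mul_le_mul_of_nonneg_right h1 h2).trans (le_of_eq (by ring))
  · rw [expect_mul_const]
    calc _ ≤ _ := mul_le_mul_of_nonneg_right h2 ha
      _ = _ := by ring

/-- The second vertex lies in an earlier level or in the same one. In the first case its weight is
part of the history and only the new vertex is averaged; in the second both are offspring of level
`s` through different edges, and the squared weight of level `s` appears. -/
lemma expect_okBefore_mul_pairs_le {B : ℝ} (hμ : (∑ j, m j * p j) / N = μ)
    (hB : ∀ l, expect ρ (fun ξ c => ind (okBefore p good x μ l ξ c) * actSum m l ξ c) ≤ B * μ ^ l)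
    (s : ℕ) :
    expect ρ (fun ξ c => ind (okBefore p good x μ (s + 1) ξ c) *
      ∑ j, ∑ j', ind (j ≠ j') * (ind (j ∈ actSet (stateEdge c) ξ (s + 1)) *
        ind (j' ∈ deadSet (stateEdge c) ξ (s + 2)) * (m j * m j'))) ≤
      ((∑ j, m j * m j) / N * B + ((∑ j, m j * m j) / N) ^ 2 * ((∑ i, p i) / n)) *
        (x * (μ ^ s * ∑ l ∈ Finset.range (s + 1), μ ^ l)) := by
  have ha : 0 ≤ (∑ j, m j * m j) / N := div_nonneg
    (Finset.sum_nonneg fun i _ => mul_nonneg (hm i) (hm i)) hN.le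
  have hsplit : ∀ ξ c, ind (okBefore p good x μ (s + 1) ξ c) *
      ∑ j, ∑ j', ind (j ≠ j') * (ind (j ∈ actSet (stateEdge c) ξ (s + 1)) *
        ind (j' ∈ deadSet (stateEdge c) ξ (s + 2)) * (m j * m j')) ≤
      ind (okBefore p good x μ (s + 1) ξ c) * deadSum m (s + 1) ξ c * actSum m (s + 1) ξ c +
      ind (okBefore p good x μ (s + 1) ξ c) * ∑ j, ∑ j', ind (j ≠ j') *
        (ind (j ∈ actSet (stateEdge c) ξ (s + 1)) * ind (j' ∈ actSet (stateEdge c) ξ (s + 1)) *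
          (m j * m j')) := by
    intro ξ c
    rw [mul_assoc, ← mul_add]
    refine mul_le_mul_of_nonneg_left ?_ (ind_nonneg _)
    rw [mul_comm (deadSum m (s + 1) ξ c), actSum_eq, deadSum_eq, Finset.sum_mul_sum,
      ← Finset.sum_add_distrib]
    refine Finset.sum_le_sum fun j _ => ?_
    rw [← Finset.sum_add_distrib]
    refine Finset.sum_le_sum fun j' _ => ?_
    have h1 : ind (j' ∈ deadSet (stateEdge c) ξ (s + 2)) ≤
        ind (j' ∈ deadSet (stateEdge c) ξ (s + 1)) + ind (j' ∈ actSet (stateEdge c) ξ (s + 1)) := by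
      by_cases h : j' ∈ deadSet (stateEdge c) ξ (s + 2)
      · rw [ind_of h]
        rcases mem_deadSet_succ.1 h with h | h
        · rw [ind_of h]; linarith [ind_nonneg (j' ∈ actSet (stateEdge c) ξ (s + 1))]
        · rw [ind_of h]; linarith [ind_nonneg (j' ∈ deadSet (stateEdge c) ξ (s + 1))]
      · rw [ind_of_not h]
        exact add_nonneg (ind_nonneg _) (ind_nonneg _)
    have h0 : 0 ≤ ind (j ∈ actSet (stateEdge c) ξ (s + 1)) * (m j * m j') :=
      mul_nonneg (ind_nonneg _) (mul_nonneg (hm j) (hm j'))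
    have h2 := mul_le_mul_of_nonneg_left h1 (mul_nonneg (ind_nonneg (j ≠ j')) h0)
    have h3 := mul_le_mul_of_nonneg_right (ind_le_one (j ≠ j'))
      (mul_nonneg h0 (ind_nonneg (j' ∈ deadSet (stateEdge c) ξ (s + 1))))
    calc _ = ind (j ≠ j') * (ind (j ∈ actSet (stateEdge c) ξ (s + 1)) * (m j * m j')) *
          ind (j' ∈ deadSet (stateEdge c) ξ (s + 2)) := by ring
      _ ≤ _ := h2
      _ = ind (j ≠ j') * (ind (j ∈ actSet (stateEdge c) ξ (s + 1)) * (m j * m j') *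
          ind (j' ∈ deadSet (stateEdge c) ξ (s + 1))) + ind (j ≠ j') *
          (ind (j ∈ actSet (stateEdge c) ξ (s + 1)) * ind (j' ∈ actSet (stateEdge c) ξ (s + 1)) *
          (m j * m j')) := by ring
      _ ≤ _ := add_le_add (h3.trans (le_of_eq (by ring))) le_rfl
  refine (expect_mono hsplit).trans ?_
  rw [expect_add, add_mul]
  have hx' : 0 ≤ x * μ ^ s := mul_nonneg hx (pow_nonneg hμ0 s)
  refine add_le_add ?_ ?_
  · refine (expect_mul_actSum_succ_le hm hq (Y := fun ξ c =>
      ind (okBefore p good x μ (s + 1) ξ c) * deadSum m (s + 1) ξ c)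
      ((ofHistory_okBefore le_rfl).mul (ofHistory_deadSum le_rfl m))
      fun ξ c => mul_nonneg (ind_nonneg _) (deadSum_nonneg hm _ ξ c)).trans ?_
    have h1 : expect ρ (fun ξ c => ind (okBefore p good x μ (s + 1) ξ c) * deadSum m (s + 1) ξ c *
        actSum p s ξ c) ≤ B * (∑ l ∈ Finset.range (s + 1), μ ^ l) * (x * μ ^ s) := by
      refine (expect_mono (G := fun ξ c => ind (okBefore p good x μ (s + 1) ξ c) *
        deadSum m (s + 1) ξ c * (x * μ ^ s)) fun ξ c => ?_).trans ?_
      · have := mul_le_mul_of_nonneg_right (ind_okBefore_mul_actSum_le (p := p) (good := good)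
          (x := x) (μ := μ) (r := s) ξ c) (deadSum_nonneg hm (s + 1) ξ c)
        linarith
      · rw [expect_mul_const]
        exact mul_le_mul_of_nonneg_right
          (expect_okBefore_mul_deadSum_le hm hB (Nat.le_succ _)) hx'
    calc _ ≤ _ := mul_le_mul_of_nonneg_right h1 ha
      _ = _ := by ring
  · refine (expect_mul_pairSum_succ_le hm hq (ofHistory_okBefore le_rfl)
      fun ξ c => ind_nonneg _).trans ?_
    calc _ ≤ _ := mul_le_mul_of_nonneg_right
          (expect_okBefore_mul_sq_le (good := good) hp hx hμ0 hq hμ s) (sq_nonneg _)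
      _ = _ := by ring

end Defects

/-! ### Summation of the defect estimates over the levels. -/

section DefectBound

variable {n : ℕ} {ρ : Fin n × Fin n → Measure (Bool × Bool)}
  {m p : Fin n → ℝ} {N x μ : ℝ} {good : Fin n → Prop}

/-- Control before `r + 1` includes that level `r` is good, so bounds valid only at good vertices
apply there. Afterwards the control is weakened to the history before level `r`. -/
lemma ind_okBefore_mul_actSum_good_le {f h : Fin n → ℝ} (hfh : ∀ j, good j → f j ≤ h j)
    (hh0 : ∀ j, 0 ≤ h j) (r : ℕ) (ξ : Fin n) (c : EdgeStates n) :
    ind (okBefore p good x μ (r + 1) ξ c) * actSum f r ξ c ≤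
      ind (okBefore p good x μ r ξ c) * actSum h r ξ c := by
  by_cases h1 : okBefore p good x μ (r + 1) ξ c
  · rw [ind_of h1, ind_of (h1.mono (Nat.le_succ r)), one_mul, one_mul]
    exact Finset.sum_le_sum fun j hj => hfh j ((okBefore_succ.1 h1).2.2 j hj)
  · rw [ind_of_not h1, zero_mul]
    exact mul_nonneg (ind_nonneg _) (actSum_nonneg hh0 r ξ c)

variable [∀ e, IsProbabilityMeasure (ρ e)]

/-- The three defects whose rates are attached to a single vertex are collected into one function
`h`; what remains of the starred parts is a collision term. -/
lemma expect_mismatches_le {h : Fin n → ℝ} (hm : ∀ i, 0 ≤ m i) (hN : 0 < N) (hx : 0 ≤ x)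
    (hμ0 : 0 ≤ μ) (hh0 : ∀ j, 0 ≤ h j)
    (hh : ∀ j, good j → ∑ t, ind (j ≠ t) * (ρ (j, t)).real {b | b.2 = true} +
      ∑ i, ind (i ≠ j) * (ρ (i, j)).real {b | b.2 = true} + m j * p j / N ≤ h j) {B : ℝ}
    (hB : ∀ l, expect ρ (fun ξ c => ind (okBefore p good x μ l ξ c) * actSum m l ξ c) ≤ B * μ ^ l)
    (r : ℕ) :
    expect ρ (fun ξ c => ind (okBefore p good x μ (r + 1) ξ c) *
      (outMismatches r ξ c + inMismatches r ξ c + starRate m p N r ξ c)) ≤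
      expect ρ (fun ξ c => ind (okBefore p good x μ r ξ c) * actSum h r ξ c) +
      B / N * (x * (μ ^ r * ∑ l ∈ Finset.range (r + 1), μ ^ l)) := by
  have h1 := expect_outMismatches_le (ρ := ρ) (p := p) (good := good) (x := x) (μ := μ) r
  have h2 := expect_inMismatches_le (ρ := ρ) (p := p) (good := good) (x := x) (μ := μ) r
  have h3 := expect_starRate_le (ρ := ρ) (p := p) (good := good) hm hN hx hμ0 hB r
  simp only [mul_add]
  rw [expect_add, expect_add]
  have h4 : ∀ ξ c, ind (okBefore p good x μ (r + 1) ξ c) *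
        actSum (fun j => ∑ t, ind (j ≠ t) * (ρ (j, t)).real {b | b.2 = true}) r ξ c +
      ind (okBefore p good x μ (r + 1) ξ c) *
        actSum (fun t => ∑ j, ind (j ≠ t) * (ρ (j, t)).real {b | b.2 = true}) r ξ c +
      ind (okBefore p good x μ (r + 1) ξ c) * actSum (fun j => m j * p j / N) r ξ c ≤
      ind (okBefore p good x μ r ξ c) * actSum h r ξ c := by
    intro ξ c
    refine le_trans (le_of_eq ?_) (ind_okBefore_mul_actSum_good_le hh hh0 r ξ c)
    simp only [actSum, Finset.sum_add_distrib]
    ring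
  have h5 := expect_mono (ρ := ρ) h4
  rw [expect_add, expect_add] at h5
  linarith

/-- The probability that there is a defect up to distance `k`. -/
theorem expect_defects_le {h : Fin n → ℝ} {B Bh Bb : ℝ} (hm : ∀ i, 0 ≤ m i) (hp : ∀ i, 0 ≤ p i)
    (hN : 0 < N) (hx : 0 < x) (hμ : (∑ j, m j * p j) / N = μ) (hμ0 : 0 < μ)
    (hq : ∀ j t, (ρ (j, t)).real {b | b.1 = true} ≤ m j * p t / N) (hh0 : ∀ j, 0 ≤ h j)
    (hh : ∀ j, good j → ∑ t, ind (j ≠ t) * (ρ (j, t)).real {b | b.2 = true} +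
      ∑ i, ind (i ≠ j) * (ρ (i, j)).real {b | b.2 = true} + m j * p j / N ≤ h j)
    (hB : (∑ i, m i) / n ≤ B) (hBμ : (∑ i, p i) / n * ((∑ j, m j * m j) / N) ≤ B * μ)
    (hBh : (∑ i, h i) / n ≤ Bh) (hBhμ : (∑ i, p i) / n * ((∑ j, m j * h j) / N) ≤ Bh * μ)
    (hBb : (∑ i, ind (¬ good i)) / n ≤ Bb)
    (hBbμ : (∑ i, p i) / n * ((∑ j, m j * ind (¬ good j)) / N) ≤ Bb * μ) (k : ℕ) :
    expect ρ (fun ξ c => ind (¬ okBefore p good x μ (k + 1) ξ c) +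
      ∑ r ∈ Finset.range (k + 1), ind (okBefore p good x μ (r + 1) ξ c) *
        defectCount m p N r ξ c) ≤
      (∑ i, p i) / n / x + (Bb + Bh) * ∑ r ∈ Finset.range (k + 1), μ ^ r +
      (2 * (B / N) + (∑ i, p i) / n * ((∑ j, m j * m j) / N / N) +
        ((∑ j, m j * m j) / N * B + ((∑ j, m j * m j) / N) ^ 2 * ((∑ i, p i) / n)) *
          ((∑ t, p t * p t) / N ^ 2)) *
        (x * ∑ r ∈ Finset.range (k + 1), μ ^ r * ∑ l ∈ Finset.range (r + 1), μ ^ l) := by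
  have hsum0 : ∀ {f : Fin n → ℝ}, (∀ i, 0 ≤ f i) → 0 ≤ (∑ j, m j * f j) / N := fun hf =>
    div_nonneg (Finset.sum_nonneg fun i _ => mul_nonneg (hm i) (hf i)) hN.le
  have hEm : ∀ l, expect ρ (fun ξ c => ind (okBefore p good x μ l ξ c) * actSum m l ξ c) ≤
      B * μ ^ l := expect_okBefore_mul_actSum_le hm hp hq hμ hμ0.le hB (hsum0 hm) hBμ
  have hEh : ∀ l, expect ρ (fun ξ c => ind (okBefore p good x μ l ξ c) * actSum h l ξ c) ≤
      Bh * μ ^ l := expect_okBefore_mul_actSum_le hh0 hp hq hμ hμ0.le hBh (hsum0 hh0) hBhμ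
  have hEb : ∀ l, expect ρ (fun ξ c => ind (okBefore p good x μ l ξ c) *
      actSum (fun i => ind (¬ good i)) l ξ c) ≤ Bb * μ ^ l :=
    expect_okBefore_mul_actSum_le (fun i => ind_nonneg _) hp hq hμ hμ0.le hBb
      (hsum0 fun i => ind_nonneg _) hBbμ
  have hnot : expect ρ (fun ξ c => ind (¬ okBefore p good x μ (k + 1) ξ c)) ≤
      Bb * ∑ r ∈ Finset.range (k + 1), μ ^ r + (∑ i, p i) / n / x := by
    refine (expect_mono fun ξ c => ind_not_okBefore_le (k + 1) ξ c).trans ?_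
    rw [expect_sum]
    simp only [expect_add]
    rw [Finset.sum_add_distrib]
    refine add_le_add ?_ ?_
    · rw [Finset.mul_sum]
      exact Finset.sum_le_sum fun r _ => hEb r
    · rw [le_div_iff₀ hx, mul_comm]
      have := expect_weight_exceeds_le (good := good) (x := x) hp hq hμ hμ0 (k + 1)
      refine le_trans (le_add_of_nonneg_right ?_) this
      exact div_nonneg (expect_nonneg fun ξ c => mul_nonneg (ind_nonneg _)
        (actSum_nonneg hp _ ξ c)) (pow_nonneg hμ0.le _)
  set a := (∑ j, m j * m j) / N with ha
  set P := (∑ i, p i) / n with hP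
  set V := (∑ t, p t * p t) / N ^ 2 with hV
  set D : ℕ → ℝ := fun r => x * (μ ^ r * ∑ l ∈ Finset.range (r + 1), μ ^ l) with hD
  have hD0 : ∀ r, 0 ≤ D r := fun r => mul_nonneg hx.le (mul_nonneg (pow_nonneg hμ0.le r)
    (Finset.sum_nonneg fun l _ => pow_nonneg hμ0.le l))
  have ha0 : 0 ≤ a := hsum0 hm
  have hP0 : 0 ≤ P := div_nonneg (Finset.sum_nonneg fun i _ => hp i) (by positivity)
  have hV0 : 0 ≤ V := div_nonneg (Finset.sum_nonneg fun i _ => mul_nonneg (hp i) (hp i))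
    (by positivity)
  have hB0 : 0 ≤ B := le_trans (div_nonneg (Finset.sum_nonneg fun i _ => hm i) (by positivity)) hB
  -- Common targets at level `s + 1` are estimated through level `s`, so the index shifts by one.
  -- Level 0 contributes nothing, because the root is the only explored vertex.
  have hCT : ∑ r ∈ Finset.range (k + 1), expect ρ (fun ξ c =>
      ind (okBefore p good x μ (r + 1) ξ c) * commonTargets r ξ c) ≤
      (a * B + a ^ 2 * P) * V * ∑ r ∈ Finset.range (k + 1), D r := by
    rw [Finset.sum_range_succ']
    have h0 : expect ρ (fun ξ c => ind (okBefore p good x μ (0 + 1) ξ c) *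
        commonTargets 0 ξ c) = 0 := by
      have : ∀ ξ c, ind (okBefore p good x μ (0 + 1) ξ c) * commonTargets 0 ξ c = 0 := by
        intro ξ c
        rw [commonTargets, Finset.sum_eq_zero, mul_zero]
        rintro ⟨j, j', t⟩ -
        dsimp only
        by_cases hj : j = j'
        · rw [ind_of_not (not_not.2 hj), zero_mul]
        · by_cases hj1 : j ∈ actSet (stateEdge c) ξ 0
          · rw [ind_of_not (p := j' ∈ deadSet (stateEdge c) ξ (0 + 1))]
            · ring
            · intro hj2
              rw [mem_deadSet_succ] at hj2
              simp only [actSet_zero, deadSet_zero, Finset.notMem_empty, false_or,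
                Finset.mem_singleton] at hj1 hj2
              exact hj (hj1.trans hj2.symm)
          · rw [ind_of_not hj1]; ring
      simp only [this]
      simp [expect]
    rw [h0, add_zero, Finset.sum_range_succ, mul_add, Finset.mul_sum]
    refine le_trans ?_ (le_add_of_nonneg_right (mul_nonneg (mul_nonneg
      (add_nonneg (mul_nonneg ha0 hB0) (mul_nonneg (sq_nonneg _) hP0)) hV0) (hD0 k)))
    refine Finset.sum_le_sum fun s _ => ?_
    refine (expect_commonTargets_le hm hp hN hq (s + 1)).trans ?_
    calc _ ≤ _ := mul_le_mul_of_nonneg_right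
          (expect_okBefore_mul_pairs_le (good := good) hm hp hN hx.le hμ0.le hq hμ hEm s) hV0
      _ = _ := by ring
  have hrest : ∀ r, expect ρ (fun ξ c => ind (okBefore p good x μ (r + 1) ξ c) *
      (outMismatches r ξ c + inMismatches r ξ c + starRate m p N r ξ c)) +
      expect ρ (fun ξ c => ind (okBefore p good x μ (r + 1) ξ c) * returnEdges r ξ c) +
      expect ρ (fun ξ c => ind (okBefore p good x μ (r + 1) ξ c) * commonSources r ξ c) ≤
      Bh * μ ^ r + (2 * (B / N) + P * (a / N)) * D r := by
    intro r
    have h1 := expect_mismatches_le (good := good) (x := x) hm hN hx.le hμ0.le hh0 hh hEm r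
    have h2 := expect_returnEdges_le (good := good) hm hN hx.le hμ0.le hq hEm r
    have h3 := expect_commonSources_le (good := good) hm hp hN hx.le hμ0.le hq hμ r
    have h4 := hEh r
    simp only [hD]
    linarith
  have hsplit : expect ρ (fun ξ c => ind (¬ okBefore p good x μ (k + 1) ξ c) +
      ∑ r ∈ Finset.range (k + 1), ind (okBefore p good x μ (r + 1) ξ c) *
        defectCount m p N r ξ c) =
      expect ρ (fun ξ c => ind (¬ okBefore p good x μ (k + 1) ξ c)) +
      ∑ r ∈ Finset.range (k + 1), (expect ρ (fun ξ c => ind (okBefore p good x μ (r + 1) ξ c) *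
      (outMismatches r ξ c + inMismatches r ξ c + starRate m p N r ξ c)) +
      expect ρ (fun ξ c => ind (okBefore p good x μ (r + 1) ξ c) * returnEdges r ξ c) +
      expect ρ (fun ξ c => ind (okBefore p good x μ (r + 1) ξ c) * commonSources r ξ c)) +
      ∑ r ∈ Finset.range (k + 1), expect ρ (fun ξ c =>
        ind (okBefore p good x μ (r + 1) ξ c) * commonTargets r ξ c) := by
    rw [expect_add, expect_sum, add_assoc, ← Finset.sum_add_distrib]
    congr 1
    refine Finset.sum_congr rfl fun r _ => ?_
    rw [← expect_add, ← expect_add, ← expect_add]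
    congr 1
    ext ξ c
    rw [defectCount]
    ring
  rw [hsplit]
  have h5 := Finset.sum_le_sum fun r (_ : r ∈ Finset.range (k + 1)) => hrest r
  have h6 : ∑ r ∈ Finset.range (k + 1), (Bh * μ ^ r + (2 * (B / N) + P * (a / N)) * D r) =
      Bh * ∑ r ∈ Finset.range (k + 1), μ ^ r +
        (2 * (B / N) + P * (a / N)) * ∑ r ∈ Finset.range (k + 1), D r := by
    rw [Finset.sum_add_distrib, ← Finset.mul_sum, ← Finset.mul_sum]
  rw [h6] at h5
  have h7 : ∑ r ∈ Finset.range (k + 1), D r = x * ∑ r ∈ Finset.range (k + 1),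
      μ ^ r * ∑ l ∈ Finset.range (r + 1), μ ^ l := by
    simp only [hD, ← Finset.mul_sum]
  rw [← h7]
  calc _ ≤ _ := add_le_add (add_le_add hnot h5) hCT
    _ = _ := by ring

end DefectBound

/-! ### Poisson quantiles -/

section Quantile

lemma poissonQuantile_of_le {q u : ℝ} (h : u ≤ Real.exp (-q)) : poissonQuantile q u = 0 :=
  Nat.sInf_eq_zero.2 (Or.inl (by simpa using h))

lemma exists_le_poisson_sum {q u : ℝ} (hq : 0 ≤ q) (hu : u < 1) :
    ∃ m : ℕ, u ≤ ∑ t ∈ Finset.range (m + 1), Real.exp (-q) * q ^ t / (t.factorial : ℝ) := by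
  have h := (hasSum_one_poissonMeasure ⟨q, hq⟩).tendsto_sum_nat
  have h2 := (tendsto_add_atTop_iff_nat 1).2 h
  obtain ⟨m, hm⟩ := (h2.eventually (lt_mem_nhds hu)).exists
  exact ⟨m, hm.le⟩

lemma le_of_poissonQuantile_le {q u : ℝ} (hq : 0 ≤ q) (hu : u < 1) {m : ℕ}
    (h : poissonQuantile q u ≤ m) :
    u ≤ ∑ t ∈ Finset.range (m + 1), Real.exp (-q) * q ^ t / (t.factorial : ℝ) := by
  have hne : {m : ℕ | u ≤ ∑ t ∈ Finset.range (m + 1),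
      Real.exp (-q) * q ^ t / (t.factorial : ℝ)}.Nonempty := exists_le_poisson_sum hq hu
  refine (Nat.sInf_mem hne).trans (Finset.sum_le_sum_of_subset_of_nonneg
    (Finset.range_subset_range.2 (Nat.succ_le_succ h)) fun t _ _ => by positivity)

lemma poissonQuantile_le_of_le {q u : ℝ} {m : ℕ}
    (h : u ≤ ∑ t ∈ Finset.range (m + 1), Real.exp (-q) * q ^ t / (t.factorial : ℝ)) :
    poissonQuantile q u ≤ m := Nat.sInf_le h

lemma measurable_poissonQuantile : Measurable fun y : ℝ × ℝ => poissonQuantile y.1 y.2 := by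
  have hF : ∀ m : ℕ, MeasurableSet {y : ℝ × ℝ |
      y.2 ≤ ∑ t ∈ Finset.range (m + 1), Real.exp (-y.1) * y.1 ^ t / (t.factorial : ℝ)} := by
    intro m
    refine measurableSet_le measurable_snd ?_
    fun_prop
  refine measurable_to_countable' fun k => ?_
  -- The second part of the union accounts for the default `sInf ∅ = 0`, when the partial sums never
  -- reach `u`.
  have : (fun y : ℝ × ℝ => poissonQuantile y.1 y.2) ⁻¹' {k} =
      ({y | y.2 ≤ ∑ t ∈ Finset.range (k + 1), Real.exp (-y.1) * y.1 ^ t / (t.factorial : ℝ)} ∩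
        ⋂ m : ℕ, ⋂ _ : m < k, {y | y.2 ≤ ∑ t ∈ Finset.range (m + 1),
          Real.exp (-y.1) * y.1 ^ t / (t.factorial : ℝ)}ᶜ) ∪
      ({y | k = 0} ∩ ⋂ m : ℕ, {y | y.2 ≤ ∑ t ∈ Finset.range (m + 1),
          Real.exp (-y.1) * y.1 ^ t / (t.factorial : ℝ)}ᶜ) := by
    ext y
    simp only [Set.mem_preimage, Set.mem_singleton_iff, Set.mem_union, Set.mem_inter_iff,
      Set.mem_iInter, Set.mem_compl_iff, Set.mem_ofPred_eq]
    constructor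
    · rintro rfl
      by_cases h : ∃ m : ℕ, y.2 ≤ ∑ t ∈ Finset.range (m + 1),
          Real.exp (-y.1) * y.1 ^ t / (t.factorial : ℝ)
      · exact Or.inl ⟨Nat.sInf_mem h, fun m hm hle => Nat.notMem_of_lt_sInf hm hle⟩
      · exact Or.inr ⟨Nat.sInf_eq_zero.2 (Or.inr (Set.eq_empty_of_forall_notMem
          fun m hm => h ⟨m, hm⟩)), fun m hm => h ⟨m, hm⟩⟩
    · rintro (⟨h1, h2⟩ | ⟨rfl, h2⟩)
      · refine le_antisymm (Nat.sInf_le h1) (le_of_not_gt fun hlt => ?_)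
        exact h2 _ hlt (Nat.sInf_mem (s := {m : ℕ | y.2 ≤ ∑ t ∈ Finset.range (m + 1),
          Real.exp (-y.1) * y.1 ^ t / (t.factorial : ℝ)}) ⟨k, h1⟩)
      · exact Nat.sInf_eq_zero.2 (Or.inr (Set.eq_empty_of_forall_notMem h2))
  rw [this]
  exact ((hF k).inter (MeasurableSet.iInter fun m => MeasurableSet.iInter fun _ =>
    (hF m).compl)).union ((MeasurableSet.const _).inter (MeasurableSet.iInter fun m =>
    (hF m).compl))

lemma volume_real_unitInterval_le {A : Set unitInterval} {S : Set ℝ}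
    (h : ∀ u ∈ A, (u : ℝ) ∈ S) (hS : volume S ≠ ∞) :
    (volume : Measure unitInterval).real A ≤ (volume : Measure ℝ).real S := by
  refine ENNReal.toReal_mono hS ?_
  rw [unitInterval.volume_apply]
  exact measure_mono (Set.image_subset_iff.2 h)

lemma volume_real_one_le_poissonQuantile_le {q : ℝ} (hq : 0 ≤ q) :
    (volume : Measure unitInterval).real {u | 1 ≤ poissonQuantile q u} ≤ q := by
  have he : Real.exp (-q) ≤ 1 := Real.exp_le_one_iff.2 (by linarith)
  refine (volume_real_unitInterval_le (S := Set.Ioc (Real.exp (-q)) 1) (fun u hu => ?_) ?_).trans ?_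
  · refine ⟨lt_of_not_ge fun h => ?_, u.2.2⟩
    have : 1 ≤ poissonQuantile q u := hu
    rw [poissonQuantile_of_le h] at this
    omega
  · simp
  · rw [Real.volume_real_Ioc_of_le he]
    linarith [Real.add_one_le_exp (-q)]

/-- The probability that the Poisson quantile differs from a Bernoulli variable driven by the same
uniform variable. -/
lemma volume_real_mismatch_le {q a ε : ℝ} (hq : 0 ≤ q) (hq1 : q ≤ 1 / 4) (ha : |a| ≤ ε)
    (ha1 : ε ≤ 1) :
    (volume : Measure unitInterval).real {u : unitInterval |
      ¬ ((1 - min 1 (q * (1 + a)) < u ∧ poissonQuantile q u = 1) ∨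
        (¬ 1 - min 1 (q * (1 + a)) < u ∧ poissonQuantile q u = 0))} ≤ q * ε + 2 * q ^ 2 := by
  have ha' := abs_le.1 ha
  have hp : min 1 (q * (1 + a)) = q * (1 + a) := min_eq_right (by nlinarith)
  rw [hp]
  set p := q * (1 + a) with hpdef
  have hexp := abs_le.1 (Real.abs_exp_sub_one_sub_id_le (x := -q)
    (by rw [abs_neg, abs_of_nonneg hq]; linarith))
  have hexp0 := Real.add_one_le_exp (-q)
  have hexp1 : Real.exp (-q) ≤ 1 := Real.exp_le_one_iff.2 (by linarith)
  -- From `exp (-q) ≥ 1 - q`: a value of at least 2 has probability at most `q ^ 2`.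
  have hE : 1 - q ^ 2 ≤ Real.exp (-q) * (1 + q) := by nlinarith
  have hE1 : Real.exp (-q) * (1 + q) ≤ 1 := by
    have := Real.add_one_le_exp q
    have h2 : Real.exp (-q) * Real.exp q = 1 := by rw [← Real.exp_add]; simp
    nlinarith [Real.exp_pos (-q)]
  -- A mismatch forces one of three things: `u = 1`, where the quantile may take its default value;
  -- `u` between `exp (-q)` and `1 - p`, the two thresholds for being positive; or a quantile of at
  -- least 2. The second set contributes `q ε + q ^ 2` and the third `q ^ 2`.
  refine (volume_real_unitInterval_le
    (S := ({1} ∪ Set.uIoc (Real.exp (-q)) (1 - p)) ∪ Set.Ioc (Real.exp (-q) * (1 + q)) 1)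
    (fun u hu => ?_) ?_).trans ?_
  · by_cases hu1 : (u : ℝ) = 1
    · exact Or.inl (Or.inl hu1)
    have hlt : (u : ℝ) < 1 := lt_of_le_of_ne u.2.2 hu1
    rw [Set.mem_ofPred_eq, not_or, not_and, not_and] at hu
    by_cases h2 : Real.exp (-q) * (1 + q) < u
    · exact Or.inr ⟨h2, u.2.2⟩
    have hZ1 : poissonQuantile q u ≤ 1 := by
      refine poissonQuantile_le_of_le ?_
      have : (u : ℝ) ≤ Real.exp (-q) * (1 + q) := not_lt.1 h2
      simp [Finset.sum_range_succ]
      linarith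
    refine Or.inl (Or.inr ?_)
    rw [Set.mem_uIoc]
    by_cases hX : 1 - p < u
    · have hZ0 : poissonQuantile q u ≤ 0 := by
        have := hu.1 hX
        omega
      have := le_of_poissonQuantile_le hq hlt hZ0
      simp at this
      exact Or.inr ⟨hX, this⟩
    · refine Or.inl ⟨lt_of_not_ge fun h => ?_, not_lt.1 hX⟩
      exact hu.2 hX (poissonQuantile_of_le h)
  · refine ((measure_union_le _ _).trans_lt (ENNReal.add_lt_top.2
      ⟨(measure_union_le _ _).trans_lt (ENNReal.add_lt_top.2 ⟨by simp, ?_⟩), by simp⟩)).ne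
    rw [Set.uIoc]
    simp
  · refine (measureReal_union_le _ _).trans ?_
    have h1 := measureReal_union_le (μ := (volume : Measure ℝ)) {1}
      (Set.uIoc (Real.exp (-q)) (1 - p))
    have h2 : (volume : Measure ℝ).real {1} = 0 := by simp [measureReal_def]
    have h3 : (volume : Measure ℝ).real (Set.uIoc (Real.exp (-q)) (1 - p)) =
        |1 - p - Real.exp (-q)| := by
      rw [Set.uIoc, Real.volume_real_Ioc_of_le min_le_max, max_sub_min_eq_abs]
    rw [Real.volume_real_Ioc_of_le hE1]
    have h4 : |1 - p - Real.exp (-q)| ≤ q ^ 2 + q * ε := by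
      rw [abs_le]
      constructor <;> nlinarith
    linarith

end Quantile

/-! ### The conditional probability of a defect given the types -/

open Classical in
/-- The state of an edge as a function of its uniform variable. -/
noncomputable def edgeStateOf (θ : ℝ) (φ : EdgeCorrection) {n : ℕ} (w : Fin n → VertexType)
    (e : Fin n × Fin n) (u : ℝ) : Bool × Bool :=
  (decide (1 ≤ poissonQuantile (qRate θ w e.1 e.2) u),
    decide (¬ ((1 - edgeProb θ φ w e.1 e.2 < u ∧ poissonQuantile (qRate θ w e.1 e.2) u = 1) ∨
      (¬ 1 - edgeProb θ φ w e.1 e.2 < u ∧ poissonQuantile (qRate θ w e.1 e.2) u = 0))))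

/-- The states of all edges. -/
noncomputable def edgeStates (θ : ℝ) (φ : EdgeCorrection) {n : ℕ} (w : Fin n → VertexType)
    (U : Fin n × Fin n → unitInterval) : EdgeStates n :=
  fun e => edgeStateOf θ φ w e (U e)

/-- The law of the state of an edge. -/
noncomputable def edgeLaw (θ : ℝ) (φ : EdgeCorrection) {n : ℕ} (w : Fin n → VertexType)
    (e : Fin n × Fin n) : Measure (Bool × Bool) :=
  (volume : Measure unitInterval).map fun u : unitInterval => edgeStateOf θ φ w e u

/-- There is a collision or a mismatch at distance `r`. -/
def EdgeDefect {n : ℕ} (r : ℕ) (ξ : Fin n) (c : EdgeStates n) : Prop :=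
  ((((∃ e : Fin n × Fin n, e.1 ≠ e.2 ∧ (e.1 ∈ actSet (stateEdge c) ξ r ∧
      e.2 ∉ deadSet (stateEdge c) ξ r) ∧ stateMismatch c e.1 e.2) ∨
    ∃ e : Fin n × Fin n, e.1 ≠ e.2 ∧ e.2 ∈ actSet (stateEdge c) ξ r ∧
      stateMismatch c e.1 e.2) ∨
    ∃ e : Fin n × Fin n, (e.2 ∈ actSet (stateEdge c) ξ r ∧
      e.1 ∈ deadSet (stateEdge c) ξ (r + 1)) ∧ stateEdge c e.1 e.2) ∨
    ∃ i : Fin n × Fin n × Fin n, i.1 ≠ i.2.1 ∧ ((i.1 ∈ actSet (stateEdge c) ξ r ∧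
      i.2.1 ∈ deadSet (stateEdge c) ξ (r + 1)) ∧ i.2.2 ∉ deadSet (stateEdge c) ξ r) ∧
      stateEdge c i.1 i.2.2 ∧ stateEdge c i.2.1 i.2.2) ∨
    ∃ i : Fin n × Fin n × Fin n, i.1 ≠ i.2.1 ∧ (i.1 ∈ actSet (stateEdge c) ξ r ∧
      i.2.1 ∈ actSet (stateEdge c) ξ r) ∧ stateEdge c i.2.2 i.1 ∧ stateEdge c i.2.2 i.2.1

/-- The independent parts of the marks that do not vanish although they should. -/
def starDefect (θ : ℝ) {n : ℕ} (w : Fin n → VertexType) (r : ℕ) (ξ : Fin n) (c : EdgeStates n) :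
    Set (TreeNode n × Fin n → unitInterval) :=
  {v | ∃ j ∈ actSet (stateEdge c) ξ r, ∃ t, (t ∈ deadSet (stateEdge c) ξ r ∨ t = j) ∧
    1 ≤ poissonQuantile (qRate θ w j t) (v (bfsPath (stateEdge c) ξ r j, t))}

/-- The event that both `B_i` and `B̃_i` occur. -/
def GoodVertex (θ : ℝ) (φ : EdgeCorrection) (η : ℝ) {n : ℕ} (w : Fin n → VertexType)
    (i : Fin n) : Prop := EventB θ φ η w i ∧ EventBTilde θ φ η w i

/-- The growth of the exploration is controlled before step `r`. -/
def Controlled (θ : ℝ) (φ : EdgeCorrection) (η x : ℝ) {n : ℕ} (w : Fin n → VertexType) (r : ℕ)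
    (ξ : Fin n) (c : EdgeStates n) : Prop :=
  okBefore (fun i => wPlus (w i)) (GoodVertex θ φ η w) x (muMean θ w) r ξ c

/-- The seeds for which there is a defect up to distance `k`. -/
def badSeeds (θ : ℝ) (φ : EdgeCorrection) (η x : ℝ) {n : ℕ} (w : Fin n → VertexType) (k : ℕ) :
    Set (Seed n) :=
  {s | (¬ Controlled θ φ η x w (k + 1) s.1 (edgeStates θ φ w s.2.1) ∨
      ∃ r < k + 1, EdgeDefect r s.1 (edgeStates θ φ w s.2.1)) ∨
      ∃ r < k + 1, s.2.2.2 ∈ starDefect θ w r s.1 (edgeStates θ φ w s.2.1)}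

lemma ind_or_le (p q : Prop) : ind (p ∨ q) ≤ ind p + ind q := by
  by_cases hp : p <;> by_cases hq : q <;> simp [ind, hp, hq]

section SeedBound

variable {n : ℕ} {θ : ℝ} {φ : EdgeCorrection} {w : Fin n → VertexType} {η x : ℝ}

lemma stateEdge_edgeStates (s : Seed n) :
    stateEdge (edgeStates θ φ w s.2.1) = poissonEdge θ w s := by
  ext j t
  simp [stateEdge, edgeStates, edgeStateOf, poissonEdge, coupledZ, seedU]

/-- Only off the diagonal: the discretized state compares `U_{jj}` with the threshold as well, while
the graph has no loops. -/
lemma stateMismatch_edgeStates {s : Seed n} {j t : Fin n} (h : j ≠ t) :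
    stateMismatch (edgeStates θ φ w s.2.1) j t ↔ Mismatch θ φ w s j t := by
  simp only [stateMismatch, edgeStates, edgeStateOf, Mismatch, IsEdge, coupledZ, seedU, ne_eq, h,
    not_false_eq_true, true_and, decide_eq_true_eq]

lemma noDefect_of_notMem_badSeeds {k : ℕ} {s : Seed n} (h : s ∉ badSeeds θ φ η x w k) :
    ∀ r ≤ k, NoDefect θ φ w s r := by
  intro r hr
  simp only [badSeeds, Set.mem_ofPred_eq, not_or, not_exists, not_and] at h
  have hE := h.1.2 r (Nat.lt_succ_of_le hr)
  have hS := h.2 r (Nat.lt_succ_of_le hr)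
  simp only [EdgeDefect, stateEdge_edgeStates, not_or, not_exists, not_and, Prod.forall] at hE
  simp only [starDefect, Set.mem_ofPred_eq, stateEdge_edgeStates, not_exists, not_and] at hS
  obtain ⟨⟨⟨⟨h1, h2⟩, h3⟩, h4⟩, h5⟩ := hE
  refine ⟨?_, ?_, ?_, ?_, ?_, ?_⟩
  · intro j hj t ht hne
    rw [← stateMismatch_edgeStates hne]
    exact h1 j t hne ⟨hj, ht⟩
  · intro t ht j hne
    rw [← stateMismatch_edgeStates hne]
    exact h2 j t hne ht
  · intro t ht j hj
    exact h3 j t ⟨ht, hj⟩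
  · rintro j hj j' hj' hne t ht ⟨ha, hb⟩
    exact h4 j j' t hne ⟨⟨hj, hj'⟩, ht⟩ ha hb
  · rintro t ht t' ht' hne j ⟨ha, hb⟩
    exact h5 t t' j hne ⟨ht, ht'⟩ ha hb
  · intro j hj t ht
    have := hS j hj t ht
    simpa [starZ, seedStar, seedRoot] using this

lemma ind_edgeDefect_le (r : ℕ) (ξ : Fin n) (c : EdgeStates n) :
    ind (EdgeDefect r ξ c) ≤ outMismatches r ξ c + inMismatches r ξ c + returnEdges r ξ c +
      commonTargets r ξ c + commonSources r ξ c := by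
  refine (ind_or_le _ _).trans (add_le_add ((ind_or_le _ _).trans (add_le_add
    ((ind_or_le _ _).trans (add_le_add ((ind_or_le _ _).trans (add_le_add ?_ ?_)) ?_)) ?_)) ?_)
  all_goals refine (ind_exists_le_sum _).trans (le_of_eq (Finset.sum_congr rfl fun i _ => ?_))
  all_goals simp only [ind_and, one_mul]

lemma starRate_nonneg {m p : Fin n → ℝ} {N : ℝ} (hm : ∀ i, 0 ≤ m i) (hp : ∀ i, 0 ≤ p i)
    (hN : 0 < N) (r : ℕ) (ξ : Fin n) (c : EdgeStates n) : 0 ≤ starRate m p N r ξ c :=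
  Finset.sum_nonneg fun j _ => add_nonneg (Finset.sum_nonneg fun t _ =>
    div_nonneg (mul_nonneg (hm j) (hp t)) hN.le) (div_nonneg (mul_nonneg (hm j) (hp j)) hN.le)

lemma ind_edgeDefect_add_starRate_le {m p : Fin n → ℝ} {N : ℝ} (r : ℕ) (ξ : Fin n)
    (c : EdgeStates n) : ind (EdgeDefect r ξ c) + starRate m p N r ξ c ≤
      defectCount m p N r ξ c :=
  add_le_add (ind_edgeDefect_le r ξ c) le_rfl

open Classical in
lemma measurable_edgeStateOf_comp {α : Type*} [MeasurableSpace α] {q p u : α → ℝ}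
    (hq : Measurable q) (hp : Measurable p) (hu : Measurable u) :
    Measurable fun a => (decide (1 ≤ poissonQuantile (q a) (u a)),
      decide (¬ ((1 - p a < u a ∧ poissonQuantile (q a) (u a) = 1) ∨
        (¬ 1 - p a < u a ∧ poissonQuantile (q a) (u a) = 0)))) := by
  have hZ : Measurable fun a => poissonQuantile (q a) (u a) :=
    measurable_poissonQuantile.comp (hq.prodMk hu)
  have hX : Measurable fun a => 1 - p a < u a :=
    measurableSet_setOfPred.1 (measurableSet_lt (measurable_const.sub hp) hu)
  have hZ' : ∀ k, Measurable fun a => poissonQuantile (q a) (u a) = k := fun k =>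
    measurableSet_setOfPred.1 (hZ (measurableSet_singleton k))
  have hdec : ∀ {f : α → Prop} [DecidablePred f], Measurable f →
      Measurable fun a => decide (f a) := by
    intro f _ hf
    refine measurable_to_bool ?_
    have : (fun a => decide (f a)) ⁻¹' {true} = {a | f a} := by ext a; simp
    rw [this]
    exact measurableSet_setOfPred.2 hf
  exact (hdec (measurableSet_setOfPred.1 (measurableSet_le measurable_const hZ))).prodMk
    (hdec (((hX.and (hZ' 1)).or (hX.not.and (hZ' 0))).not))

lemma measurable_edgeStateOf (e : Fin n × Fin n) :
    Measurable fun u : unitInterval => edgeStateOf θ φ w e u :=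
  measurable_edgeStateOf_comp measurable_const measurable_const measurable_subtype_coe

instance (e : Fin n × Fin n) : IsProbabilityMeasure (edgeLaw θ φ w e) :=
  Measure.isProbabilityMeasure_map (measurable_edgeStateOf e).aemeasurable

lemma edgeLaw_real (e : Fin n × Fin n) (B : Bool × Bool → Prop) :
    (edgeLaw θ φ w e).real {b | B b} =
      (volume : Measure unitInterval).real {u | B (edgeStateOf θ φ w e u)} := by
  rw [measureReal_def, edgeLaw, Measure.map_apply (measurable_edgeStateOf e)
    (Set.toFinite _).measurableSet]
  rfl

lemma qRate_nonneg (hθ : 0 < θ) (i j : Fin n) : 0 ≤ qRate θ w i j :=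
  div_nonneg (mul_nonneg (NNReal.coe_nonneg _) (NNReal.coe_nonneg _)) (by positivity)

lemma edgeLaw_real_edge_le (hθ : 0 < θ) (e : Fin n × Fin n) :
    (edgeLaw θ φ w e).real {b | b.1 = true} ≤ qRate θ w e.1 e.2 := by
  rw [edgeLaw_real e (fun b => b.1 = true)]
  simp only [edgeStateOf, decide_eq_true_eq]
  exact volume_real_one_le_poissonQuantile_le (qRate_nonneg hθ _ _)

lemma edgeLaw_real_mismatch_le (hθ : 0 < θ) {e : Fin n × Fin n} {ε : ℝ} (hε : ε ≤ 1)
    (hq : qRate θ w e.1 e.2 ≤ 1 / 4) (hφ : |phiTerm φ w e.1 e.2| ≤ ε) :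
    (edgeLaw θ φ w e).real {b | b.2 = true} ≤
      qRate θ w e.1 e.2 * ε + 2 * qRate θ w e.1 e.2 ^ 2 := by
  rw [edgeLaw_real e (fun b => b.2 = true)]
  simp only [edgeStateOf, decide_eq_true_eq]
  exact volume_real_mismatch_le (qRate_nonneg hθ _ _) hq hφ hε

/-- Fubini's theorem for the discretized seed. -/
lemma seedLaw_le_ofReal_expect {Q : Fin n → EdgeStates n →
      Set (TreeNode n × Fin n → unitInterval)} {F : Fin n → EdgeStates n → ℝ}
    (hF : ∀ ξ c, 0 ≤ F ξ c)
    (hQ : ∀ ξ c, (Measure.infinitePi fun _ : TreeNode n × Fin n =>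
      (volume : Measure unitInterval)) (Q ξ c) ≤ ENNReal.ofReal (F ξ c)) :
    seedLaw n {s | s.2.2.2 ∈ Q s.1 (edgeStates θ φ w s.2.1)} ≤
      ENNReal.ofReal (expect (edgeLaw θ φ w) F) := by
  rcases Nat.eq_zero_or_pos n with rfl | hn
  · have : {s : Seed 0 | s.2.2.2 ∈ Q s.1 (edgeStates θ φ w s.2.1)} = ∅ :=
      Set.eq_empty_of_forall_notMem fun s => s.1.elim0
    rw [this, measure_empty]
    exact zero_le
  -- There are finitely many values of the root and of the edge states, so a finite cover by product
  -- sets replaces an integral and `Q` need not be measurable. The variables for repeated types do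
  -- not matter: such nodes arise only after a defect.
  have hcover : {s : Seed n | s.2.2.2 ∈ Q s.1 (edgeStates θ φ w s.2.1)} ⊆
      ⋃ ξ ∈ (Finset.univ : Finset (Fin n)), ⋃ c ∈ (Finset.univ : Finset (EdgeStates n)),
        ({ξ} : Set (Fin n)) ×ˢ ({U | edgeStates θ φ w U = c} ×ˢ
          ((Set.univ : Set (TreeNode n × Fin n → unitInterval)) ×ˢ Q ξ c)) := by
    intro s hs
    simp only [Finset.mem_univ, Set.iUnion_true, Set.mem_iUnion]
    exact ⟨s.1, edgeStates θ φ w s.2.1, rfl, rfl, trivial, hs⟩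
  have hU : ∀ c, (Measure.infinitePi fun _ : Fin n × Fin n => (volume : Measure unitInterval))
      {U | edgeStates θ φ w U = c} = Measure.pi (edgeLaw θ φ w) {c} := by
    intro c
    have h1 := Measure.infinitePi_map_pi (fun _ : Fin n × Fin n => (volume : Measure unitInterval))
      (f := fun e (u : unitInterval) => edgeStateOf θ φ w e u) (fun e => measurable_edgeStateOf e)
    have h2 : Measure.pi (edgeLaw θ φ w) = (Measure.infinitePi fun _ : Fin n × Fin n =>
        (volume : Measure unitInterval)).map (edgeStates θ φ w) := by
      rw [← Measure.infinitePi_eq_pi]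
      exact h1.symm
    have hm : Measurable (edgeStates θ φ w) := measurable_pi_lambda _ fun e =>
      (measurable_edgeStateOf e).comp (measurable_pi_apply e)
    rw [h2, Measure.map_apply hm (measurableSet_singleton c)]
    rfl
  refine (measure_mono hcover).trans ((measure_biUnion_finset_le _ _).trans ?_)
  have hterm : ∀ ξ, seedLaw n (⋃ c ∈ (Finset.univ : Finset (EdgeStates n)),
        ({ξ} : Set (Fin n)) ×ˢ ({U | edgeStates θ φ w U = c} ×ˢ
          ((Set.univ : Set (TreeNode n × Fin n → unitInterval)) ×ˢ Q ξ c))) ≤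
      ENNReal.ofReal ((n : ℝ)⁻¹ * ∫ c, F ξ c ∂Measure.pi (edgeLaw θ φ w)) := by
    intro ξ
    rw [integral_fintype .of_finite, Finset.mul_sum, ENNReal.ofReal_sum_of_nonneg]
    · refine (measure_biUnion_finset_le _ _).trans (Finset.sum_le_sum fun c _ => ?_)
      rw [seedLaw, Measure.prod_prod, Measure.prod_prod, Measure.prod_prod, hU c, measure_univ,
        one_mul, smul_eq_mul, ENNReal.ofReal_mul (by positivity),
        ENNReal.ofReal_mul measureReal_nonneg, ofReal_measureReal]
      refine mul_le_mul' (le_of_eq ?_) (mul_le_mul' le_rfl (hQ ξ c))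
      rw [uniformOn_univ, Measure.count_singleton, Fintype.card_fin,
        ENNReal.ofReal_inv_of_pos (by exact_mod_cast hn), ENNReal.ofReal_natCast, one_div]
    · intro c _
      exact mul_nonneg (by positivity) (mul_nonneg measureReal_nonneg (hF ξ c))
  refine (Finset.sum_le_sum fun ξ _ => hterm ξ).trans (le_of_eq ?_)
  rw [expect, Finset.mul_sum, ENNReal.ofReal_sum_of_nonneg]
  intro ξ _
  exact mul_nonneg (by positivity) (integral_nonneg (hF ξ))

/-- Once `ξ` and `c` are frozen, the nodes `bfsPath` are deterministic, so fixed coordinates are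
read and a union bound with `P(Z ≥ 1) ≤ q` suffices. -/
lemma infinitePi_starDefect_le (hθ : 0 < θ) (r : ℕ) (ξ : Fin n) (c : EdgeStates n) :
    (Measure.infinitePi fun _ : TreeNode n × Fin n => (volume : Measure unitInterval))
      (starDefect θ w r ξ c) ≤ ENNReal.ofReal
        (starRate (fun i => wMinus (w i)) (fun i => wPlus (w i)) (θ * n) r ξ c) := by
  classical
  set ν := Measure.infinitePi fun _ : TreeNode n × Fin n => (volume : Measure unitInterval)
  have hcoord : ∀ (u : TreeNode n) (j t : Fin n), ν {v | 1 ≤ poissonQuantile (qRate θ w j t)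
      (v (u, t))} ≤ ENNReal.ofReal (qRate θ w j t) := by
    intro u j t
    have hB : MeasurableSet {y : unitInterval | 1 ≤ poissonQuantile (qRate θ w j t) y} :=
      measurableSet_le measurable_const
        (measurable_poissonQuantile.comp (measurable_const.prodMk measurable_subtype_coe))
    have h1 := (measurePreserving_eval_infinitePi
      (fun _ : TreeNode n × Fin n => (volume : Measure unitInterval)) (u, t)).measure_preimage
      hB.nullMeasurableSet
    refine (le_of_eq h1).trans ?_
    rw [← ofReal_measureReal]
    exact ENNReal.ofReal_le_ofReal
      (volume_real_one_le_poissonQuantile_le (qRate_nonneg hθ _ _))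
  have hcover : starDefect θ w r ξ c ⊆ ⋃ j ∈ actSet (stateEdge c) ξ r,
      ((⋃ t ∈ deadSet (stateEdge c) ξ r, {v | 1 ≤ poissonQuantile (qRate θ w j t)
        (v (bfsPath (stateEdge c) ξ r j, t))}) ∪ {v | 1 ≤ poissonQuantile (qRate θ w j j)
        (v (bfsPath (stateEdge c) ξ r j, j))}) := by
    rintro v ⟨j, hj, t, ht | rfl, h⟩
    · refine Set.mem_biUnion hj (Or.inl (Set.mem_biUnion ht h))
    · exact Set.mem_biUnion hj (Or.inr h)
  refine (measure_mono hcover).trans ((measure_biUnion_finset_le _ _).trans ?_)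
  have hq0 : ∀ i j, 0 ≤ qRate θ w i j := fun i j => qRate_nonneg hθ i j
  change _ ≤ ENNReal.ofReal (∑ j ∈ actSet (stateEdge c) ξ r,
    (∑ t ∈ deadSet (stateEdge c) ξ r, qRate θ w j t + qRate θ w j j))
  rw [ENNReal.ofReal_sum_of_nonneg fun j _ => add_nonneg
    (Finset.sum_nonneg fun t _ => hq0 j t) (hq0 j j)]
  refine Finset.sum_le_sum fun j _ => (measure_union_le _ _).trans ?_
  rw [ENNReal.ofReal_add (Finset.sum_nonneg fun t _ => hq0 j t) (hq0 j j),
    ENNReal.ofReal_sum_of_nonneg fun t _ => hq0 j t]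
  refine add_le_add ((measure_biUnion_finset_le _ _).trans
    (Finset.sum_le_sum fun t _ => hcoord _ j t)) (hcoord _ j j)

/-- The conditional probability of a defect is bounded by the expected number of defects. -/
lemma seedLaw_badSeeds_le (hθ : 0 < θ) (hn : 0 < n) (k : ℕ) :
    seedLaw n (badSeeds θ φ η x w k) ≤ ENNReal.ofReal (expect (edgeLaw θ φ w) fun ξ c =>
      ind (¬ okBefore (fun i => wPlus (w i)) (GoodVertex θ φ η w) x (muMean θ w) (k + 1) ξ c) +
      ∑ r ∈ Finset.range (k + 1),
        ind (okBefore (fun i => wPlus (w i)) (GoodVertex θ φ η w) x (muMean θ w) (r + 1) ξ c) *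
        defectCount (fun i => wMinus (w i)) (fun i => wPlus (w i)) (θ * n) r ξ c) := by
  have hN : 0 < θ * n := mul_pos hθ (by exact_mod_cast hn)
  have hstar : ∀ r ξ c, 0 ≤ starRate (fun i => wMinus (w i)) (fun i => wPlus (w i)) (θ * n) r ξ c :=
    starRate_nonneg (fun i => NNReal.coe_nonneg _) (fun i => NNReal.coe_nonneg _) hN
  have hcount : ∀ r ξ c, ind (EdgeDefect r ξ c) +
      starRate (fun i => wMinus (w i)) (fun i => wPlus (w i)) (θ * n) r ξ c ≤
      defectCount (fun i => wMinus (w i)) (fun i => wPlus (w i)) (θ * n) r ξ c :=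
    fun r ξ c => ind_edgeDefect_add_starRate_le r ξ c
  have hcount0 : ∀ r ξ c,
      0 ≤ defectCount (fun i => wMinus (w i)) (fun i => wPlus (w i)) (θ * n) r ξ c :=
    fun r ξ c => (add_nonneg (ind_nonneg _) (hstar r ξ c)).trans (hcount r ξ c)
  refine seedLaw_le_ofReal_expect (Q := fun ξ c => {v | (¬ Controlled θ φ η x w (k + 1) ξ c ∨
      ∃ r < k + 1, EdgeDefect r ξ c) ∨ ∃ r < k + 1, v ∈ starDefect θ w r ξ c}) ?_ ?_
  · exact fun ξ c => add_nonneg (ind_nonneg _) (Finset.sum_nonneg fun r _ =>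
      mul_nonneg (ind_nonneg _) (hcount0 r ξ c))
  · intro ξ c
    -- If control fails or an edge defect occurs, the right-hand side is at least 1. Otherwise only
    -- the starred variables can cause a defect, and their rates are part of the count.
    by_cases hc : Controlled θ φ η x w (k + 1) ξ c
    · have hc' : ∀ r ∈ Finset.range (k + 1), ind (okBefore (fun i => wPlus (w i))
          (GoodVertex θ φ η w) x (muMean θ w) (r + 1) ξ c) = 1 := fun r hr =>
        ind_of (okBefore.mono (by have := Finset.mem_range.1 hr; omega) hc)
      rw [ind_of_not (p := ¬ okBefore (fun i => wPlus (w i)) (GoodVertex θ φ η w) x (muMean θ w)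
        (k + 1) ξ c) (not_not.2 hc), zero_add,
        Finset.sum_congr rfl fun r hr => by rw [hc' r hr, one_mul]]
      by_cases hd : ∃ r < k + 1, EdgeDefect r ξ c
      · obtain ⟨r, hr, hd⟩ := hd
        refine (measure_mono (Set.subset_univ _)).trans ?_
        rw [measure_univ, ← ENNReal.ofReal_one]
        refine ENNReal.ofReal_le_ofReal ?_
        have h1 := hcount r ξ c
        rw [ind_of hd] at h1
        exact ((le_add_of_nonneg_right (hstar r ξ c)).trans h1).trans
          (Finset.single_le_sum (f := fun r => defectCount (fun i => wMinus (w i))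
            (fun i => wPlus (w i)) (θ * n) r ξ c) (fun r _ => hcount0 r ξ c)
            (Finset.mem_range.2 hr))
      · have hsub : {v | (¬ Controlled θ φ η x w (k + 1) ξ c ∨ ∃ r < k + 1, EdgeDefect r ξ c) ∨
            ∃ r < k + 1, v ∈ starDefect θ w r ξ c} ⊆
            ⋃ r ∈ Finset.range (k + 1), starDefect θ w r ξ c := by
          rintro v ((h | h) | ⟨r, hr, h⟩)
          · exact absurd hc h
          · exact absurd h hd
          · exact Set.mem_biUnion (Finset.mem_coe.2 (Finset.mem_range.2 hr)) h
        refine (measure_mono hsub).trans ((measure_biUnion_finset_le _ _).trans ?_)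
        rw [ENNReal.ofReal_sum_of_nonneg fun r _ => hcount0 r ξ c]
        exact Finset.sum_le_sum fun r _ => (infinitePi_starDefect_le hθ r ξ c).trans
          (ENNReal.ofReal_le_ofReal ((le_add_of_nonneg_left (ind_nonneg _)).trans (hcount r ξ c)))
    · refine (measure_mono (Set.subset_univ _)).trans ?_
      rw [measure_univ, ← ENNReal.ofReal_one]
      refine ENNReal.ofReal_le_ofReal ?_
      rw [ind_of (p := ¬ okBefore (fun i => wPlus (w i)) (GoodVertex θ φ η w) x (muMean θ w)
        (k + 1) ξ c) hc]
      exact le_add_of_nonneg_right (Finset.sum_nonneg fun r _ =>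
        mul_nonneg (ind_nonneg _) (hcount0 r ξ c))

end SeedBound

/-! ### Comparison with the error expression -/

/-- The collision sum includes the diagonal `l = r`, the error expression does not. The diagonal
term at 0 is at most `μ / c₀`, and a later one is `μ` times the last term of its row, which gives
the constants `1 / c₀` and `M`. -/
lemma sum_pow_mul_sum_pow_le {μ c₀ M : ℝ} (hc₀ : 0 < c₀) (hμ : c₀ ≤ μ) (hM : μ ≤ M) {k : ℕ}
    (hk : 1 ≤ k) :
    ∑ r ∈ Finset.range (k + 1), μ ^ r * ∑ l ∈ Finset.range (r + 1), μ ^ l ≤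
      (1 + M + 1 / c₀) * ∑ m ∈ Finset.Icc 1 k, ∑ r ∈ Finset.range m, μ ^ (m + r) := by
  have hμ0 : 0 ≤ μ := hc₀.le.trans hμ
  set S := ∑ m ∈ Finset.Icc 1 k, ∑ r ∈ Finset.range m, μ ^ (m + r) with hS
  have hS0 : ∀ m, 0 ≤ ∑ r ∈ Finset.range m, μ ^ (m + r) := fun m =>
    Finset.sum_nonneg fun r _ => pow_nonneg hμ0 _
  have hS1 : S = ∑ r ∈ Finset.range (k + 1), ∑ l ∈ Finset.range r, μ ^ (r + l) := by
    rw [Finset.sum_range_eq_add_Ico _ (Nat.succ_pos k)]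
    simp only [Finset.range_zero, Finset.sum_empty, zero_add]
    rfl
  have hdiag : ∑ r ∈ Finset.range (k + 1), μ ^ (r + r) ≤ 1 / c₀ * S + M * S := by
    rw [Finset.sum_range_eq_add_Ico _ (Nat.succ_pos k)]
    refine add_le_add ?_ ?_
    · have h1 : ∑ r ∈ Finset.range 1, μ ^ (1 + r) ≤ S :=
        Finset.single_le_sum (f := fun m => ∑ r ∈ Finset.range m, μ ^ (m + r))
          (fun m _ => hS0 m) (Finset.mem_Icc.2 ⟨le_rfl, hk⟩)
      rw [Finset.sum_range_one, add_zero, pow_one] at h1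
      rw [add_zero, pow_zero, one_div, inv_mul_eq_div, le_div_iff₀ hc₀, one_mul]
      exact hμ.trans h1
    · rw [hS, Finset.mul_sum]
      refine Finset.sum_le_sum fun r hr => ?_
      obtain ⟨s, rfl⟩ := Nat.exists_eq_add_of_le' (Finset.mem_Ico.1 hr).1
      have h1 : μ ^ (s + 1 + s) ≤ ∑ l ∈ Finset.range (s + 1), μ ^ (s + 1 + l) :=
        Finset.single_le_sum (f := fun l => μ ^ (s + 1 + l)) (fun l _ => pow_nonneg hμ0 _)
          (Finset.self_mem_range_succ s)
      calc μ ^ (s + 1 + (s + 1)) = μ * μ ^ (s + 1 + s) := by ring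
        _ ≤ M * ∑ l ∈ Finset.range (s + 1), μ ^ (s + 1 + l) :=
          mul_le_mul hM h1 (pow_nonneg hμ0 _) (hμ0.trans hM)
  have hsplit : ∑ r ∈ Finset.range (k + 1), μ ^ r * ∑ l ∈ Finset.range (r + 1), μ ^ l =
      S + ∑ r ∈ Finset.range (k + 1), μ ^ (r + r) := by
    rw [hS1, ← Finset.sum_add_distrib]
    refine Finset.sum_congr rfl fun r _ => ?_
    rw [Finset.mul_sum, Finset.sum_range_succ]
    simp only [pow_add]
  rw [hsplit]
  linarith

/-- A moment of a vertex type that dominates all the moments that are needed. -/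
noncomputable def typeMoment (δ : ℝ) (v : VertexType) : ℝ :=
  (1 + wMinus v ^ 2) * (1 + wPlus v ^ (1 + δ))

/-! ### Empirical moments controlled by `typeMoment`. -/

section Moments

variable {δ : ℝ}

lemma wPlus_nonneg (v : VertexType) : 0 ≤ wPlus v := NNReal.coe_nonneg _

lemma wMinus_nonneg (v : VertexType) : 0 ≤ wMinus v := NNReal.coe_nonneg _

lemma wPlus_le_one_add_rpow (hδ : 0 < δ) (v : VertexType) : wPlus v ≤ 1 + wPlus v ^ (1 + δ) := by
  have h0 := wPlus_nonneg v
  rcases le_total (wPlus v) 1 with h | h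
  · exact h.trans (le_add_of_nonneg_right (Real.rpow_nonneg h0 _))
  · have := Real.rpow_le_rpow_of_exponent_le h (show (1 : ℝ) ≤ 1 + δ by linarith)
    rw [Real.rpow_one] at this
    linarith

lemma rpow_le_one_add_sq {y s : ℝ} (hy : 0 ≤ y) (hs : 0 ≤ s) (hs2 : s ≤ 2) :
    y ^ s ≤ 1 + y ^ 2 := by
  rcases le_total y 1 with h | h
  · exact (Real.rpow_le_one hy h hs).trans (le_add_of_nonneg_right (sq_nonneg y))
  · have := Real.rpow_le_rpow_of_exponent_le h hs2
    rw [Real.rpow_two] at this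
    linarith

lemma mul_le_typeMoment {a b c : ℝ} {v : VertexType} (hb : 0 ≤ b) (hc : 0 ≤ c)
    (h1 : a ≤ c * (1 + wMinus v ^ 2)) (h2 : b ≤ 1 + wPlus v ^ (1 + δ)) :
    a * b ≤ c * typeMoment δ v := by
  calc a * b ≤ (c * (1 + wMinus v ^ 2)) * (1 + wPlus v ^ (1 + δ)) :=
        mul_le_mul h1 h2 hb (mul_nonneg hc (by positivity))
    _ = _ := by rw [typeMoment]; ring

variable {n : ℕ} {w : Fin n → VertexType} {K : ℝ}

lemma average_le_of_le_typeMoment (hK : (∑ i, typeMoment δ (w i)) / n ≤ K) {f : Fin n → ℝ} {c : ℝ}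
    (hc : 0 ≤ c) (hf : ∀ i, f i ≤ c * typeMoment δ (w i)) : (∑ i, f i) / n ≤ c * K := by
  calc (∑ i, f i) / n ≤ (∑ i, c * typeMoment δ (w i)) / n :=
        div_le_div_of_nonneg_right (Finset.sum_le_sum fun i _ => hf i) (by positivity)
    _ = c * ((∑ i, typeMoment δ (w i)) / n) := by rw [← Finset.mul_sum, mul_div_assoc]
    _ ≤ c * K := mul_le_mul_of_nonneg_left hK hc

lemma average_wPlus_le (hδ : 0 < δ) (hK : (∑ i, typeMoment δ (w i)) / n ≤ K) :
    (∑ t, wPlus (w t)) / n ≤ K := by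
  simpa using average_le_of_le_typeMoment hK zero_le_one fun i => by
    simpa using mul_le_typeMoment (δ := δ) (v := w i) (a := 1) (c := 1) (wPlus_nonneg (w i))
      zero_le_one (by nlinarith [sq_nonneg (wMinus (w i))]) (wPlus_le_one_add_rpow hδ _)

lemma average_wPlus_rpow_le (hK : (∑ i, typeMoment δ (w i)) / n ≤ K) :
    (∑ t, wPlus (w t) ^ (1 + δ)) / n ≤ K := by
  simpa using average_le_of_le_typeMoment hK zero_le_one fun i => by
    simpa using mul_le_typeMoment (δ := δ) (v := w i) (a := 1) (c := 1)
      (Real.rpow_nonneg (wPlus_nonneg (w i)) (1 + δ))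
      zero_le_one (by nlinarith [sq_nonneg (wMinus (w i))]) (by linarith)

lemma average_wMinus_le (hK : (∑ i, typeMoment δ (w i)) / n ≤ K) :
    (∑ t, wMinus (w t)) / n ≤ K := by
  simpa using average_le_of_le_typeMoment hK zero_le_one fun i => by
    simpa using mul_le_typeMoment (δ := δ) (v := w i) (a := wMinus (w i)) (b := 1) (c := 1)
      zero_le_one zero_le_one (by nlinarith [sq_nonneg (wMinus (w i) - 1)])
      (le_add_of_nonneg_right (Real.rpow_nonneg (wPlus_nonneg _) _))

lemma average_wMinus_mul_self_le (hK : (∑ i, typeMoment δ (w i)) / n ≤ K) :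
    (∑ t, wMinus (w t) * wMinus (w t)) / n ≤ K := by
  simpa using average_le_of_le_typeMoment hK zero_le_one fun i => by
    simpa using mul_le_typeMoment (δ := δ) (v := w i) (a := wMinus (w i) * wMinus (w i)) (b := 1)
      (c := 1) zero_le_one zero_le_one (by nlinarith)
      (le_add_of_nonneg_right (Real.rpow_nonneg (wPlus_nonneg _) _))

lemma average_wMinus_rpow_le (hδ : 0 < δ) (hδ1 : δ ≤ 1) (hK : (∑ i, typeMoment δ (w i)) / n ≤ K) :
    (∑ t, wMinus (w t) ^ (1 + δ)) / n ≤ K := by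
  simpa using average_le_of_le_typeMoment hK zero_le_one fun i => by
    simpa using mul_le_typeMoment (δ := δ) (v := w i) (a := wMinus (w i) ^ (1 + δ)) (b := 1)
      (c := 1) zero_le_one zero_le_one (by
        have := rpow_le_one_add_sq (wMinus_nonneg (w i)) (show 0 ≤ 1 + δ by linarith)
          (show 1 + δ ≤ 2 by linarith)
        linarith) (le_add_of_nonneg_right (Real.rpow_nonneg (wPlus_nonneg _) _))

lemma typeMoment_nonneg (v : VertexType) : 0 ≤ typeMoment δ v :=
  mul_nonneg (by positivity) (add_nonneg zero_le_one (Real.rpow_nonneg (wPlus_nonneg v) _))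

/-- A single term is at most the whole sum. This yields the uniform bounds `W⁺ ≤ K n` and `(W⁻)² ≤ K
n` that trade missing moments for powers of `n`. -/
lemma typeMoment_le (hn : 0 < n) (hK : (∑ i, typeMoment δ (w i)) / n ≤ K) (i : Fin n) :
    typeMoment δ (w i) ≤ K * n := by
  rw [div_le_iff₀ (by exact_mod_cast hn)] at hK
  exact (Finset.single_le_sum (f := fun i => typeMoment δ (w i))
    (fun i _ => typeMoment_nonneg _) (Finset.mem_univ i)).trans hK

lemma wPlus_le (hδ : 0 < δ) (hn : 0 < n) (hK : (∑ i, typeMoment δ (w i)) / n ≤ K) (i : Fin n) :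
    wPlus (w i) ≤ K * n := by
  refine le_trans ?_ (typeMoment_le hn hK i)
  have := mul_le_typeMoment (δ := δ) (v := w i) (a := 1) (b := wPlus (w i)) (c := 1)
    (wPlus_nonneg _) zero_le_one (by nlinarith [sq_nonneg (wMinus (w i))])
    (wPlus_le_one_add_rpow hδ _)
  linarith

lemma wMinus_sq_le (hn : 0 < n) (hK : (∑ i, typeMoment δ (w i)) / n ≤ K) (i : Fin n) :
    wMinus (w i) ^ 2 ≤ K * n := by
  refine le_trans ?_ (typeMoment_le hn hK i)
  have := mul_le_typeMoment (δ := δ) (v := w i) (a := wMinus (w i) ^ 2) (b := 1) (c := 1)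
    zero_le_one zero_le_one (by linarith)
    (le_add_of_nonneg_right (Real.rpow_nonneg (wPlus_nonneg _) _))
  linarith

end Moments

/-! ### Averages of the mismatch rates at good vertices. -/

section Averages

variable {n : ℕ} {w : Fin n → VertexType} {θ δ η K : ℝ}

/-- A bound for the probability that some edge at a good vertex is mismatched. -/
noncomputable def mismatchBound (θ δ η : ℝ) {n : ℕ} (w : Fin n → VertexType) (j : Fin n) : ℝ :=
  ∑ t, (qRate θ w j t * (n : ℝ) ^ (-η) + 2 * qRate θ w j t ^ (1 + δ)) +
    ∑ i, (qRate θ w i j * (n : ℝ) ^ (-η) + 2 * qRate θ w i j ^ (1 + δ)) + qRate θ w j j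

lemma mismatchBound_nonneg (hθ : 0 < θ) (j : Fin n) : 0 ≤ mismatchBound θ δ η w j := by
  have h : ∀ i j, 0 ≤ qRate θ w i j := fun i j => qRate_nonneg hθ i j
  have h' : ∀ i j, 0 ≤ qRate θ w i j * (n : ℝ) ^ (-η) + 2 * qRate θ w i j ^ (1 + δ) :=
    fun i j => add_nonneg (mul_nonneg (h i j) (Real.rpow_nonneg (Nat.cast_nonneg n) _))
      (mul_nonneg zero_le_two (Real.rpow_nonneg (h i j) _))
  exact add_nonneg (add_nonneg (Finset.sum_nonneg fun t _ => h' j t)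
    (Finset.sum_nonneg fun t _ => h' t j)) (h j j)

lemma qRate_rpow (hθ : 0 < θ) (i j : Fin n) : qRate θ w i j ^ (1 + δ) =
    wMinus (w i) ^ (1 + δ) * wPlus (w j) ^ (1 + δ) * (θ ^ (-(1 + δ)) * (n : ℝ) ^ (-(1 + δ))) := by
  rw [qRate, Real.div_rpow (mul_nonneg (wMinus_nonneg _) (wPlus_nonneg _)) (by positivity),
    Real.mul_rpow (wMinus_nonneg _) (wPlus_nonneg _), Real.mul_rpow hθ.le (Nat.cast_nonneg n),
    Real.rpow_neg hθ.le, Real.rpow_neg (Nat.cast_nonneg n), div_eq_mul_inv, mul_inv]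

lemma rpow_neg_le_of_le (hn : 0 < n) {a b : ℝ} (h : a ≤ b) :
    (n : ℝ) ^ (-b) ≤ (n : ℝ) ^ (-a) :=
  Real.rpow_le_rpow_of_exponent_le (by exact_mod_cast hn) (neg_le_neg h)

lemma rpow_neg_one_add (hn : 0 < n) : (n : ℝ) ^ (-(1 + δ)) = (n : ℝ) ^ (-δ) / n := by
  have hn' : (0 : ℝ) < n := by exact_mod_cast hn
  rw [neg_add, Real.rpow_add hn', Real.rpow_neg_one]
  ring

lemma sum_qRate_left (j : Fin n) :
    ∑ t, qRate θ w j t = wMinus (w j) * ((∑ t, wPlus (w t)) / n) / θ := by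
  simp only [qRate]
  rw [← Finset.sum_div, ← Finset.mul_sum, mul_comm θ, ← div_div, mul_div_assoc]

lemma sum_qRate_right (j : Fin n) :
    ∑ i, qRate θ w i j = wPlus (w j) * ((∑ i, wMinus (w i)) / n) / θ := by
  simp only [qRate]
  rw [← Finset.sum_div, ← Finset.sum_mul, mul_comm θ, ← div_div, mul_div_right_comm]
  ring

lemma sum_qRate_rpow_left (hθ : 0 < θ) (hn : 0 < n) (j : Fin n) :
    ∑ t, qRate θ w j t ^ (1 + δ) = θ ^ (-(1 + δ)) * (wMinus (w j) ^ (1 + δ) * (n : ℝ) ^ (-δ)) *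
      ((∑ t, wPlus (w t) ^ (1 + δ)) / n) := by
  simp only [qRate_rpow hθ]
  rw [← Finset.sum_mul, ← Finset.mul_sum, rpow_neg_one_add hn]
  ring

lemma sum_qRate_rpow_right (hθ : 0 < θ) (hn : 0 < n) (j : Fin n) :
    ∑ i, qRate θ w i j ^ (1 + δ) = θ ^ (-(1 + δ)) * (wPlus (w j) ^ (1 + δ) * (n : ℝ) ^ (-δ)) *
      ((∑ i, wMinus (w i) ^ (1 + δ)) / n) := by
  simp only [qRate_rpow hθ]
  rw [← Finset.sum_mul, ← Finset.sum_mul, rpow_neg_one_add hn]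
  ring

/-- The constant in the bound for the mismatch probabilities. -/
noncomputable def mismatchConst (θ δ K : ℝ) : ℝ :=
  2 * K / θ + 4 * θ ^ (-(1 + δ)) * K ^ (δ / 2) * K + 2 * K / θ + 4 * θ ^ (-(1 + δ)) * K + 2 / θ

lemma mismatchConst_nonneg (hθ : 0 < θ) (hK0 : 0 < K) : 0 ≤ mismatchConst θ δ K := by
  have h1 : 0 < θ ^ (-(1 + δ)) := Real.rpow_pos_of_pos hθ _
  have h2 : 0 < K ^ (δ / 2) := Real.rpow_pos_of_pos hK0 _
  rw [mismatchConst]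
  positivity

/-- The bound is still to be multiplied by `W⁻`, and `2 + δ` moments are not available. The excess
power `(W⁻) ^ δ` is therefore replaced by `(K n) ^ (δ / 2)`; this is the origin of `δ / 2` in `γ`.
-/
lemma wMinus_rpow_mul_le (hδ : 0 < δ) (hn : 0 < n) (hK0 : 0 < K)
    (hK : (∑ i, typeMoment δ (w i)) / n ≤ K) (j : Fin n) :
    wMinus (w j) ^ (1 + δ) * (n : ℝ) ^ (-δ) ≤
      wMinus (w j) * (K ^ (δ / 2) * (n : ℝ) ^ (-(δ / 2))) := by
  have hn' : (0 : ℝ) < n := by exact_mod_cast hn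
  have hm := wMinus_nonneg (w j)
  have h1 : wMinus (w j) ^ δ ≤ K ^ (δ / 2) * (n : ℝ) ^ (δ / 2) := by
    rw [← Real.mul_rpow hK0.le hn'.le]
    calc wMinus (w j) ^ δ = (wMinus (w j) ^ 2) ^ (δ / 2) := by
          rw [← Real.rpow_natCast, ← Real.rpow_mul hm]
          congr 1
          push_cast
          ring
      _ ≤ _ := Real.rpow_le_rpow (sq_nonneg _) (wMinus_sq_le hn hK j) (by linarith)
  have h2 : (n : ℝ) ^ (δ / 2) * (n : ℝ) ^ (-δ) = (n : ℝ) ^ (-(δ / 2)) := by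
    rw [← Real.rpow_add hn']
    congr 1
    ring
  rw [Real.rpow_add_of_nonneg hm zero_le_one hδ.le, Real.rpow_one, mul_assoc]
  refine mul_le_mul_of_nonneg_left ?_ hm
  rw [← h2, ← mul_assoc]
  exact mul_le_mul_of_nonneg_right h1 (Real.rpow_nonneg hn'.le _)

/-- The factor `1 + W⁻` serves the uniform root and the later vertices, whose law is biased by `W⁻`,
at once. Every product of weights that arises is dominated by `typeMoment`, and the powers of `n`
with exponents `-η`, `-δ/2`, `-δ` and `-1` are all at most `n ^ (-γ)`. -/
lemma one_add_wMinus_mul_mismatchBound_le (hθ : 0 < θ) (hδ : 0 < δ) (hδ1 : δ ≤ 1) (hη1 : η ≤ 1)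
    (hn : 0 < n) (hK0 : 0 < K) (hK : (∑ i, typeMoment δ (w i)) / n ≤ K) (j : Fin n) :
    (1 + wMinus (w j)) * mismatchBound θ δ η w j ≤
      mismatchConst θ δ K * (n : ℝ) ^ (-(min (δ / 2) η)) * typeMoment δ (w j) := by
  have hn' : (0 : ℝ) < n := by exact_mod_cast hn
  set m := wMinus (w j) with hm_def
  set p := wPlus (w j) with hp_def
  set T := typeMoment δ (w j) with hT
  set L := (n : ℝ) ^ (-(min (δ / 2) η)) with hL
  set b := θ ^ (-(1 + δ)) with hb_def
  have hm : 0 ≤ m := wMinus_nonneg _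
  have hp : 0 ≤ p := wPlus_nonneg _
  have hp' : 0 ≤ p ^ (1 + δ) := Real.rpow_nonneg hp _
  have hL0 : 0 ≤ L := Real.rpow_nonneg hn'.le _
  have hb : 0 ≤ b := Real.rpow_nonneg hθ.le _
  have hKd : 0 ≤ K ^ (δ / 2) := Real.rpow_nonneg hK0.le _
  have hLη : (n : ℝ) ^ (-η) ≤ L := rpow_neg_le_of_le hn (min_le_right _ _)
  have hLδ2 : (n : ℝ) ^ (-(δ / 2)) ≤ L := rpow_neg_le_of_le hn (min_le_left _ _)
  have hLδ : (n : ℝ) ^ (-δ) ≤ L :=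
    rpow_neg_le_of_le hn ((min_le_left _ _).trans (by linarith))
  have hL1 : 1 / (n : ℝ) ≤ L := by
    rw [one_div, ← Real.rpow_neg_one]
    exact rpow_neg_le_of_le hn ((min_le_right _ _).trans hη1)
  have ha1 := average_wPlus_le hδ hK
  have ha2 := average_wPlus_rpow_le hK
  have ha3 := average_wMinus_le hK
  have ha4 := average_wMinus_rpow_le hδ hδ1 hK
  have hone : ∀ i, (1 : ℝ) ≤ 1 + wPlus (w i) ^ (1 + δ) := fun i =>
    le_add_of_nonneg_right (Real.rpow_nonneg (wPlus_nonneg _) _)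
  have hs : ∀ {f : Fin n → ℝ}, (∀ i, 0 ≤ f i) → 0 ≤ (∑ i, f i) / n := fun hf =>
    div_nonneg (Finset.sum_nonneg fun i _ => hf i) hn'.le
  have hb1 : (1 + m) * m ≤ 2 * T := by
    simpa using mul_le_typeMoment (δ := δ) (v := w j) (a := (1 + m) * m) (b := 1) (c := 2)
      zero_le_one zero_le_two (by nlinarith [sq_nonneg (m - 1)]) (hone j)
  have hm1 : 1 + m ≤ 2 * (1 + m ^ 2) := by nlinarith [sq_nonneg (m - 1)]
  have hb2 : (1 + m) * p ≤ 2 * T :=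
    mul_le_typeMoment hp zero_le_two hm1 (wPlus_le_one_add_rpow hδ _)
  have hb3 : (1 + m) * p ^ (1 + δ) ≤ 2 * T :=
    mul_le_typeMoment hp' zero_le_two hm1 (by linarith)
  have hb4 : (1 + m) * m * p ≤ 2 * T :=
    mul_le_typeMoment hp zero_le_two (by nlinarith [sq_nonneg (m - 1)])
      (wPlus_le_one_add_rpow hδ _)
  have hone_m : 0 ≤ 1 + m := by linarith
  have hT0 : 0 ≤ T := typeMoment_nonneg _
  have e1 : m * ((∑ t, wPlus (w t)) / n) / θ * (n : ℝ) ^ (-η) ≤ m * K / θ * L := by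
    gcongr
  have e2 : b * (m ^ (1 + δ) * (n : ℝ) ^ (-δ)) * ((∑ t, wPlus (w t) ^ (1 + δ)) / n) ≤
      b * (m * (K ^ (δ / 2) * L)) * K := by
    refine mul_le_mul (mul_le_mul_of_nonneg_left ((wMinus_rpow_mul_le hδ hn hK0 hK j).trans ?_) hb)
      ha2 (hs fun i => Real.rpow_nonneg (wPlus_nonneg _) _) (by positivity)
    gcongr
  have e3 : p * ((∑ t, wMinus (w t)) / n) / θ * (n : ℝ) ^ (-η) ≤ p * K / θ * L := by
    gcongr
  have e4 : b * (p ^ (1 + δ) * (n : ℝ) ^ (-δ)) * ((∑ t, wMinus (w t) ^ (1 + δ)) / n) ≤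
      b * (p ^ (1 + δ) * L) * K := by
    refine mul_le_mul ?_ ha4 (hs fun i => Real.rpow_nonneg (wMinus_nonneg _) _) (by positivity)
    gcongr
  have e5 : qRate θ w j j ≤ m * p / θ * L := by
    have : qRate θ w j j = m * p / θ * (1 / n) := by
      rw [qRate, ← hm_def, ← hp_def]
      field_simp
    rw [this]
    gcongr
  have hmain : mismatchBound θ δ η w j ≤ (K / θ * m + 2 * b * K ^ (δ / 2) * K * m + K / θ * p +
      2 * b * K * p ^ (1 + δ) + 1 / θ * (m * p)) * L := by
    rw [mismatchBound, Finset.sum_add_distrib, Finset.sum_add_distrib, ← Finset.mul_sum,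
      ← Finset.mul_sum, ← Finset.sum_mul, ← Finset.sum_mul, sum_qRate_left, sum_qRate_right,
      sum_qRate_rpow_left hθ hn, sum_qRate_rpow_right hθ hn]
    refine (add_le_add (add_le_add (add_le_add e1 (mul_le_mul_of_nonneg_left e2 zero_le_two))
      (add_le_add e3 (mul_le_mul_of_nonneg_left e4 zero_le_two))) e5).trans (le_of_eq ?_)
    ring
  calc (1 + m) * mismatchBound θ δ η w j ≤ (1 + m) * ((K / θ * m + 2 * b * K ^ (δ / 2) * K * m +
        K / θ * p + 2 * b * K * p ^ (1 + δ) + 1 / θ * (m * p)) * L) :=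
        mul_le_mul_of_nonneg_left hmain hone_m
    _ = (K / θ * ((1 + m) * m) + 2 * b * K ^ (δ / 2) * K * ((1 + m) * m) + K / θ * ((1 + m) * p) +
        2 * b * K * ((1 + m) * p ^ (1 + δ)) + 1 / θ * ((1 + m) * m * p)) * L := by ring
    _ ≤ (K / θ * (2 * T) + 2 * b * K ^ (δ / 2) * K * (2 * T) + K / θ * (2 * T) +
        2 * b * K * (2 * T) + 1 / θ * (2 * T)) * L := by gcongr
    _ = mismatchConst θ δ K * L * T := by
        rw [mismatchConst, ← hb_def]
        ring

end Averages

/-! ### The conditional probability of a defect in terms of the error expression -/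

section ErrorBound

variable {n : ℕ} {w : Fin n → VertexType} {θ δ η K c₀ x : ℝ} {φ : EdgeCorrection}

/-- The factor `1 + K / (θ c₀)`. -/
noncomputable def growthConst (θ K c₀ : ℝ) : ℝ := 1 + K / (θ * c₀)

/-- The constant in the bound for the probability of a collision. -/
noncomputable def collisionConst (θ δ K c₀ : ℝ) : ℝ :=
  2 * (K * growthConst θ K c₀ / θ) + K * (K / θ ^ 2) +
    (K / θ * (K * growthConst θ K c₀) + (K / θ) ^ 2 * K) * (K * K ^ (1 - δ) / θ ^ 2)

/-- The constant in the bound for the conditional probability of a defect. -/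
noncomputable def defectConst (θ δ K c₀ : ℝ) : ℝ :=
  K + growthConst θ K c₀ * (1 + mismatchConst θ δ K * K) +
    collisionConst θ δ K c₀ * (1 + K / θ + 1 / c₀)

lemma growthConst_nonneg (hθ : 0 < θ) (hK0 : 0 < K) (hc₀ : 0 < c₀) : 0 ≤ growthConst θ K c₀ := by
  rw [growthConst]
  positivity

lemma collisionConst_nonneg (hθ : 0 < θ) (hK0 : 0 < K) (hc₀ : 0 < c₀) :
    0 ≤ collisionConst θ δ K c₀ := by
  have h1 := growthConst_nonneg hθ hK0 hc₀
  have h2 : 0 ≤ K ^ (1 - δ) := Real.rpow_nonneg hK0.le _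
  rw [collisionConst]
  positivity

lemma muMean_le (hθ : 0 < θ) (hδ : 0 < δ) (hK : (∑ i, typeMoment δ (w i)) / n ≤ K) :
    muMean θ w ≤ K / θ := by
  have h : (∑ t, wPlus (w t) * wMinus (w t)) / n ≤ K := by
    simpa using average_le_of_le_typeMoment hK zero_le_one fun i => by
      rw [mul_comm]
      exact mul_le_typeMoment (δ := δ) (v := w i) (c := 1) (wPlus_nonneg (w i))
        zero_le_one (by nlinarith [sq_nonneg (wMinus (w i) - 1)]) (wPlus_le_one_add_rpow hδ _)
  rw [muMean, mul_inv, mul_assoc, inv_mul_eq_div, inv_mul_eq_div]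
  exact div_le_div_of_nonneg_right h hθ.le

/-- The square of `W⁺` is `(W⁺)^(1+δ) (W⁺)^(1-δ)`; the second factor is bounded by `(K n)^(1-δ)`,
the first is averaged. -/
lemma sum_wPlus_mul_self_le (hθ : 0 < θ) (hδ : 0 < δ) (hδ1 : δ ≤ 1) (hn : 0 < n) (hK0 : 0 < K)
    (hK : (∑ i, typeMoment δ (w i)) / n ≤ K) :
    (∑ t, wPlus (w t) * wPlus (w t)) / (θ * n) ^ 2 ≤
      K * K ^ (1 - δ) / θ ^ 2 * (n : ℝ) ^ (-δ) := by
  have hn' : (0 : ℝ) < n := by exact_mod_cast hn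
  have h1 : ∀ t, wPlus (w t) * wPlus (w t) ≤
      wPlus (w t) ^ (1 + δ) * (K ^ (1 - δ) * (n : ℝ) ^ (1 - δ)) := by
    intro t
    have hp := wPlus_nonneg (w t)
    have e : wPlus (w t) * wPlus (w t) = wPlus (w t) ^ (1 + δ) * wPlus (w t) ^ (1 - δ) := by
      rw [← Real.rpow_add_of_nonneg hp (by linarith) (by linarith),
        show 1 + δ + (1 - δ) = (2 : ℝ) by ring, Real.rpow_two, sq]
    rw [e, ← Real.mul_rpow hK0.le hn'.le]
    exact mul_le_mul_of_nonneg_left (Real.rpow_le_rpow hp (wPlus_le hδ hn hK t) (by linarith))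
      (Real.rpow_nonneg hp _)
  have h2 := (Finset.sum_le_sum fun t (_ : t ∈ Finset.univ) => h1 t)
  rw [← Finset.sum_mul] at h2
  have h3 := average_wPlus_rpow_le hK
  rw [div_le_iff₀ hn'] at h3
  have hKd : 0 ≤ K ^ (1 - δ) := Real.rpow_nonneg hK0.le _
  have hnd : 0 ≤ (n : ℝ) ^ (1 - δ) := Real.rpow_nonneg hn'.le _
  have h4 : ∑ t, wPlus (w t) * wPlus (w t) ≤ K * n * (K ^ (1 - δ) * (n : ℝ) ^ (1 - δ)) :=
    h2.trans (mul_le_mul_of_nonneg_right h3 (by positivity))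
  rw [div_le_iff₀ (by positivity)]
  refine h4.trans (le_of_eq ?_)
  have e : (n : ℝ) ^ (1 - δ) = n * (n : ℝ) ^ (-δ) := by
    rw [sub_eq_add_neg, Real.rpow_add hn', Real.rpow_one]
  rw [e]
  field_simp

/-- A weighted average that the growth bound needs. -/
lemma average_mul_le_growthConst (hθ : 0 < θ) (hδ : 0 < δ) (hK0 : 0 < K) (hc₀ : 0 < c₀)
    (hμ : c₀ ≤ muMean θ w) (hK : (∑ i, typeMoment δ (w i)) / n ≤ K) {f : Fin n → ℝ} {A : ℝ}
    (hA : 0 ≤ A) (hf0 : ∀ i, 0 ≤ f i) (hf : (∑ j, wMinus (w j) * f j) / n ≤ A) :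
    (∑ i, wPlus (w i)) / n * ((∑ j, wMinus (w j) * f j) / (θ * n)) ≤
      A * growthConst θ K c₀ * muMean θ w := by
  have h1 : (∑ j, wMinus (w j) * f j) / (θ * n) ≤ A / θ := by
    rw [mul_comm, ← div_div]
    exact div_le_div_of_nonneg_right hf hθ.le
  have h2 : 0 ≤ (∑ j, wMinus (w j) * f j) / (θ * n) :=
    div_nonneg (Finset.sum_nonneg fun i _ => mul_nonneg (wMinus_nonneg _) (hf0 i)) (by positivity)
  calc (∑ i, wPlus (w i)) / n * ((∑ j, wMinus (w j) * f j) / (θ * n)) ≤ K * (A / θ) :=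
        mul_le_mul (average_wPlus_le hδ hK) h1 h2 hK0.le
    -- The added `A * c₀` completes the sum to `A * growthConst θ K c₀ * c₀`; the lower bound `c₀`
    -- supplies the missing factor `μ_n`.
    _ ≤ A * c₀ + K * (A / θ) := le_add_of_nonneg_left (by positivity)
    _ = A * growthConst θ K c₀ * c₀ := by
        rw [growthConst]
        field_simp
    _ ≤ _ := mul_le_mul_of_nonneg_left hμ (mul_nonneg hA (growthConst_nonneg hθ hK0 hc₀))

lemma le_mul_growthConst (hθ : 0 < θ) (hK0 : 0 < K) (hc₀ : 0 < c₀) {a A : ℝ} (hA : 0 ≤ A)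
    (h : a ≤ A) : a ≤ A * growthConst θ K c₀ :=
  h.trans (le_mul_of_one_le_right hA (by
    rw [growthConst]
    exact le_add_of_nonneg_right (by positivity)))

/-- The probability of a mismatch at a good vertex. -/
lemma mismatch_rate_le (hθ : 0 < θ) (hδ1 : δ ≤ 1) (hη : 0 < η) (hn : 0 < n) (j : Fin n)
    (hj : GoodVertex θ φ η w j) :
    ∑ t, ind (j ≠ t) * (edgeLaw θ φ w (j, t)).real {b | b.2 = true} +
      ∑ i, ind (i ≠ j) * (edgeLaw θ φ w (i, j)).real {b | b.2 = true} +
      wMinus (w j) * wPlus (w j) / (θ * n) ≤ mismatchBound θ δ η w j := by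
  have hε : (n : ℝ) ^ (-η) ≤ 1 :=
    Real.rpow_le_one_of_one_le_of_nonpos (by exact_mod_cast hn) (by linarith)
  have key : ∀ i t, qRate θ w i t ≤ 1 / 4 → (i ≠ t → |phiTerm φ w i t| ≤ (n : ℝ) ^ (-η)) →
      ind (i ≠ t) * (edgeLaw θ φ w (i, t)).real {b | b.2 = true} ≤
        qRate θ w i t * (n : ℝ) ^ (-η) + 2 * qRate θ w i t ^ (1 + δ) := by
    intro i t hq hφ
    have hq0 : 0 ≤ qRate θ w i t := qRate_nonneg hθ _ _
    have hr : 0 ≤ qRate θ w i t ^ (1 + δ) := Real.rpow_nonneg hq0 _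
    by_cases hne : i ≠ t
    · rw [ind_of hne, one_mul]
      refine (edgeLaw_real_mismatch_le (e := (i, t)) hθ hε hq (hφ hne)).trans ?_
      refine add_le_add le_rfl (mul_le_mul_of_nonneg_left ?_ zero_le_two)
      -- Since `q ≤ 1/4` and `δ ≤ 1`, the square is at most `q ^ (1 + δ)`, which has finite mean.
      change qRate θ w i t ^ 2 ≤ _
      rcases hq0.eq_or_lt with h0 | h0
      · rw [← h0]
        simpa using Real.rpow_nonneg le_rfl (1 + δ)
      · rw [← Real.rpow_two]
        exact Real.rpow_le_rpow_of_exponent_ge h0 (by linarith) (by linarith)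
    · rw [ind_of_not hne, zero_mul]
      have : 0 ≤ (n : ℝ) ^ (-η) := Real.rpow_nonneg (Nat.cast_nonneg n) _
      positivity
  refine add_le_add (add_le_add (Finset.sum_le_sum fun t _ => ?_)
    (Finset.sum_le_sum fun i _ => ?_)) le_rfl
  · exact key j t (hj.2.2 t) fun h => hj.2.1 t h.symm
  · exact key i j (hj.1.2 i) fun h => hj.1.1 i h

/-- Collisions other than common targets have rate of order `1 / n`, which is at most `n ^ (-δ)`
because `δ ≤ 1`; common targets have rate `n ^ (-δ)` by `sum_wPlus_mul_self_le`. -/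
lemma collision_rate_le (hθ : 0 < θ) (hδ : 0 < δ) (hδ1 : δ ≤ 1) (hn : 0 < n) (hK0 : 0 < K)
    (hc₀ : 0 < c₀) (hK : (∑ i, typeMoment δ (w i)) / n ≤ K) :
    2 * (K * growthConst θ K c₀ / (θ * n)) +
      (∑ i, wPlus (w i)) / n * ((∑ j, wMinus (w j) * wMinus (w j)) / (θ * n) / (θ * n)) +
      ((∑ j, wMinus (w j) * wMinus (w j)) / (θ * n) * (K * growthConst θ K c₀) +
        ((∑ j, wMinus (w j) * wMinus (w j)) / (θ * n)) ^ 2 * ((∑ i, wPlus (w i)) / n)) *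
      ((∑ t, wPlus (w t) * wPlus (w t)) / (θ * n) ^ 2) ≤
      collisionConst θ δ K c₀ * (n : ℝ) ^ (-δ) := by
  have hn' : (0 : ℝ) < n := by exact_mod_cast hn
  have hD := growthConst_nonneg hθ hK0 hc₀
  have hinv : 1 / (n : ℝ) ≤ (n : ℝ) ^ (-δ) := by
    rw [one_div, ← Real.rpow_neg_one]
    exact rpow_neg_le_of_le hn hδ1
  have hp0 : 0 ≤ (∑ i, wPlus (w i)) / n :=
    div_nonneg (Finset.sum_nonneg fun i _ => wPlus_nonneg _) hn'.le
  have hp := average_wPlus_le hδ hK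
  have hs := sum_wPlus_mul_self_le hθ hδ hδ1 hn hK0 hK
  have hs0 : 0 ≤ (∑ t, wPlus (w t) * wPlus (w t)) / (θ * n) ^ 2 :=
    div_nonneg (Finset.sum_nonneg fun i _ => mul_self_nonneg _) (by positivity)
  have ha0 : 0 ≤ (∑ j, wMinus (w j) * wMinus (w j)) / (θ * n) :=
    div_nonneg (Finset.sum_nonneg fun i _ => mul_self_nonneg _) (by positivity)
  have ha : (∑ j, wMinus (w j) * wMinus (w j)) / (θ * n) ≤ K / θ := by
    rw [mul_comm θ, ← div_div]
    exact div_le_div_of_nonneg_right (average_wMinus_mul_self_le hK) hθ.le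
  set a := (∑ j, wMinus (w j) * wMinus (w j)) / (θ * n)
  set s := (∑ t, wPlus (w t) * wPlus (w t)) / (θ * n) ^ 2
  set pb := (∑ i, wPlus (w i)) / n
  set D := growthConst θ K c₀
  set ε := (n : ℝ) ^ (-δ)
  have e1 : 2 * (K * D / (θ * n)) ≤ 2 * (K * D / θ) * ε := by
    calc 2 * (K * D / (θ * n)) = 2 * (K * D / θ) * (1 / n) := by field_simp
      _ ≤ _ := by gcongr
  have e2 : pb * (a / (θ * n)) ≤ K * (K / θ ^ 2) * ε := by
    calc pb * (a / (θ * n)) ≤ K * (K / θ / (θ * n)) := by gcongr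
      _ = K * (K / θ ^ 2) * (1 / n) := by field_simp
      _ ≤ _ := by gcongr
  have e3 : (a * (K * D) + a ^ 2 * pb) * s ≤
      (K / θ * (K * D) + (K / θ) ^ 2 * K) * (K * K ^ (1 - δ) / θ ^ 2 * ε) := by gcongr
  rw [collisionConst]
  linarith

/-- The conditional expected number of defects is controlled by the error expression. -/
theorem expect_defects_le_couplingError (hθ : 0 < θ) (hδ : 0 < δ) (hδ1 : δ ≤ 1) (hη : 0 < η)
    (hη1 : η ≤ 1) (hn : 0 < n) (hK0 : 0 < K) (hc₀ : 0 < c₀) (hx : 0 < x) {k : ℕ} (hk : 1 ≤ k)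
    (hK : (∑ i, typeMoment δ (w i)) / n ≤ K) (hμ : c₀ ≤ muMean θ w) :
    expect (edgeLaw θ φ w) (fun ξ c =>
      ind (¬ okBefore (fun i => wPlus (w i)) (GoodVertex θ φ η w) x (muMean θ w) (k + 1) ξ c) +
      ∑ r ∈ Finset.range (k + 1),
        ind (okBefore (fun i => wPlus (w i)) (GoodVertex θ φ η w) x (muMean θ w) (r + 1) ξ c) *
        defectCount (fun i => wMinus (w i)) (fun i => wPlus (w i)) (θ * n) r ξ c) ≤
      defectConst θ δ K c₀ * (1 / x + couplingError θ φ δ η k x w) := by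
  classical
  have hn' : (0 : ℝ) < n := by exact_mod_cast hn
  have hμ0 : 0 < muMean θ w := hc₀.trans_le hμ
  have hD := growthConst_nonneg hθ hK0 hc₀
  have hM : 0 ≤ mismatchConst θ δ K := mismatchConst_nonneg hθ hK0
  have hCC : 0 ≤ collisionConst θ δ K c₀ := collisionConst_nonneg hθ hK0 hc₀
  set L := (n : ℝ) ^ (-(min (δ / 2) η)) with hL_def
  have hL : 0 ≤ L := Real.rpow_nonneg hn'.le _
  set b := (n : ℝ)⁻¹ * ∑ i, if ¬ EventB θ φ η w i ∨ ¬ EventBTilde θ φ η w i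
    then max (wMinus (w i)) 1 else 0 with hb_def
  have hbad : ∀ i, (¬ EventB θ φ η w i ∨ ¬ EventBTilde θ φ η w i) ↔ ¬ GoodVertex θ φ η w i :=
    fun i => not_and_or.symm
  have hb0 : 0 ≤ b := by
    refine mul_nonneg (by positivity) (Finset.sum_nonneg fun i _ => ?_)
    split_ifs
    · exact zero_le_one.trans (le_max_right _ _)
    · exact le_rfl
  have hb1 : (∑ i, ind (¬ GoodVertex θ φ η w i)) / n ≤ b := by
    rw [hb_def, div_eq_inv_mul]
    refine mul_le_mul_of_nonneg_left (Finset.sum_le_sum fun i _ => ?_) (by positivity)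
    by_cases h : GoodVertex θ φ η w i <;> simp [hbad, ind, h]
  have hb2 : (∑ j, wMinus (w j) * ind (¬ GoodVertex θ φ η w j)) / n ≤ b := by
    rw [hb_def, div_eq_inv_mul]
    refine mul_le_mul_of_nonneg_left (Finset.sum_le_sum fun i _ => ?_) (by positivity)
    by_cases h : GoodVertex θ φ η w i <;> simp [hbad, ind, h]
  have hh0 : ∀ j, 0 ≤ mismatchBound θ δ η w j := fun j => mismatchBound_nonneg hθ j
  have hA : 0 ≤ mismatchConst θ δ K * L * K := mul_nonneg (mul_nonneg hM hL) hK0.le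
  have hh : ∀ j, (1 + wMinus (w j)) * mismatchBound θ δ η w j ≤
      mismatchConst θ δ K * L * typeMoment δ (w j) :=
    one_add_wMinus_mul_mismatchBound_le hθ hδ hδ1 hη1 hn hK0 hK
  have hA1 : (∑ i, mismatchBound θ δ η w i) / n ≤ mismatchConst θ δ K * L * K :=
    average_le_of_le_typeMoment hK (mul_nonneg hM hL) fun i =>
      (le_mul_of_one_le_left (hh0 i) (le_add_of_nonneg_right (wMinus_nonneg _))).trans (hh i)
  have hA2 : (∑ i, wMinus (w i) * mismatchBound θ δ η w i) / n ≤ mismatchConst θ δ K * L * K :=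
    average_le_of_le_typeMoment hK (mul_nonneg hM hL) fun i =>
      (mul_le_mul_of_nonneg_right (le_add_of_nonneg_left zero_le_one) (hh0 i)).trans (hh i)
  have hμ_eq : (∑ j, wMinus (w j) * wPlus (w j)) / (θ * n) = muMean θ w := by
    rw [muMean, div_eq_inv_mul]
    simp only [mul_comm]
  have hmain := expect_defects_le (ρ := edgeLaw θ φ w) (m := fun i => wMinus (w i))
    (p := fun i => wPlus (w i)) (N := θ * n) (x := x) (good := GoodVertex θ φ η w)
    (h := mismatchBound θ δ η w) (fun i => wMinus_nonneg _) (fun i => wPlus_nonneg _)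
    (mul_pos hθ hn') hx hμ_eq hμ0 (fun j t => edgeLaw_real_edge_le hθ (j, t)) hh0
    (fun j hj => mismatch_rate_le hθ hδ1 hη hn j hj)
    (le_mul_growthConst hθ hK0 hc₀ hK0.le (average_wMinus_le hK))
    (average_mul_le_growthConst hθ hδ hK0 hc₀ hμ hK hK0.le (fun i => wMinus_nonneg _)
      (average_wMinus_mul_self_le hK))
    (le_mul_growthConst hθ hK0 hc₀ hA hA1)
    (average_mul_le_growthConst hθ hδ hK0 hc₀ hμ hK hA hh0 hA2)
    (le_mul_growthConst hθ hK0 hc₀ hb0 hb1)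
    (average_mul_le_growthConst hθ hδ hK0 hc₀ hμ hK hb0 (fun i => ind_nonneg _) hb2) k
  refine hmain.trans ?_
  have hpow := sum_pow_mul_sum_pow_le hc₀ hμ (muMean_le hθ hδ hK) hk
  have hcoef := collision_rate_le hθ hδ hδ1 hn hK0 hc₀ hK
  have hp := average_wPlus_le hδ hK
  have hS0 : 0 ≤ ∑ r ∈ Finset.range (k + 1), muMean θ w ^ r *
      ∑ l ∈ Finset.range (r + 1), muMean θ w ^ l :=
    Finset.sum_nonneg fun r _ => mul_nonneg (pow_nonneg hμ0.le _)
      (Finset.sum_nonneg fun l _ => pow_nonneg hμ0.le _)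
  have hF0 : 0 ≤ ∑ r ∈ Finset.range (k + 1), muMean θ w ^ r :=
    Finset.sum_nonneg fun r _ => pow_nonneg hμ0.le _
  have hT0 : 0 ≤ ∑ m ∈ Finset.Icc 1 k, ∑ r ∈ Finset.range m, muMean θ w ^ (m + r) :=
    Finset.sum_nonneg fun m _ => Finset.sum_nonneg fun r _ => pow_nonneg hμ0.le _
  have hε : 0 ≤ (n : ℝ) ^ (-δ) := Real.rpow_nonneg hn'.le _
  rw [couplingError, ← hL_def, ← hb_def]
  generalize (∑ r ∈ Finset.range (k + 1), muMean θ w ^ r *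
    ∑ l ∈ Finset.range (r + 1), muMean θ w ^ l) = S2 at *
  generalize (∑ r ∈ Finset.range (k + 1), muMean θ w ^ r) = F at *
  generalize (∑ m ∈ Finset.Icc 1 k, ∑ r ∈ Finset.range m, muMean θ w ^ (m + r)) = S at *
  generalize (n : ℝ) ^ (-δ) = ε at *
  have hG : 0 ≤ 1 + K / θ + 1 / c₀ := by positivity
  have t1 : (∑ i, wPlus (w i)) / n / x ≤ K * (1 / x) := by
    rw [mul_one_div]
    exact div_le_div_of_nonneg_right hp hx.le
  have t2 : (b * growthConst θ K c₀ + mismatchConst θ δ K * L * K * growthConst θ K c₀) * F ≤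
      growthConst θ K c₀ * (1 + mismatchConst θ δ K * K) * ((L + b) * F) := by
    rw [← mul_assoc]
    refine mul_le_mul_of_nonneg_right ?_ hF0
    have h1 : 0 ≤ growthConst θ K c₀ * L := mul_nonneg hD hL
    have h2 : 0 ≤ growthConst θ K c₀ * (mismatchConst θ δ K * K * b) :=
      mul_nonneg hD (mul_nonneg (mul_nonneg hM hK0.le) hb0)
    linarith
  have t3 := mul_le_mul hcoef (mul_le_mul_of_nonneg_left hpow hx.le) (mul_nonneg hx.le hS0)
    (mul_nonneg hCC hε)
  have hX1 : 0 ≤ 1 / x := by positivity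
  have hX2 : 0 ≤ (L + b) * F := mul_nonneg (add_nonneg hL hb0) hF0
  have hX3 : 0 ≤ ε * x * S := mul_nonneg (mul_nonneg hε hx.le) hT0
  have c2 : 0 ≤ growthConst θ K c₀ * (1 + mismatchConst θ δ K * K) :=
    mul_nonneg hD (add_nonneg zero_le_one (mul_nonneg hM hK0.le))
  have c3 : 0 ≤ collisionConst θ δ K c₀ * (1 + K / θ + 1 / c₀) := mul_nonneg hCC hG
  refine (add_le_add (add_le_add t1 t2) t3).trans ?_
  rw [defectConst]
  -- What is left is `K X1 + C2 X2 + C3 X3 ≤ (K + C2 + C3)(X1 + X2 + X3)` with nonnegative entries.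
  generalize growthConst θ K c₀ * (1 + mismatchConst θ δ K * K) = C2 at *
  rw [show collisionConst θ δ K c₀ * ε * (x * ((1 + K / θ + 1 / c₀) * S)) =
    collisionConst θ δ K c₀ * (1 + K / θ + 1 / c₀) * (ε * x * S) by ring]
  generalize collisionConst θ δ K c₀ * (1 + K / θ + 1 / c₀) = C3 at *
  generalize ε * x * S = X3 at *
  generalize (L + b) * F = X2 at *
  generalize 1 / x = X1 at *
  nlinarith [mul_nonneg c2 hX1, mul_nonneg c3 hX1, mul_nonneg hK0.le hX2, mul_nonneg c3 hX2,
    mul_nonneg hK0.le hX3, mul_nonneg c2 hX3]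

lemma seedLaw_badSeeds_le_couplingError (hθ : 0 < θ) (hδ : 0 < δ) (hδ1 : δ ≤ 1) (hη : 0 < η)
    (hη1 : η ≤ 1) (hn : 0 < n) (hK0 : 0 < K) (hc₀ : 0 < c₀) (hx : 0 < x) {k : ℕ} (hk : 1 ≤ k)
    (hK : (∑ i, typeMoment δ (w i)) / n ≤ K) (hμ : c₀ ≤ muMean θ w) :
    seedLaw n (badSeeds θ φ η x w k) ≤
      ENNReal.ofReal (defectConst θ δ K c₀ * (1 / x + couplingError θ φ δ η k x w)) :=
  (seedLaw_badSeeds_le hθ hn k).trans (ENNReal.ofReal_le_ofReal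
    (expect_defects_le_couplingError hθ hδ hδ1 hη hη1 hn hK0 hc₀ hx hk hK hμ))

end ErrorBound

/-! ### Measurability in the types -/

section Measurability

variable {n : ℕ} {θ : ℝ} {φ : EdgeCorrection} {η x : ℝ} {α : Type*} [MeasurableSpace α]

lemma measurable_wPlus : Measurable wPlus := measurable_fst.coe_nnreal_real

lemma measurable_wMinus : Measurable wMinus := (measurable_fst.comp measurable_snd).coe_nnreal_real

lemma measurable_qRate (i j : Fin n) : Measurable fun w : Fin n → VertexType => qRate θ w i j :=
  ((measurable_wMinus.comp (measurable_pi_apply i)).mul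
    (measurable_wPlus.comp (measurable_pi_apply j))).div_const _

lemma measurable_phiTerm (hφ : Measurable
      fun y : VertexType × VertexType × (Fin n → VertexType) => φ n y.1 y.2.1 y.2.2)
    (i j : Fin n) : Measurable fun w : Fin n → VertexType => phiTerm φ w i j := by
  have h : Measurable fun w : Fin n → VertexType => (w i, w j, w) := by fun_prop
  exact hφ.comp h

lemma measurable_edgeProb (hφ : Measurable
      fun y : VertexType × VertexType × (Fin n → VertexType) => φ n y.1 y.2.1 y.2.2)
    (i j : Fin n) : Measurable fun w : Fin n → VertexType => edgeProb θ φ w i j :=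
  measurable_const.min ((measurable_qRate i j).mul
    (measurable_const.add (measurable_phiTerm hφ i j)))

lemma measurable_muMean : Measurable fun w : Fin n → VertexType => muMean θ w :=
  measurable_const.mul (Finset.measurable_fun_sum _ fun i _ =>
    (measurable_wPlus.comp (measurable_pi_apply i)).mul
      (measurable_wMinus.comp (measurable_pi_apply i)))

lemma measurable_edgeStates_seed (hφ : Measurable
      fun y : VertexType × VertexType × (Fin n → VertexType) => φ n y.1 y.2.1 y.2.2) :
    Measurable fun y : (Fin n → VertexType) × Seed n => edgeStates θ φ y.1 y.2.2.1 := by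
  refine measurable_pi_lambda _ fun e => ?_
  refine measurable_edgeStateOf_comp ((measurable_qRate _ _).comp measurable_fst)
    ((measurable_edgeProb hφ _ _).comp measurable_fst) ?_
  exact measurable_subtype_coe.comp ((measurable_pi_apply e).comp
    (measurable_fst.comp (measurable_snd.comp measurable_snd)))

lemma measurable_goodVertex (hφ : Measurable
      fun y : VertexType × VertexType × (Fin n → VertexType) => φ n y.1 y.2.1 y.2.2)
    (i : Fin n) : Measurable fun w : Fin n → VertexType => GoodVertex θ φ η w i := by
  have hle : ∀ {f : (Fin n → VertexType) → ℝ} {a : ℝ}, Measurable f →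
      Measurable fun w => f w ≤ a := fun hf =>
    measurableSet_setOfPred.1 (measurableSet_le hf measurable_const)
  have hp : ∀ a b : Fin n, Measurable fun w : Fin n → VertexType =>
      |phiTerm φ w a b| ≤ (n : ℝ) ^ (-η) := fun a b => hle (measurable_phiTerm hφ a b).abs
  have hq : ∀ a b : Fin n, Measurable fun w : Fin n → VertexType => qRate θ w a b ≤ 1 / 4 :=
    fun a b => hle (measurable_qRate a b)
  refine Measurable.and (Measurable.and ?_ ?_) (Measurable.and ?_ ?_)
  · exact Measurable.forall fun j => Measurable.imp measurable_const (hp j i)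
  · exact Measurable.forall fun j => hq j i
  · exact Measurable.forall fun j => Measurable.imp measurable_const (hp i j)
  · exact Measurable.forall fun j => hq i j

lemma measurable_controlled (hφ : Measurable
      fun y : VertexType × VertexType × (Fin n → VertexType) => φ n y.1 y.2.1 y.2.2)
    (r : ℕ) (ξ : Fin n) (c : EdgeStates n) :
    Measurable fun w : Fin n → VertexType => Controlled θ φ η x w r ξ c := by
  refine Measurable.forall fun l => Measurable.imp measurable_const (Measurable.and ?_ ?_)
  · refine measurableSet_setOfPred.1 (measurableSet_le ?_
      (measurable_const.mul (measurable_muMean.pow_const l)))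
    exact Finset.measurable_fun_sum _ fun i _ => measurable_wPlus.comp (measurable_pi_apply i)
  · exact Measurable.forall fun i => Measurable.imp measurable_const (measurable_goodVertex hφ i)

lemma measurable_mem_starDefect (r : ℕ) (ξ : Fin n) (c : EdgeStates n) :
    Measurable fun y : (Fin n → VertexType) × Seed n =>
      y.2.2.2.2 ∈ starDefect θ y.1 r ξ c := by
  refine Measurable.exists fun j => Measurable.and measurable_const
    (Measurable.exists fun t => Measurable.and measurable_const ?_)
  have hq : Measurable fun y : (Fin n → VertexType) × Seed n => qRate θ y.1 j t :=
    (measurable_qRate j t).comp measurable_fst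
  have hu : Measurable fun y : (Fin n → VertexType) × Seed n =>
      (y.2.2.2.2 (bfsPath (stateEdge c) ξ r j, t) : ℝ) :=
    measurable_subtype_coe.comp ((measurable_pi_apply _).comp
      (measurable_snd.comp (measurable_snd.comp (measurable_snd.comp measurable_snd))))
  exact measurableSet_setOfPred.1 (measurableSet_le measurable_const
    (measurable_poissonQuantile.comp (hq.prodMk hu)))

/-- Splitting by the finitely many values of the root and of the edge states makes the exploration
deterministic; only inequalities between measurable functions remain. -/
lemma measurableSet_badSeeds (hφ : Measurable
      fun y : VertexType × VertexType × (Fin n → VertexType) => φ n y.1 y.2.1 y.2.2) (k : ℕ) :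
    MeasurableSet {y : (Fin n → VertexType) × Seed n | y.2 ∈ badSeeds θ φ η x y.1 k} := by
  have hsplit : {y : (Fin n → VertexType) × Seed n | y.2 ∈ badSeeds θ φ η x y.1 k} =
      ⋃ ξ : Fin n, ⋃ c : EdgeStates n, {y | (y.2.1 = ξ ∧ edgeStates θ φ y.1 y.2.2.1 = c) ∧
        ((¬ Controlled θ φ η x y.1 (k + 1) ξ c ∨ ∃ r, r < k + 1 ∧ EdgeDefect r ξ c) ∨
          ∃ r, r < k + 1 ∧ y.2.2.2.2 ∈ starDefect θ y.1 r ξ c)} := by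
    ext y
    simp only [Set.mem_iUnion, Set.mem_ofPred_eq]
    constructor
    · intro h
      exact ⟨_, _, ⟨rfl, rfl⟩, h⟩
    · rintro ⟨ξ, c, ⟨rfl, rfl⟩, h⟩
      exact h
  rw [hsplit]
  refine MeasurableSet.iUnion fun ξ => MeasurableSet.iUnion fun c => measurableSet_setOfPred.2 ?_
  refine Measurable.and (Measurable.and ?_ ?_)
    (Measurable.or (Measurable.or ?_ measurable_const) ?_)
  · exact measurableSet_setOfPred.1
      ((measurable_fst.comp measurable_snd) (measurableSet_singleton ξ))
  · exact measurableSet_setOfPred.1 ((measurable_edgeStates_seed hφ) (measurableSet_singleton c))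
  · exact ((measurable_controlled hφ (k + 1) ξ c).comp measurable_fst).not
  · exact Measurable.exists fun r => Measurable.and measurable_const
      (measurable_mem_starDefect r ξ c)

end Measurability

/-! ### Averages of i.i.d. types -/

section Limits

variable {Ω : Type*} [MeasurableSpace Ω] {P : Measure Ω}

lemma tendsto_measure_lt_of_tendstoInMeasure {f : ℕ → Ω → ℝ} {a b : ℝ}
    (h : TendstoInMeasure P f atTop fun _ => a) (hab : a < b) :
    Tendsto (fun n => P {ω | b < f n ω}) atTop (𝓝 0) := by
  refine tendsto_of_tendsto_of_tendsto_of_le_of_le tendsto_const_nhds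
    (tendstoInMeasure_iff_dist.1 h (b - a) (sub_pos.2 hab)) (fun _ => zero_le) fun n => ?_
  refine measure_mono fun ω hω => ?_
  have hω' : b < f n ω := hω
  change b - a ≤ dist (f n ω) a
  rw [Real.dist_eq]
  exact (by linarith : b - a ≤ f n ω - a).trans (le_abs_self _)

variable [IsProbabilityMeasure P]

/-- Stated for arbitrary `G`, so that the error expression does not have to be shown measurable. -/
lemma lintegral_le_add_measure_compl {f : Ω → ℝ≥0∞} (hf : ∀ ω, f ω ≤ 1) {G : Set Ω} {a : ℝ≥0∞}
    (h : ∀ ω ∈ G, f ω ≤ a) : ∫⁻ ω, f ω ∂P ≤ a + P Gᶜ := by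
  calc ∫⁻ ω, f ω ∂P ≤ ∫⁻ ω, (a + Gᶜ.indicator 1 ω) ∂P := by
        refine lintegral_mono fun ω => ?_
        by_cases hω : ω ∈ G
        · exact (h ω hω).trans le_self_add
        · refine (hf ω).trans (le_add_left ?_)
          rw [Set.indicator_of_mem (show ω ∈ Gᶜ from hω), Pi.one_apply]
    _ = a + ∫⁻ ω, Gᶜ.indicator 1 ω ∂P := by
        rw [lintegral_add_left measurable_const, lintegral_const, measure_univ, mul_one]
    _ ≤ a + P Gᶜ := by
        gcongr
        exact lintegral_indicator_one_le _

variable {W : ℕ → Ω → VertexType}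

/-- The weak law of large numbers for a function of the types. -/
lemma tendstoInMeasure_average (hWmeas : ∀ i, Measurable (W i)) (hWindep : iIndepFun W P)
    (hWident : ∀ i, IdentDistrib (W i) (W 0) P P) {g : VertexType → ℝ} (hg : Measurable g)
    (hint : Integrable (fun ω => g (W 0 ω)) P) :
    TendstoInMeasure P (fun (n : ℕ) ω => (∑ i : Fin n, g (W i ω)) / n) atTop
      fun _ => ∫ ω, g (W 0 ω) ∂P := by
  have h := strong_law_ae_real (fun i ω => g (W i ω)) hint
    (fun i j hij => (hWindep.indepFun hij).comp hg hg) (fun i => (hWident i).comp hg)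
  refine tendstoInMeasure_of_tendsto_ae (fun n => ?_) ?_
  · exact ((Finset.measurable_fun_sum _ fun (i : Fin n) _ =>
      hg.comp (hWmeas i)).div_const _).aestronglyMeasurable
  · filter_upwards [h] with ω hω
    simpa only [Finset.sum_range] using hω

end Limits

/-! ### The coupling without edges -/

section NoEdges

variable {n : ℕ} {θ : ℝ} {φ : EdgeCorrection} {w : Fin n → VertexType}

/-- The degenerate case, in which `μ_n` has no positive lower bound. With mean 0 the Poisson
distribution function is already 1 at 0, so all quantiles vanish, and the graph has no edges either.
-/
lemma couplingHolds_of_qRate_eq_zero (h : ∀ i j, qRate θ w i j = 0) (s : Seed n) (k : ℕ) :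
    CouplingHolds θ φ w s k := by
  have hquant : ∀ (i j : Fin n) (u : unitInterval), poissonQuantile (qRate θ w i j) u = 0 := by
    intro i j u
    refine poissonQuantile_of_le ?_
    rw [h, neg_zero, Real.exp_zero]
    exact u.2.2
  have hZ : ∀ i j, coupledZ θ w s i j = 0 := fun i j => hquant i j _
  have hE : ∀ i j, ¬ poissonEdge θ w s i j := fun i j => by simp [poissonEdge, hZ]
  have hX : ∀ i j, ¬ IsEdge θ φ w s i j := by
    rintro i j ⟨-, hlt⟩
    rw [edgeProb, h, zero_mul, min_eq_right zero_le_one, sub_zero] at hlt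
    exact absurd (s.2.1 (i, j)).2.2 (not_le.2 hlt)
  have hM : ∀ i j, ¬ Mismatch θ φ w s i j := fun i j => not_not.2 (Or.inr ⟨hX i j, hZ i j⟩)
  exact couplingHolds_of_noDefect fun r _ => ⟨fun j _ t _ _ => hM j t, fun t _ j _ => hM j t,
    fun t _ j _ => hE j t, fun j _ j' _ _ t _ => fun h => hE j t h.1,
    fun t _ t' _ _ j => fun h => hE j t h.1, fun j _ t _ => hquant j t _⟩

end NoEdges

/-! ### From the breaking time to defects and ranks. -/

section Break

variable {n : ℕ} {θ : ℝ} {φ : EdgeCorrection} {w : Fin n → VertexType} {s : Seed n}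

lemma graphRank_eq_treeRank_of_lt_couplingBreak {k : ℕ} (h : ¬ couplingBreak θ φ w s ≤ k) :
    graphRank θ φ w s k = treeRank θ w s k :=
  graphRank_eq_treeRank (couplingHolds_of_lt_couplingBreak h)

lemma mem_badSeeds_of_couplingBreak_le {η x : ℝ} {k : ℕ} (h : couplingBreak θ φ w s ≤ k) :
    s ∈ badSeeds θ φ η x w k := by
  by_contra hs
  exact lt_couplingBreak_of_couplingHolds
    (couplingHolds_of_noDefect (noDefect_of_notMem_badSeeds hs)) h

end Break

lemma seedLaw_le_one (n : ℕ) (S : Set (Seed n)) : seedLaw n S ≤ 1 := by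
  rcases Nat.eq_zero_or_pos n with rfl | hn
  · rw [Set.eq_empty_of_forall_notMem (s := S) fun s _ => s.1.elim0, measure_empty]
    exact zero_le
  · have : Nonempty (Fin n) := ⟨⟨0, hn⟩⟩
    have : IsProbabilityMeasure (uniformOn (Set.univ : Set (Fin n))) :=
      isProbabilityMeasure_uniformOn Set.finite_univ Set.univ_nonempty
    have : IsProbabilityMeasure (seedLaw n) := by
      unfold seedLaw
      infer_instance
    exact prob_le_one

instance (n : ℕ) : SFinite (seedLaw n) := by
  unfold seedLaw
  infer_instance

/-! ### Integrability of the dominating moment. -/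

section Integrability

variable {Ω : Type*} [MeasurableSpace Ω] {P : Measure Ω} [IsProbabilityMeasure P]
  {W : Ω → VertexType} {δ : ℝ}

lemma measurable_typeMoment : Measurable (typeMoment δ) :=
  (measurable_const.add (measurable_wMinus.pow_const 2)).mul
    (measurable_const.add (measurable_wPlus.pow_const (1 + δ)))

/-- Independence of `W⁺` and `W⁻` makes the product of the two separately integrable factors
integrable. -/
lemma integrable_typeMoment (hPlus : Integrable (fun ω => wPlus (W ω) ^ (1 + δ)) P)
    (hMinus : Integrable (fun ω => wMinus (W ω) ^ 2) P)
    (hindep : IndepFun (fun ω => wPlus (W ω)) (fun ω => wMinus (W ω)) P) :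
    Integrable (fun ω => typeMoment δ (W ω)) P := by
  have h := hindep.symm.comp (φ := fun y : ℝ => 1 + y ^ 2) (ψ := fun y : ℝ => 1 + y ^ (1 + δ))
    (by fun_prop) (by fun_prop)
  exact h.integrable_mul ((integrable_const 1).add hMinus) ((integrable_const 1).add hPlus)

end Integrability

/-! ### The probability that the coupling breaks -/

section BreakProbability

variable {Ω : Type*} [MeasurableSpace Ω] {P : Measure Ω}
  {W : ℕ → Ω → VertexType} {φ : EdgeCorrection} {θ δ η : ℝ}

lemma defectConst_nonneg {K c₀ : ℝ} (hθ : 0 < θ) (hK0 : 0 < K) (hc₀ : 0 < c₀) :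
    0 ≤ defectConst θ δ K c₀ := by
  have h1 := growthConst_nonneg hθ hK0 hc₀
  have h2 : 0 ≤ mismatchConst θ δ K := mismatchConst_nonneg hθ hK0
  have h3 : 0 ≤ collisionConst θ δ K c₀ := collisionConst_nonneg hθ hK0 hc₀
  rw [defectConst]
  positivity

lemma measure_couplingBreak_eq_zero {n : ℕ}
    (h : ∀ᵐ ω ∂P, ∀ i j : Fin n, qRate θ (fun v : Fin n => W v ω) i j = 0) (k : ℕ) :
    (P.prod (seedLaw n)) {y | couplingBreak θ φ (fun v : Fin n => W v y.1) y.2 ≤ (k : ℕ∞)} =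
      0 := by
  refine measure_mono_null (t := {ω | ¬ ∀ i j : Fin n,
    qRate θ (fun v : Fin n => W v ω) i j = 0} ×ˢ (Set.univ : Set (Seed n))) ?_ ?_
  · rintro ⟨ω, s⟩ hy
    refine ⟨fun hq => ?_, trivial⟩
    exact lt_couplingBreak_of_couplingHolds (couplingHolds_of_qRate_eq_zero hq s k) hy
  · rw [Measure.prod_prod, ae_iff.1 h, zero_mul]

lemma ae_qRate_eq_zero (hWident : ∀ i, IdentDistrib (W i) (W 0) P P) {g : VertexType → ℝ}
    (hg : Measurable g) (h0 : ∀ᵐ ω ∂P, g (W 0 ω) = 0)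
    (hgq : ∀ v v' : VertexType, g v = 0 → g v' = 0 → wMinus v * wPlus v' = 0) (n : ℕ) :
    ∀ᵐ ω ∂P, ∀ i j : Fin n, qRate θ (fun v : Fin n => W v ω) i j = 0 := by
  have hall : ∀ i, ∀ᵐ ω ∂P, g (W i ω) = 0 := fun i =>
    (hWident i).symm.ae_snd (p := fun v => g v = 0) (hg (measurableSet_singleton 0)) h0
  filter_upwards [ae_all_iff.2 hall] with ω hω i j
  rw [qRate, hgq _ _ (hω i) (hω j), zero_div]

variable [IsProbabilityMeasure P]

/-- The conditional bound is used where the types behave typically; elsewhere the conditional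
probability is bounded by 1. -/
lemma measure_couplingBreak_le (hWmeas : ∀ i, Measurable (W i)) (hθ : 0 < θ) (hδ : 0 < δ)
    (hδ1 : δ ≤ 1) (hη : 0 < η) (hη1 : η ≤ 1) {n : ℕ} (hn : 0 < n)
    (hφ : Measurable fun y : VertexType × VertexType × (Fin n → VertexType) => φ n y.1 y.2.1 y.2.2)
    {K c₀ x ε : ℝ} (hK0 : 0 < K) (hc₀ : 0 < c₀) (hx : 0 < x) {k : ℕ} (hk : 1 ≤ k) :
    (P.prod (seedLaw n)) {y | couplingBreak θ φ (fun v : Fin n => W v y.1) y.2 ≤ (k : ℕ∞)} ≤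
      ENNReal.ofReal (defectConst θ δ K c₀ * (1 / x + ε)) +
      (P {ω | K < (∑ i : Fin n, typeMoment δ (W i ω)) / n} +
        P {ω | muMean θ (fun v : Fin n => W v ω) < c₀} +
        P {ω | ε < couplingError θ φ δ η k x (fun v : Fin n => W v ω)}) := by
  have hw : Measurable fun y : Ω × Seed n => ((fun v : Fin n => W v y.1), y.2) :=
    (measurable_pi_lambda (fun (y : Ω × Seed n) (v : Fin n) => W v y.1)
      fun v => (hWmeas v).comp measurable_fst).prodMk measurable_snd
  have hmeas : MeasurableSet {y : Ω × Seed n |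
      y.2 ∈ badSeeds θ φ η x (fun v : Fin n => W v y.1) k} := hw (measurableSet_badSeeds hφ k)
  -- The breaking event is enlarged to a measurable one, to which the product formula applies.
  refine (measure_mono (t := {y : Ω × Seed n |
      y.2 ∈ badSeeds θ φ η x (fun v : Fin n => W v y.1) k})
    fun y hy => mem_badSeeds_of_couplingBreak_le hy).trans ?_
  rw [Measure.prod_apply hmeas]
  refine (lintegral_le_add_measure_compl
    (a := ENNReal.ofReal (defectConst θ δ K c₀ * (1 / x + ε))) (fun ω => seedLaw_le_one n _)
    (G := {ω | (∑ i : Fin n, typeMoment δ (W i ω)) / n ≤ K ∧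
      c₀ ≤ muMean θ (fun v : Fin n => W v ω) ∧
      couplingError θ φ δ η k x (fun v : Fin n => W v ω) ≤ ε}) ?_).trans (add_le_add le_rfl ?_)
  · rintro ω ⟨h1, h2, h3⟩
    refine (seedLaw_badSeeds_le_couplingError hθ hδ hδ1 hη hη1 hn hK0 hc₀ hx hk h1 h2).trans
      (ENNReal.ofReal_le_ofReal ?_)
    exact mul_le_mul_of_nonneg_left (by linarith) (defectConst_nonneg hθ hK0 hc₀)
  · refine (measure_mono ?_).trans ((measure_union_le _ _).trans
      (add_le_add (measure_union_le _ _) le_rfl))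
    intro ω hω
    by_contra hc
    simp only [Set.mem_union, Set.mem_ofPred_eq, not_or, not_lt] at hc
    exact hω ⟨hc.1.1, hc.1.2, hc.2⟩

theorem tendsto_measure_couplingBreak (hWmeas : ∀ i, Measurable (W i)) (hWindep : iIndepFun W P)
    (hWident : ∀ i, IdentDistrib (W i) (W 0) P P) (hθ : 0 < θ)
    (hφmeas : ∀ n, Measurable
      fun y : VertexType × VertexType × (Fin n → VertexType) => φ n y.1 y.2.1 y.2.2)
    (hδ : 0 < δ) (hδ1 : δ ≤ 1) (hη : 0 < η) (hη1 : η ≤ 1)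
    (hmomPlus : Integrable (fun ω => wPlus (W 0 ω) ^ (1 + δ)) P)
    (hmomMinus : Integrable (fun ω => wMinus (W 0 ω) ^ 2) P)
    (hindep : IndepFun (fun ω => wPlus (W 0 ω)) (fun ω => wMinus (W 0 ω)) P)
    {k : ℕ → ℕ} {x : ℕ → ℝ} (hk : Tendsto k atTop atTop) (hx : Tendsto x atTop atTop)
    (herr : TendstoInMeasure P
      (fun (n : ℕ) ω => couplingError θ φ δ η (k n) (x n) (fun v : Fin n => W v ω))
      atTop (fun _ => 0)) :
    Tendsto (fun n : ℕ => (P.prod (seedLaw n))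
        {y | couplingBreak θ φ (fun v : Fin n => W v y.1) y.2 ≤ (k n : ℕ∞)})
      atTop (𝓝 0) := by
  have hT := integrable_typeMoment hmomPlus hmomMinus hindep
  have hplus : Integrable (fun ω => wPlus (W 0 ω)) P :=
    ((integrable_const (1 : ℝ)).add hmomPlus).mono'
      (measurable_wPlus.comp (hWmeas 0)).aestronglyMeasurable (Eventually.of_forall fun ω => by
        rw [Real.norm_of_nonneg (wPlus_nonneg _)]
        exact wPlus_le_one_add_rpow hδ _)
  have hminus : Integrable (fun ω => wMinus (W 0 ω)) P :=
    ((integrable_const (1 : ℝ)).add hmomMinus).mono'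
      (measurable_wMinus.comp (hWmeas 0)).aestronglyMeasurable (Eventually.of_forall fun ω => by
        rw [Real.norm_of_nonneg (wMinus_nonneg _)]
        change wMinus (W 0 ω) ≤ 1 + wMinus (W 0 ω) ^ 2
        nlinarith [sq_nonneg (wMinus (W 0 ω) - 1)])
  have hprod : Integrable (fun ω => wPlus (W 0 ω) * wMinus (W 0 ω)) P :=
    hindep.integrable_mul hplus hminus
  have hprod_eq : ∫ ω, wPlus (W 0 ω) * wMinus (W 0 ω) ∂P =
      (∫ ω, wPlus (W 0 ω) ∂P) * ∫ ω, wMinus (W 0 ω) ∂P :=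
    hindep.integral_mul_eq_mul_integral hplus.aestronglyMeasurable hminus.aestronglyMeasurable
  -- If `E[W⁺ W⁻] = E[W⁺] E[W⁻]` vanishes, one of the two nonnegative weights is a.s. zero and there
  -- are no edges.
  rcases (show 0 ≤ ∫ ω, wPlus (W 0 ω) * wMinus (W 0 ω) ∂P from integral_nonneg fun ω =>
    mul_nonneg (wPlus_nonneg _) (wMinus_nonneg _)).eq_or_lt with hzero | hpos
  · have hq : ∀ n : ℕ, ∀ᵐ ω ∂P, ∀ i j : Fin n, qRate θ (fun v : Fin n => W v ω) i j = 0 := by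
      rw [hprod_eq, eq_comm, mul_eq_zero] at hzero
      intro n
      rcases hzero with h | h
      · exact ae_qRate_eq_zero hWident measurable_wPlus
          ((integral_eq_zero_iff_of_nonneg (fun ω => wPlus_nonneg _) hplus).1 h)
          (fun v v' _ h' => by rw [h', mul_zero]) n
      · exact ae_qRate_eq_zero hWident measurable_wMinus
          ((integral_eq_zero_iff_of_nonneg (fun ω => wMinus_nonneg _) hminus).1 h)
          (fun v v' h' _ => by rw [h', zero_mul]) n
    simp only [fun n => measure_couplingBreak_eq_zero (φ := φ) (hq n) (k n)]
    exact tendsto_const_nhds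
  set a := ∫ ω, wPlus (W 0 ω) * wMinus (W 0 ω) ∂P with ha_def
  set K := ∫ ω, typeMoment δ (W 0 ω) ∂P + 1 with hK_def
  have hK0 : 0 < K := add_pos_of_nonneg_of_pos
    (integral_nonneg fun ω => typeMoment_nonneg _) zero_lt_one
  -- Half of the limit `a / θ` of `μ_n`; likewise `K` exceeds the limiting average of `typeMoment`
  -- by 1.
  set c₀ := a / 2 / θ with hc_def
  have hc₀ : 0 < c₀ := by positivity
  have hC : 0 ≤ defectConst θ δ K c₀ := defectConst_nonneg hθ hK0 hc₀
  set C := defectConst θ δ K c₀ with hC_def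
  have hlim1 : Tendsto (fun n : ℕ => P {ω | K < (∑ i : Fin n, typeMoment δ (W i ω)) / n})
      atTop (𝓝 0) := tendsto_measure_lt_of_tendstoInMeasure
    (tendstoInMeasure_average hWmeas hWindep hWident measurable_typeMoment hT) (lt_add_one _)
  have hlim2 : Tendsto (fun n : ℕ => P {ω | muMean θ (fun v : Fin n => W v ω) < c₀})
      atTop (𝓝 0) := by
    have h := tendstoInMeasure_average hWmeas hWindep hWident
      (g := fun v => -(wPlus v * wMinus v)) (measurable_wPlus.mul measurable_wMinus).neg hprod.neg
    rw [integral_neg, ← ha_def] at h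
    refine (tendsto_measure_lt_of_tendstoInMeasure h (b := -(a / 2)) (by linarith)).congr
      fun n => ?_
    congr 1
    ext ω
    simp only [Set.mem_ofPred_eq]
    rw [Finset.sum_neg_distrib, neg_div, neg_lt_neg_iff, hc_def, lt_div_iff₀ hθ, muMean, mul_inv]
    congr! 1
    field_simp
  rw [ENNReal.tendsto_nhds_zero]
  intro e he
  obtain ⟨r, hr0, hre⟩ := ENNReal.lt_iff_exists_nnreal_btwn.1 he
  have hr : (0 : ℝ) < r := by exact_mod_cast hr0
  -- Chosen so that `C * ε ≤ r`, which lies strictly below `e`; adding 1 avoids division by zero.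
  set ε := (r : ℝ) / (C + 1) with hε_def
  have hε : 0 < ε := by positivity
  have hlim3 : Tendsto (fun n : ℕ =>
      P {ω | ε < couplingError θ φ δ η (k n) (x n) (fun v : Fin n => W v ω)}) atTop (𝓝 0) :=
    tendsto_measure_lt_of_tendstoInMeasure herr hε
  have hlim0 : Tendsto (fun n => ENNReal.ofReal (C * (1 / x n + ε))) atTop
      (𝓝 (ENNReal.ofReal (C * (0 + ε)))) := by
    refine ENNReal.tendsto_ofReal (Tendsto.const_mul C (Tendsto.add_const ε ?_))
    simp only [one_div]
    exact hx.inv_tendsto_atTop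
  have hlim := hlim0.add ((hlim1.add hlim2).add hlim3)
  have hlt : ENNReal.ofReal (C * (0 + ε)) + (0 + 0 + 0) < e := by
    rw [add_zero, add_zero, add_zero, zero_add]
    refine lt_of_le_of_lt ?_ hre
    rw [← ENNReal.ofReal_coe_nnreal]
    refine ENNReal.ofReal_le_ofReal ?_
    rw [hε_def, mul_div_assoc', div_le_iff₀ (by positivity)]
    nlinarith
  filter_upwards [hlim.eventually (gt_mem_nhds hlt), hk.eventually_ge_atTop 1,
    hx.eventually_gt_atTop 0, eventually_gt_atTop 0] with n h1 h2 h3 h4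
  exact (measure_couplingBreak_le hWmeas hθ hδ hδ1 hη hη1 h4 (hφmeas n) hK0 hc₀ h3 h2).trans h1.le

end BreakProbability

theorem corollaryC {Ω : Type*} [MeasurableSpace Ω] (P : Measure Ω) [IsProbabilityMeasure P]
    (W : ℕ → Ω → VertexType) (φ : EdgeCorrection) (θ δ c η κ : ℝ)
    -- the types are i.i.d.
    (hWmeas : ∀ i, Measurable (W i))
    (hWindep : iIndepFun W P)
    (hWident : ∀ i, IdentDistrib (W i) (W 0) P P)
    -- the random digraph model
    (hθ : θ = ∫ ω, (wPlus (W 0 ω) + wMinus (W 0 ω)) ∂P)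
    (hθpos : 0 < θ)
    (hφmeas : ∀ n, Measurable
      fun y : VertexType × VertexType × (Fin n → VertexType) => φ n y.1 y.2.1 y.2.2)
    (hφgt : ∀ (n : ℕ) (i j : Fin n), i ≠ j →
      ∀ᵐ ω ∂P, -1 < phiTerm φ (fun v : Fin n => W v ω) i j)
    (hedges : ∀ᵐ ω ∂P, Tendsto
      (fun n : ℕ => (n : ℝ)⁻¹ * ∑ i : Fin n, ∑ j ∈ Finset.univ.erase i,
        edgeProb θ φ (fun v : Fin n => W v ω) i j)
      atTop (𝓝 ((∫ ω, wPlus (W 0 ω) ∂P) * (∫ ω, wMinus (W 0 ω) ∂P) / θ)))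
    -- part (a) of the assumption
    (hδ : 0 < δ) (hδ1 : δ ≤ 1) (hc : 0 < c) (hc1 : c < 1)
    (hmomPlus : Integrable (fun ω => wPlus (W 0 ω) ^ (1 + δ)) P)
    (hmomMinus : Integrable (fun ω => wMinus (W 0 ω) ^ 2) P)
    (hmomQ : Integrable (fun ω => persQ (W 0 ω)) P)
    (hweight : ∀ᵐ ω ∂P, |weightZ (W 0 ω)| ≤ c)
    (hindep : IndepFun (fun ω => (wPlus (W 0 ω), persQ (W 0 ω)))
      (fun ω => (wMinus (W 0 ω), weightZ (W 0 ω))) P)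
    -- part (b) of the assumption
    (hη : 0 < η) (hη1 : η ≤ 1) (hκ : 0 < κ)
    (hφsmall : ∀ (n : ℕ) (hn : 0 < n),
      1 - (n : ℝ) ^ (-κ) ≤ P.real {ω | ∀ j : Fin n, j ≠ ⟨0, hn⟩ →
        |phiTerm φ (fun v : Fin n => W v ω) ⟨0, hn⟩ j| ≤ (n : ℝ) ^ (-η) ∧
        |phiTerm φ (fun v : Fin n => W v ω) j ⟨0, hn⟩| ≤ (n : ℝ) ^ (-η)})
    -- the sequences `k_n` and `x_n`
    (k : ℕ → ℕ) (x : ℕ → ℝ) (hk : Tendsto k atTop atTop) (hx : Tendsto x atTop atTop)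
    (herr : TendstoInMeasure P
      (fun (n : ℕ) ω => couplingError θ φ δ η (k n) (x n) (fun v : Fin n => W v ω))
      atTop (fun _ => 0)) :
    (∀ n : ℕ,
      (P.prod (seedLaw n)) {y | graphRank θ φ (fun v : Fin n => W v y.1) y.2 (k n) ≠
          treeRank θ (fun v : Fin n => W v y.1) y.2 (k n)} ≤
        (P.prod (seedLaw n))
          {y | couplingBreak θ φ (fun v : Fin n => W v y.1) y.2 ≤ (k n : ℕ∞)}) ∧
    Tendsto (fun n : ℕ => (P.prod (seedLaw n))
        {y | couplingBreak θ φ (fun v : Fin n => W v y.1) y.2 ≤ (k n : ℕ∞)})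
      atTop (𝓝 0) := by
  
  refine ⟨fun n => measure_mono fun y hy => ?_, ?_⟩
  · by_contra h
    exact hy (graphRank_eq_treeRank_of_lt_couplingBreak h)
  · exact tendsto_measure_couplingBreak hWmeas hWindep hWident hθpos hφmeas hδ hδ1 hη hη1 hmomPlus
      hmomMinus (hindep.comp measurable_fst measurable_fst) hk hx herr
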